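/- **Setting.** Let $1\ge p_1\ge\dots\ge p_d>0$. The data distribution $\mathcal D$ on $\{-1,0,1\}^d$ has independent coordinates with $\Pr(x_i=0)=1-p_i$ and $\Pr(x_i=1)=\Pr(x_i=-1)=p_i/2$. The training data are $n$ i.i.d. rows $\mathbf x_1,\dots,\mathbf x_n\sim\mathcal D$, forming a matrix $X$, and labels $y=X\beta^*+\xi$, where $\xi\sim\mathcal N(0,\sigma^2I_n)$ is independent of $X$, $0\le\sigma\le1$ and $\max_i|\beta^*_i|\le B$. The estimator is $\hat\beta=(X^\top X)^\dagger X^\top y$. Fix a threshold $k$; features $1,\dots,k$ are called common and the others long-tail. Write $p_{>k}=\sum_{k<i\le d}p_i$, and let $X_{\le k}$, $X_{>k}$ be the common and the long-tail columns of $X$. Let $\mathcal F$ be the set of features that are non-zero in some training sample, and $\mathcal F_0$ the set of features that are non-zero in some training sample having no long-tail feature. For a set $\widetilde{\mathcal F}$ of features, $\mathcal D_{\widetilde{\mathcal F}}$ is $\mathcal D$ with each feature in $\widetilde{\mathcal F}$ forced to be non-zero with a uniform random sign, the other features keeping their own frequencies, independently. The averaged OOD loss of $\widetilde{\mathcal F}$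 is $$R(\widetilde{\mathcal F})=\mathbb E_{X_{\le k}}\,\mathbb E_{x\sim\mathcal D_{\widetilde{\mathcal F}}}\big[(\hat\beta^\top x-\beta^{*\top}x)^2\big],$$ where $\widetilde{\mathcal F}$, $X_{>k}$ and $\xi$ are held fixed and $X_{\le k}$ is averaged over its law. For $A\in\mathbb N$ put $c_{\log}=(\ln d)^A$; regime $\mathcal R_A$ means $c_{\log}<k<n/c_{\log}<d/c_{\log}^2$. **Theorem.** There is an absolute constant $c>0$ such that the following two statements hold. 1. For all constants $c_1,c_2,c_p,B>0$ there are $A$, $d_0$ and $C$ such that, whenever $d\ge d_0$, $\mathcal R_A$ holds, $c_1\ln^2d\le np_k\le c_2\ln^2 d$, $p_{>k}\le1-c_p$ and $np_{>k}^2<c$, with probability at least $0.99$ over $(X,\xi)$ every non-empty $\widetilde{\mathcal F}\subseteq\mathcal F\setminus\mathcal F_0$ satisfies $$R(\widetilde{\mathcal F})\le C\Big(p_{>k}+\sigma^2|\widetilde{\mathcal F}|\Big(\frac{k^2\ln^2d}{n}+\ln d\Big)\Big).$$ 2. For all constants $\alpha>2$ and $c_1,c_2,B>0$ there are $A$, $d_0$,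 $c_0>0$ and $C$ such that, if $p_i=\min\{1,s\,i^{-\alpha}/Z_\alpha\}$ with $s>0$ and $Z_\alpha=\sum_{i\le d}i^{-\alpha}$, then, whenever $d\ge d_0$, $\mathcal R_A$ holds, $s+\ln d<n^{c_0}$ and $c_1\ln^2d\le np_k\le c_2\ln^2 d$, with probability at least $0.99$ over $(X,\xi)$ every $\widetilde{\mathcal F}\subseteq\mathcal F\setminus\mathcal F_0$ satisfies $$R(\widetilde{\mathcal F})\le C\Big(s\Big(\frac{\ln^2d}{ns}\Big)^{1-\frac1\alpha}+\sigma^2|\widetilde{\mathcal F}|\ln d\Big).$$ -/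

import Mathlib

open MeasureTheory ProbabilityTheory

namespace LongTail

noncomputable section

/-- The law of one feature of frequency `q`: it is `0` with probability `1 - q`, and `1` and `-1`
with probability `q / 2` each. -/
def featureLaw (q : ℝ) : Measure ℝ :=
  ENNReal.ofReal (1 - q) • Measure.dirac 0 +
    (ENNReal.ofReal (q / 2) • Measure.dirac 1 + ENNReal.ofReal (q / 2) • Measure.dirac (-1))

theorem featureLaw_isProbabilityMeasure {q : ℝ} (h0 : 0 ≤ q) (h1 : q ≤ 1) :
    IsProbabilityMeasure (featureLaw q) := by
  constructor
  simp only [featureLaw, Measure.add_apply, Measure.smul_apply, measure_univ, smul_eq_mul, mul_one]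
  rw [← ENNReal.ofReal_add (by positivity) (by positivity),
    ← ENNReal.ofReal_add (by linarith) (by positivity)]
  simp

/-- The law of a test point when the features in `T` are forced to be non-zero (with uniform
random sign), every other feature keeping its own frequency. Features are numbered `1, …, d`:
the coordinate `j : Fin d` is the feature number `j + 1` and has frequency `p (j + 1)`.
For `T = ∅` this is the original data distribution. -/
def oodLaw (d : ℕ) (p : ℕ → ℝ) (T : Finset (Fin d)) : Measure (Fin d → ℝ) :=
  Measure.pi fun j => featureLaw (if j ∈ T then 1 else p (j + 1))

/-- The law of one data point: independent features, feature number `i` having frequency `p i`. -/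
def dataLaw (d : ℕ) (p : ℕ → ℝ) : Measure (Fin d → ℝ) :=
  Measure.pi fun j => featureLaw (p (j + 1))

/-- The law of the `n × d` design matrix: `n` independent data points as rows. -/
def designLaw (n d : ℕ) (p : ℕ → ℝ) : Measure (Fin n → Fin d → ℝ) :=
  Measure.pi fun _ => dataLaw d p

/-- The law of the label noise: `n` independent centred Gaussians of variance `σ ^ 2`. -/
def noiseLaw (n : ℕ) (σ : ℝ) : Measure (Fin n → ℝ) :=
  Measure.pi fun _ => gaussianReal 0 (σ ^ 2).toNNReal

/-- The law of the training data: the design matrix and, independently of it, the label noise. -/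
def trainLaw (n d : ℕ) (p : ℕ → ℝ) (σ : ℝ) : Measure ((Fin n → Fin d → ℝ) × (Fin n → ℝ)) :=
  (designLaw n d p).prod (noiseLaw n σ)

/-- The labels `X β + ξ`. -/
def labels {n d : ℕ} (X : Fin n → Fin d → ℝ) (β : Fin d → ℝ) (ξ : Fin n → ℝ) : Fin n → ℝ :=
  Matrix.mulVec (Matrix.of X) β + ξ

/-- The Moore-Penrose pseudoinverse of a real symmetric matrix: in an orthonormal eigenbasis,
invert the non-zero eigenvalues and keep the zero ones (`0⁻¹ = 0`). -/
def symPinv {d : ℕ} (A : Matrix (Fin d) (Fin d) ℝ) (hA : A.IsHermitian) :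
    Matrix (Fin d) (Fin d) ℝ :=
  (hA.eigenvectorUnitary : Matrix (Fin d) (Fin d) ℝ) *
    Matrix.diagonal (fun i => (hA.eigenvalues i)⁻¹) *
      star (hA.eigenvectorUnitary : Matrix (Fin d) (Fin d) ℝ)

/-- The four Penrose equations, which characterize the pseudoinverse. -/
theorem symPinv_penrose {d : ℕ} (A : Matrix (Fin d) (Fin d) ℝ) (hA : A.IsHermitian) :
    A * symPinv A hA * A = A ∧ symPinv A hA * A * symPinv A hA = symPinv A hA ∧
      (A * symPinv A hA).transpose = A * symPinv A hA ∧
      (symPinv A hA * A).transpose = symPinv A hA * A := by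
  obtain ⟨U, D, hU, hAU, hB⟩ : ∃ (U : Matrix (Fin d) (Fin d) ℝ) (D : Fin d → ℝ),
      U.transpose * U = 1 ∧ A = U * Matrix.diagonal D * U.transpose ∧
      symPinv A hA = U * Matrix.diagonal (fun i => (D i)⁻¹) * U.transpose := by
    refine ⟨hA.eigenvectorUnitary, hA.eigenvalues, ?_, ?_, ?_⟩
    · have := Unitary.coe_star_mul_self hA.eigenvectorUnitary
      simpa [Matrix.star_eq_conjTranspose] using this
    · have := hA.spectral_theorem
      simpa [Matrix.star_eq_conjTranspose, Unitary.conjStarAlgAut_apply, Function.comp_def]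
        using this
    · simp [symPinv, Matrix.star_eq_conjTranspose]
  have key : ∀ a b : Fin d → ℝ,
      (U * Matrix.diagonal a * U.transpose) * (U * Matrix.diagonal b * U.transpose) =
        U * Matrix.diagonal (fun i => a i * b i) * U.transpose := by
    intro a b
    calc _ = U * Matrix.diagonal a * (U.transpose * U) * Matrix.diagonal b * U.transpose := by
          simp only [Matrix.mul_assoc]
      _ = _ := by
          rw [hU, Matrix.mul_one, Matrix.mul_assoc U, Matrix.diagonal_mul_diagonal]
  have symm : ∀ a : Fin d → ℝ, (U * Matrix.diagonal a * U.transpose).transpose =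
      U * Matrix.diagonal a * U.transpose := by
    intro a
    simp [Matrix.transpose_mul, Matrix.mul_assoc]
  rw [hB]
  rw [hAU]
  simp only [key, symm, and_true]
  constructor
  · congr; ext i; by_cases h : D i = 0 <;> simp [h]
  · congr; ext i; by_cases h : D i = 0 <;> simp [h]

/-- The estimator `(Xᵀ X)† Xᵀ y`, the limit of gradient descent on the square loss from `0`. -/
def betaHat {n d : ℕ} (X : Fin n → Fin d → ℝ) (y : Fin n → ℝ) : Fin d → ℝ :=
  Matrix.mulVec
    (symPinv ((Matrix.of X).transpose * Matrix.of X)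
      (by simpa using Matrix.isHermitian_conjTranspose_mul_self (Matrix.of X)))
    (Matrix.mulVec (Matrix.of X).transpose y)

open Classical in
/-- The features that appear in the data. -/
def seen {n d : ℕ} (X : Fin n → Fin d → ℝ) : Finset (Fin d) :=
  Finset.univ.filter fun j => ∃ i, X i j ≠ 0

open Classical in
/-- The features that appear in some sample all of whose non-zero entries are among the
features numbered `1, …, k`. -/
def seenCommon {n d : ℕ} (k : ℕ) (X : Fin n → Fin d → ℝ) : Finset (Fin d) :=
  Finset.univ.filter fun j =>
    ∃ i, (∀ l : Fin d, k < (l : ℕ) + 1 → X i l = 0) ∧ X i j ≠ 0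

/-- The design matrix whose common part (features `1, …, k`) is that of `H` and whose long-tail
part (features `k + 1, …, d`) is that of `X`. -/
def mixHead {n d : ℕ} (k : ℕ) (H X : Fin n → Fin d → ℝ) : Fin n → Fin d → ℝ :=
  fun i j => if (j : ℕ) + 1 ≤ k then H i j else X i j

/-- The OOD loss of the coefficient vector `b` when the features in `T` are forced to be
non-zero. -/
def oodLoss {d : ℕ} (p : ℕ → ℝ) (β : Fin d → ℝ) (T : Finset (Fin d)) (b : Fin d → ℝ) : ℝ :=
  ∫ x, (b ⬝ᵥ x - β ⬝ᵥ x) ^ 2 ∂(oodLaw d p T)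

/-- The OOD loss of the estimator, averaged over the common part of the training data, the
long-tail part of `X` and the noise `ξ` being fixed. -/
def avgOodLoss {n d : ℕ} (k : ℕ) (p : ℕ → ℝ) (β : Fin d → ℝ) (T : Finset (Fin d))
    (X : Fin n → Fin d → ℝ) (ξ : Fin n → ℝ) : ℝ :=
  ∫ H, oodLoss p β T (betaHat (mixHead k H X) (labels (mixHead k H X) β ξ)) ∂(designLaw n d p)

/-- The tail probability `∑_{k < i ≤ d} p i`. -/
def tailProb (d k : ℕ) (p : ℕ → ℝ) : ℝ := ∑ i ∈ Finset.Ioc k d, p i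

/-- Admissible feature frequencies: `1 ≥ p 1 ≥ ⋯ ≥ p d > 0`. -/
def IsFrequency (d : ℕ) (p : ℕ → ℝ) : Prop :=
  (∀ i ∈ Finset.Icc 1 d, 0 < p i ∧ p i ≤ 1) ∧
    ∀ i ∈ Finset.Icc 1 d, ∀ j ∈ Finset.Icc 1 d, i ≤ j → p j ≤ p i

/-- The truncated power law `p i = min {1, s i ^ (-α) / Z}`, `Z = ∑_{1 ≤ i ≤ d} i ^ (-α)`. -/
def powerLaw (d : ℕ) (s α : ℝ) (i : ℕ) : ℝ :=
  min 1 (s * (i : ℝ) ^ (-α) / ∑ l ∈ Finset.Icc 1 d, (l : ℝ) ^ (-α))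

/-- The parameter regime `c < k < n / c < d / c ^ 2`, where `c = (ln d) ^ A`. -/
def Regime (A d n k : ℕ) : Prop :=
  Real.log d ^ A < k ∧ (k : ℝ) < n / Real.log d ^ A ∧
    (n : ℝ) / Real.log d ^ A < d / (Real.log d ^ A) ^ 2

end

end LongTail

/-! The features are independent and centred, so the OOD loss of `b` equals `∑ w_j (b_j - β_j)²`
with `w_j = 1` on `T` and `w_j = p_j` elsewhere (`oodLoss_eq`). The error of the estimator is `X†ξ`
minus the component of `β` in the kernel of `X` (`betaHat_sub`). It remains to show that the rows of
`X†` are short and that the kernel component vanishes on the features seen, on average over the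
common columns.

With high probability no sample has two long-tail features and three quarters of the samples are
clean, that is, have none. Fix such a long-tail part. The common entries are still independent of
it, hence of the set `I` of clean rows. Suppose that each common column `a` is separated from the
others on `I`: `δ_a z_a² ≤ ‖X_I z‖²` with `δ_a = n p_a / 8`. Then common coefficients are determined
by the clean rows, and row `a` of `X†` has squared norm at most `1 / δ_a`. A long-tail feature `l`
seen in row `i` is recovered from that row after subtraction of the common part, so its squared row
norm is at most `1` plus the leverage of row `i` over `I`. Row `i` is not clean, so its common
entries are independent of those in `I` and its mean leverage is at most `∑ p_a / δ_a ≤ 8k/n`. The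
averaged squared noise in coordinate `l` is therefore a quadratic form in `ξ` of trace at most `9`,
with exponential tails, and is `O(σ² ln d)` for all `l` at once. The noise weighted by the
frequencies has mean `O(σ² (p_{>k} + k/n))`, to which Markov's inequality applies. The bias lives on
unseen long-tail features and is at most `B² p_{>k}`.

Since the loss is an average over the common columns, exceptional common columns cannot be
discarded: on them `X†` may be huge. They are controlled by the number `N` of bad columns (`badNum`)
through two estimates. Deterministically, all squared row norms are at most `d ^ (20 N + 27)`
(`rowNorm_le_pow`): the bad coefficients solve an integer linear system in at most `N` unknowns,
which has a solution bounded by Cramer's rule. Probabilistically, the mean of `(d ^ 60) ^ N` is at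
most `2` (`mean_pow_badNum_le`). Together the exceptional part contributes at most `d ^ (-12)` per
coordinate.

The exponential moment is obtained by peeling off bad columns one at a time, each with the rows `U`
of its support, so that what remains is independent of the signs of the peeled column. A column is
bad only if `U` is small, which Chernoff's bound excludes, or if the column is close to the span of
the others. For random signs the latter has probability `exp(-|U|/16)` as soon as that span has
small total leverage on `U` (`sum_flip_near_le`). The leverage is small because rows in `U` are
fresh relative to the remaining rows, and a fresh row is typically dominated by them. This last fact
is a leave-one-out argument based on the leverages of all rows summing to at most the number of
columns (`mean_sparse_le`).

For general frequencies, if `n p_{>k}` is tiny then no long-tail feature is seen and there is no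
non-empty `T`; otherwise `1 / d²` is absorbed by `p_{>k}`. For power laws, `p_{>k} ≤ k p_k` and `k ≲
(n s / ln² d)^(1/α)`, so `n p_{>k}²` is small because `α > 2`, and every term free of `T` is of
order `k ln² d / n`, which is bounded by a multiple of the claimed rate. -/

namespace LongTail

noncomputable section

/-! ### Means over random sign matrices -/

/-- The indicator of a proposition, as a real number. -/
def ind (P : Prop) : ℝ := by
  classical exact if P then 1 else 0

theorem ind_of {P : Prop} (h : P) : ind P = 1 := by simp [ind, h]

theorem ind_of_not {P : Prop} (h : ¬P) : ind P = 0 := by simp [ind, h]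

theorem ind_nonneg (P : Prop) : 0 ≤ ind P := by
  unfold ind; split_ifs <;> norm_num

theorem ind_le_one (P : Prop) : ind P ≤ 1 := by
  unfold ind; split_ifs <;> norm_num

theorem ind_mono {P Q : Prop} (h : P → Q) : ind P ≤ ind Q := by
  by_cases hP : P
  · rw [ind_of hP, ind_of (h hP)]
  · rw [ind_of_not hP]; exact ind_nonneg Q

theorem ind_and (P Q : Prop) : ind (P ∧ Q) = ind P * ind Q := by
  by_cases hP : P <;> by_cases hQ : Q <;> simp [ind, hP, hQ]

theorem ind_not (P : Prop) : ind (¬P) = 1 - ind P := by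
  by_cases hP : P <;> simp [ind, hP]

/-- The weight of the sign `s` as the value of a feature of frequency `q`. -/
def signWeight (q : ℝ) (s : SignType) : ℝ := if s = 0 then 1 - q else q / 2

theorem signWeight_nonneg {q : ℝ} (h : 0 ≤ q ∧ q ≤ 1) (s : SignType) : 0 ≤ signWeight q s := by
  unfold signWeight; split_ifs <;> linarith

theorem sum_signType (f : SignType → ℝ) : ∑ s, f s = f 0 + f 1 + f (-1) := by
  have : (Finset.univ : Finset SignType) = {0, 1, -1} := by decide
  rw [this, Finset.sum_insert (by decide), Finset.sum_insert (by decide), Finset.sum_singleton]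
  ring

theorem sum_signWeight (q : ℝ) : ∑ s, signWeight q s = 1 := by
  rw [sum_signType]; simp [signWeight]; ring

theorem signWeight_neg (q : ℝ) (s : SignType) : signWeight q (-s) = signWeight q s := by
  simp [signWeight]

variable {ι κ : Type*} [Fintype ι] [Fintype κ] [DecidableEq ι] [DecidableEq κ]

/-- The weight of a sign vector. -/
def rowWeight (q : κ → ℝ) (g : κ → SignType) : ℝ := ∏ j, signWeight (q j) (g j)

/-- The weight of a sign matrix. -/
def matWeight (q : κ → ℝ) (Y : ι → κ → SignType) : ℝ := ∏ i, rowWeight q (Y i)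

/-- The mean over a random sign vector. -/
def rowMean (q : κ → ℝ) (f : (κ → SignType) → ℝ) : ℝ := ∑ g, rowWeight q g * f g

/-- The mean over a random sign matrix. -/
def mean (q : κ → ℝ) (f : (ι → κ → SignType) → ℝ) : ℝ := ∑ Y, matWeight q Y * f Y

/-- Frequencies lie in the unit interval. -/
def IsProb (q : κ → ℝ) : Prop := ∀ j, 0 ≤ q j ∧ q j ≤ 1

omit [DecidableEq κ] in
theorem rowWeight_nonneg {q : κ → ℝ} (hq : IsProb q) (g : κ → SignType) : 0 ≤ rowWeight q g :=
  Finset.prod_nonneg fun j _ => signWeight_nonneg (hq j) _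

omit [DecidableEq ι] [DecidableEq κ] in
theorem matWeight_nonneg {q : κ → ℝ} (hq : IsProb q) (Y : ι → κ → SignType) :
    0 ≤ matWeight q Y :=
  Finset.prod_nonneg fun _ _ => rowWeight_nonneg hq _

theorem rowMean_prod (q : κ → ℝ) (f : κ → SignType → ℝ) :
    rowMean q (fun g => ∏ j, f j (g j)) = ∏ j, ∑ s, signWeight (q j) s * f j s := by
  rw [Finset.prod_univ_sum]
  simp only [rowMean, rowWeight, ← Finset.prod_mul_distrib, Fintype.piFinset_univ]

theorem sum_rowWeight (q : κ → ℝ) : ∑ g, rowWeight q g = 1 := by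
  have := rowMean_prod q (fun _ _ => 1)
  simpa [rowMean, sum_signWeight] using this

theorem mean_prod (q : κ → ℝ) (f : ι → (κ → SignType) → ℝ) :
    mean q (fun Y => ∏ i, f i (Y i)) = ∏ i, rowMean q (f i) := by
  unfold rowMean
  rw [Finset.prod_univ_sum]
  simp only [mean, matWeight, ← Finset.prod_mul_distrib, Fintype.piFinset_univ]

theorem sum_matWeight (q : κ → ℝ) : ∑ Y : ι → κ → SignType, matWeight q Y = 1 := by
  have := mean_prod (ι := ι) q (fun _ _ => 1)
  simpa [rowMean, mean, sum_rowWeight] using this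

theorem rowMean_const (q : κ → ℝ) (c : ℝ) : rowMean q (fun _ => c) = c := by
  simp [rowMean, ← Finset.sum_mul, sum_rowWeight]

theorem mean_const (q : κ → ℝ) (c : ℝ) : mean (ι := ι) q (fun _ => c) = c := by
  simp [mean, ← Finset.sum_mul, sum_matWeight]

theorem rowMean_mono {q : κ → ℝ} (hq : IsProb q) {f g : (κ → SignType) → ℝ}
    (h : ∀ x, f x ≤ g x) : rowMean q f ≤ rowMean q g :=
  Finset.sum_le_sum fun x _ => mul_le_mul_of_nonneg_left (h x) (rowWeight_nonneg hq x)

theorem rowMean_nonneg {q : κ → ℝ} (hq : IsProb q) {f : (κ → SignType) → ℝ}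
    (h : ∀ x, 0 ≤ f x) : 0 ≤ rowMean q f :=
  Finset.sum_nonneg fun x _ => mul_nonneg (rowWeight_nonneg hq x) (h x)

theorem mean_mono {q : κ → ℝ} (hq : IsProb q) {f g : (ι → κ → SignType) → ℝ}
    (h : ∀ Y, f Y ≤ g Y) : mean q f ≤ mean q g :=
  Finset.sum_le_sum fun x _ => mul_le_mul_of_nonneg_left (h x) (matWeight_nonneg hq x)

theorem mean_nonneg {q : κ → ℝ} (hq : IsProb q) {f : (ι → κ → SignType) → ℝ}
    (h : ∀ Y, 0 ≤ f Y) : 0 ≤ mean q f :=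
  Finset.sum_nonneg fun x _ => mul_nonneg (matWeight_nonneg hq x) (h x)

theorem mean_add (q : κ → ℝ) (f g : (ι → κ → SignType) → ℝ) :
    mean q (fun Y => f Y + g Y) = mean q f + mean q g := by
  simp [mean, mul_add, Finset.sum_add_distrib]

theorem mean_sub (q : κ → ℝ) (f g : (ι → κ → SignType) → ℝ) :
    mean q (fun Y => f Y - g Y) = mean q f - mean q g := by
  simp [mean, mul_sub, Finset.sum_sub_distrib]

theorem mean_mul_left (q : κ → ℝ) (c : ℝ) (f : (ι → κ → SignType) → ℝ) :
    mean q (fun Y => c * f Y) = c * mean q f := by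
  simp only [mean, Finset.mul_sum]
  exact Finset.sum_congr rfl fun _ _ => by ring

theorem mean_mul_right (q : κ → ℝ) (c : ℝ) (f : (ι → κ → SignType) → ℝ) :
    mean q (fun Y => f Y * c) = mean q f * c := by
  simp only [mean, Finset.sum_mul]
  exact Finset.sum_congr rfl fun _ _ => by ring

theorem mean_sum {α : Type*} (s : Finset α) (q : κ → ℝ) (f : α → (ι → κ → SignType) → ℝ) :
    mean q (fun Y => ∑ a ∈ s, f a Y) = ∑ a ∈ s, mean q (f a) := by
  simp only [mean, Finset.mul_sum]
  rw [Finset.sum_comm]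

theorem rowMean_mul_left (q : κ → ℝ) (c : ℝ) (f : (κ → SignType) → ℝ) :
    rowMean q (fun Y => c * f Y) = c * rowMean q f := by
  simp only [rowMean, Finset.mul_sum]
  exact Finset.sum_congr rfl fun _ _ => by ring

theorem rowMean_add (q : κ → ℝ) (f g : (κ → SignType) → ℝ) :
    rowMean q (fun Y => f Y + g Y) = rowMean q f + rowMean q g := by
  simp [rowMean, mul_add, Finset.sum_add_distrib]

theorem rowMean_sum {α : Type*} (s : Finset α) (q : κ → ℝ) (f : α → (κ → SignType) → ℝ) :
    rowMean q (fun Y => ∑ a ∈ s, f a Y) = ∑ a ∈ s, rowMean q (f a) := by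
  simp only [rowMean, Finset.mul_sum]
  rw [Finset.sum_comm]

/-- The mean of a function of one row. -/
theorem mean_row (q : κ → ℝ) (i : ι) (f : (κ → SignType) → ℝ) :
    mean q (fun Y : ι → κ → SignType => f (Y i)) = rowMean q f := by
  have := mean_prod (ι := ι) q (fun i' g => if i' = i then f g else 1)
  simp only [Finset.prod_ite_eq', Finset.mem_univ, if_true] at this
  rw [this, Finset.prod_eq_single i (fun j _ hj => by simp [hj, rowMean_const]) (by simp)]
  simp

/-- The mean of a product of functions of the rows in a set. -/
theorem mean_prod_finset (q : κ → ℝ) (U : Finset ι) (f : (κ → SignType) → ℝ) :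
    mean q (fun Y : ι → κ → SignType => ∏ i ∈ U, f (Y i)) = rowMean q f ^ U.card := by
  have := mean_prod (ι := ι) q (fun i' g => if i' ∈ U then f g else 1)
  simp only [Finset.prod_ite_mem, Finset.univ_inter] at this
  rw [this]
  have h2 : ∀ i, rowMean q (fun g => if i ∈ U then f g else 1) =
      if i ∈ U then rowMean q f else 1 := by
    intro i; split_ifs <;> simp [rowMean_const]
  simp [h2, Finset.prod_ite_mem]

/-- The mean of a function of one feature. -/
theorem rowMean_coord (q : κ → ℝ) (a : κ) (f : SignType → ℝ) :
    rowMean q (fun g => f (g a)) = ∑ s, signWeight (q a) s * f s := by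
  have := rowMean_prod q (fun i' g => if i' = a then f g else 1)
  simp only [Finset.prod_ite_eq', Finset.mem_univ, if_true] at this
  rw [this, Finset.prod_eq_single a (fun j _ hj => by simp [hj, sum_signWeight]) (by simp)]
  simp

theorem rowMean_two (q : κ → ℝ) {a b : κ} (hab : a ≠ b) (f f' : SignType → ℝ) :
    rowMean q (fun g => f (g a) * f' (g b)) =
      (∑ s, signWeight (q a) s * f s) * ∑ s, signWeight (q b) s * f' s := by
  have := rowMean_prod q (fun i' g => (if i' = a then f g else 1) * (if i' = b then f' g else 1))
  simp only [Finset.prod_mul_distrib, Finset.prod_ite_eq', Finset.mem_univ, if_true] at this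
  rw [this, ← Finset.mul_prod_erase _ _ (Finset.mem_univ a),
    ← Finset.mul_prod_erase _ _ (Finset.mem_erase.2 ⟨hab.symm, Finset.mem_univ b⟩),
    Finset.prod_eq_one]
  · simp [hab, hab.symm]
  · intro x hx
    simp only [Finset.mem_erase] at hx
    simp [hx.1, hx.2.1, sum_signWeight]

theorem rowMean_mul_coord (q : κ → ℝ) (a b : κ) :
    rowMean q (fun g => (g a : ℝ) * (g b : ℝ)) = if a = b then q a else 0 := by
  split_ifs with h
  · subst h
    rw [rowMean_coord q a (fun s => (s : ℝ) * s), sum_signType]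
    simp [signWeight]
  · rw [rowMean_two q h (fun s => (s : ℝ)) (fun s => (s : ℝ)), sum_signType]
    simp [signWeight]

/-- Second moments of linear forms in a random sign vector. -/
theorem rowMean_sq (q : κ → ℝ) (c : κ → ℝ) :
    rowMean q (fun g => (∑ j, c j * (g j : ℝ)) ^ 2) = ∑ j, q j * c j ^ 2 := by
  have : ∀ g : κ → SignType, (∑ j, c j * (g j : ℝ)) ^ 2 =
      ∑ a, ∑ b, (c a * c b) * ((g a : ℝ) * (g b : ℝ)) := by
    intro g
    rw [sq, Finset.sum_mul_sum]
    exact Finset.sum_congr rfl fun _ _ => Finset.sum_congr rfl fun _ _ => by ring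
  simp only [this, rowMean_sum, rowMean_mul_left, rowMean_mul_coord]
  simp only [mul_ite, mul_zero, Finset.sum_ite_eq, Finset.mem_univ, if_true]
  exact Finset.sum_congr rfl fun _ _ => by ring

/-- The mean of a quadratic form in a random sign vector. -/
theorem rowMean_quad (q : κ → ℝ) (A : κ → κ → ℝ) :
    rowMean q (fun g => ∑ a, ∑ b, A a b * ((g a : ℝ) * (g b : ℝ))) = ∑ a, q a * A a a := by
  simp only [rowMean_sum, rowMean_mul_left, rowMean_mul_coord]
  simp only [mul_ite, mul_zero, Finset.sum_ite_eq, Finset.mem_univ, if_true]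
  exact Finset.sum_congr rfl fun _ _ => by ring

/-! ### Resampling -/

/-- The matrix with the entries of `Y'` on `A` and those of `Y` elsewhere. -/
def merge (A : ι → κ → Prop) (Y' Y : ι → κ → SignType) : ι → κ → SignType := by
  classical exact fun i j => if A i j then Y' i j else Y i j

omit [Fintype ι] [Fintype κ] [DecidableEq ι] [DecidableEq κ] in
theorem merge_of {A : ι → κ → Prop} {i : ι} {j : κ} (h : A i j) (Y' Y : ι → κ → SignType) :
    merge A Y' Y i j = Y' i j := by simp [merge, h]

omit [Fintype ι] [Fintype κ] [DecidableEq ι] [DecidableEq κ] in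
theorem merge_of_not {A : ι → κ → Prop} {i : ι} {j : κ} (h : ¬A i j)
    (Y' Y : ι → κ → SignType) : merge A Y' Y i j = Y i j := by simp [merge, h]

omit [DecidableEq ι] [DecidableEq κ] in
theorem matWeight_merge (q : κ → ℝ) (A : ι → κ → Prop) (Y' Y : ι → κ → SignType) :
    matWeight q (merge A Y' Y) * matWeight q (merge A Y Y') = matWeight q Y * matWeight q Y' := by
  simp only [matWeight, rowWeight, ← Finset.prod_mul_distrib]
  refine Finset.prod_congr rfl fun i _ => Finset.prod_congr rfl fun j _ => ?_
  by_cases h : A i j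
  · simp [merge_of h, mul_comm]
  · simp [merge_of_not h]

omit [Fintype ι] [Fintype κ] [DecidableEq ι] [DecidableEq κ] in
theorem merge_merge (A : ι → κ → Prop) (Y' Y : ι → κ → SignType) :
    merge A (merge A Y Y') (merge A Y' Y) = Y := by
  funext i j
  by_cases h : A i j
  · simp [merge_of h]
  · simp [merge_of_not h]

/-- Resampling the entries in `A` does not change the mean. -/
theorem mean_resample (q : κ → ℝ) (A : ι → κ → Prop) (f : (ι → κ → SignType) → ℝ) :
    mean q f = mean q (fun Y => mean q (fun Y' => f (merge A Y' Y))) := by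
  have h1 : mean q (fun Y => mean q (fun Y' => f (merge A Y' Y))) =
      ∑ z : (ι → κ → SignType) × (ι → κ → SignType),
        matWeight q z.1 * matWeight q z.2 * f (merge A z.2 z.1) := by
    rw [Fintype.sum_prod_type]
    simp only [mean, Finset.mul_sum, mul_assoc]
  have h2 : mean q f = ∑ z : (ι → κ → SignType) × (ι → κ → SignType),
        matWeight q z.1 * matWeight q z.2 * f z.1 := by
    rw [Fintype.sum_prod_type]
    simp only [mean]
    refine Finset.sum_congr rfl fun Y _ => ?_
    rw [← Finset.sum_mul, ← Finset.mul_sum, sum_matWeight, mul_one]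
  rw [h1, h2]
  -- Exchanging the entries in `A` between two independent copies is an involution which preserves
  -- the product weight.
  let e : (ι → κ → SignType) × (ι → κ → SignType) ≃
      (ι → κ → SignType) × (ι → κ → SignType) :=
    { toFun := fun z => (merge A z.2 z.1, merge A z.1 z.2)
      invFun := fun z => (merge A z.2 z.1, merge A z.1 z.2)
      left_inv := fun z => by simp [merge_merge]
      right_inv := fun z => by simp [merge_merge] }
  rw [← Equiv.sum_comp e]
  refine Finset.sum_congr rfl fun z _ => ?_
  show matWeight q (merge A z.2 z.1) * matWeight q (merge A z.1 z.2) * f (merge A z.2 z.1) = _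
  rw [matWeight_merge]

/-- `f` depends only on the entries in `A`. -/
def DependsOnly (A : ι → κ → Prop) {α : Type*} (f : (ι → κ → SignType) → α) : Prop :=
  ∀ Y Y', (∀ i j, A i j → Y i j = Y' i j) → f Y = f Y'

omit [Fintype ι] [Fintype κ] [DecidableEq ι] [DecidableEq κ] in
theorem DependsOnly.merge_eq {A : ι → κ → Prop} {α : Type*} {f : (ι → κ → SignType) → α}
    (h : DependsOnly A f) (Y' Y : ι → κ → SignType) : f (merge A Y' Y) = f Y' :=
  h _ _ fun _ _ hA => merge_of hA _ _

omit [Fintype ι] [Fintype κ] [DecidableEq ι] [DecidableEq κ] in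
theorem DependsOnly.merge_eq_of_not {A B : ι → κ → Prop} {α : Type*}
    {f : (ι → κ → SignType) → α}
    (h : DependsOnly B f) (hAB : ∀ i j, B i j → ¬A i j) (Y' Y : ι → κ → SignType) :
    f (merge A Y' Y) = f Y :=
  h _ _ fun i j hA => merge_of_not (hAB i j hA) _ _

/-- Functions of disjoint sets of entries are independent. -/
theorem mean_mul_of_dependsOnly (q : κ → ℝ) {A B : ι → κ → Prop} (hAB : ∀ i j, B i j → ¬A i j)
    {f g : (ι → κ → SignType) → ℝ} (hf : DependsOnly A f) (hg : DependsOnly B g) :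
    mean q (fun Y => f Y * g Y) = mean q f * mean q g := by
  rw [mean_resample q A]
  simp only [hf.merge_eq, hg.merge_eq_of_not hAB, mean_mul_right]
  rw [mean_mul_left]

/-! ### Symmetry under sign changes, and Markov's inequality. -/

/-- Change the signs in column `a` in the rows where `s` is true. -/
def flip (a : κ) (s : ι → Bool) (Y : ι → κ → SignType) : ι → κ → SignType :=
  fun i j => if j = a ∧ s i = true then -Y i j else Y i j

omit [DecidableEq ι] in
theorem matWeight_flip (q : κ → ℝ) (a : κ) (s : ι → Bool) (Y : ι → κ → SignType) :
    matWeight q (flip a s Y) = matWeight q Y := by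
  refine Finset.prod_congr rfl fun i _ => Finset.prod_congr rfl fun j _ => ?_
  unfold flip
  split_ifs
  · rw [signWeight_neg]
  · rfl

omit [Fintype ι] [Fintype κ] [DecidableEq ι] in
theorem flip_flip (a : κ) (s : ι → Bool) (Y : ι → κ → SignType) : flip a s (flip a s Y) = Y := by
  funext i j
  unfold flip
  split_ifs <;> simp

theorem mean_flip (q : κ → ℝ) (a : κ) (s : ι → Bool) (f : (ι → κ → SignType) → ℝ) :
    mean q (fun Y => f (flip a s Y)) = mean q f := by
  let e : (ι → κ → SignType) ≃ (ι → κ → SignType) :=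
    ⟨flip a s, flip a s, flip_flip a s, flip_flip a s⟩
  unfold mean
  rw [← Equiv.sum_comp e]
  exact Finset.sum_congr rfl fun Y _ => by
    show matWeight q (flip a s Y) * f (flip a s (flip a s Y)) = _
    rw [matWeight_flip, flip_flip]

/-- Averaging over the signs of a column does not change the mean. -/
theorem mean_flip_average (q : κ → ℝ) (a : κ) (f : (ι → κ → SignType) → ℝ) :
    mean q f = mean q (fun Y => (∑ s : ι → Bool, f (flip a s Y)) / 2 ^ Fintype.card ι) := by
  simp only [div_eq_mul_inv]
  rw [mean_mul_right, mean_sum]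
  simp only [mean_flip, Finset.sum_const, Finset.card_univ, Fintype.card_fun, Fintype.card_bool,
    nsmul_eq_mul]
  push_cast
  field_simp

/-- Markov's inequality. -/
theorem mean_ind_le {q : κ → ℝ} (hq : IsProb q) {f : (ι → κ → SignType) → ℝ}
    (hf : ∀ Y, 0 ≤ f Y) {t : ℝ} (ht : 0 < t) :
    mean q (fun Y => ind (t ≤ f Y)) ≤ mean q f / t := by
  rw [div_eq_mul_inv, ← mean_mul_right]
  refine mean_mono hq fun Y => ?_
  by_cases h : t ≤ f Y
  · rw [ind_of h, ← div_eq_mul_inv, le_div_iff₀ ht]; linarith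
  · rw [ind_of_not h]; exact mul_nonneg (hf Y) (by positivity)

end

end LongTail

namespace LongTail

noncomputable section

/-! ### The laws of the model as finite sums of point masses -/

theorem featureLaw_eq_sum {q : ℝ} :
    featureLaw q = ∑ s : SignType, ENNReal.ofReal (signWeight q s) • Measure.dirac (s : ℝ) := by
  have : (Finset.univ : Finset SignType) = {0, 1, -1} := by decide
  rw [this, Finset.sum_insert (by decide), Finset.sum_insert (by decide), Finset.sum_singleton]
  simp [featureLaw, signWeight]

theorem isFiniteMeasure_sum_dirac {α S : Type*} [MeasurableSpace α] (t : Finset S) (w : S → ℝ)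
    (c : S → α) : IsFiniteMeasure (∑ s ∈ t, ENNReal.ofReal (w s) • Measure.dirac (c s)) := by
  constructor
  simp [ENNReal.sum_lt_top]

theorem pi_sum_dirac {ι α S : Type*} [Fintype ι] [DecidableEq ι] [Fintype S] [MeasurableSpace α]
    (w : ι → S → ℝ) (hw : ∀ i s, 0 ≤ w i s) (c : S → α) :
    Measure.pi (fun i => ∑ s, ENNReal.ofReal (w i s) • Measure.dirac (c s)) =
      ∑ y : ι → S, ENNReal.ofReal (∏ i, w i (y i)) • Measure.dirac (fun i => c (y i)) := by
  have : ∀ i, IsFiniteMeasure (∑ s, ENNReal.ofReal (w i s) • Measure.dirac (c s)) :=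
    fun i => isFiniteMeasure_sum_dirac _ _ _
  refine Measure.pi_eq fun s hs => ?_
  simp only [Measure.coe_finsetSum, Finset.sum_apply, Measure.smul_apply, smul_eq_mul]
  rw [Finset.prod_univ_sum, Fintype.piFinset_univ]
  refine Finset.sum_congr rfl fun y _ => ?_
  rw [Finset.prod_mul_distrib, ENNReal.ofReal_prod_of_nonneg fun i _ => hw i _]
  congr 1
  rw [Measure.dirac_apply' _ (MeasurableSet.univ_pi hs)]
  simp only [Measure.dirac_apply' _ (hs _)]
  by_cases h : ∀ i, c (y i) ∈ s i
  · rw [Set.indicator_of_mem (show (fun i => c (y i)) ∈ Set.univ.pi s from Set.mem_univ_pi.2 h)]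
    simp [Set.indicator_of_mem (h _)]
  · rw [Set.indicator_of_notMem
      (show (fun i => c (y i)) ∉ Set.univ.pi s from fun h' => h (Set.mem_univ_pi.1 h'))]
    push Not at h
    obtain ⟨i, hi⟩ := h
    exact (Finset.prod_eq_zero (Finset.mem_univ i) (Set.indicator_of_notMem hi _)).symm

/-- Every function is integrable against finitely many point masses. The mean over the design matrix
is thus a finite sum, and no measurability of the estimator is needed. -/
theorem integral_sum_dirac {α S : Type*} [Fintype S] [MeasurableSpace α]
    [MeasurableSingletonClass α] (w : S → ℝ) (hw : ∀ s, 0 ≤ w s) (c : S → α) (f : α → ℝ) :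
    ∫ x, f x ∂(∑ s, ENNReal.ofReal (w s) • Measure.dirac (c s)) = ∑ s, w s * f (c s) := by
  rw [integral_finsetSum_measure]
  · refine Finset.sum_congr rfl fun s _ => ?_
    rw [integral_smul_measure, integral_dirac, ENNReal.toReal_ofReal (hw s), smul_eq_mul]
  · intro s _
    exact (integrable_dirac (by simp)).smul_measure ENNReal.ofReal_ne_top

/-- The real matrix of a sign matrix. -/
def realMat {ι κ : Type*} (Y : ι → κ → SignType) : ι → κ → ℝ := fun i j => (Y i j : ℝ)

/-- The frequencies of the features, as a function of the coordinate. -/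
def freq (d : ℕ) (p : ℕ → ℝ) : Fin d → ℝ := fun j => p (j + 1)

theorem pi_featureLaw {d : ℕ} {q : Fin d → ℝ} (hq : IsProb q) :
    Measure.pi (fun j => featureLaw (q j)) =
      ∑ g : Fin d → SignType, ENNReal.ofReal (rowWeight q g) •
        Measure.dirac (fun j => (g j : ℝ)) := by
  simp only [featureLaw_eq_sum]
  exact pi_sum_dirac (fun j s => signWeight (q j) s) (fun j s => signWeight_nonneg (hq j) s)
    (fun s : SignType => (s : ℝ))

theorem designLaw_eq_sum {n d : ℕ} {p : ℕ → ℝ} (hq : IsProb (freq d p)) :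
    designLaw n d p = ∑ Y : Fin n → Fin d → SignType, ENNReal.ofReal (matWeight (freq d p) Y) •
      Measure.dirac (realMat Y) := by
  unfold designLaw dataLaw
  have := pi_featureLaw hq
  simp only [freq] at this
  rw [this]
  exact pi_sum_dirac (fun (_ : Fin n) g => rowWeight (freq d p) g)
    (fun i g => rowWeight_nonneg hq g) (fun (g : Fin d → SignType) j => (g j : ℝ))

theorem integral_designLaw {n d : ℕ} {p : ℕ → ℝ} (hq : IsProb (freq d p))
    (f : (Fin n → Fin d → ℝ) → ℝ) :
    ∫ X, f X ∂(designLaw n d p) = mean (freq d p) (fun Y => f (realMat Y)) := by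
  rw [designLaw_eq_sum hq, integral_sum_dirac _ (fun Y => matWeight_nonneg hq Y)]
  rfl

/-- The frequencies of the features when those in `T` are forced to be non-zero. -/
def oodFreq {d : ℕ} (p : ℕ → ℝ) (T : Finset (Fin d)) : Fin d → ℝ :=
  fun j => if j ∈ T then 1 else p (j + 1)

theorem isProb_oodFreq {d : ℕ} {p : ℕ → ℝ} (hq : IsProb (freq d p)) (T : Finset (Fin d)) :
    IsProb (oodFreq p T) := by
  intro j
  unfold oodFreq
  split_ifs
  · norm_num
  · exact hq j

/-- The OOD loss is a weighted sum of squared coefficient errors. -/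
theorem oodLoss_eq {d : ℕ} {p : ℕ → ℝ} (hq : IsProb (freq d p)) (β : Fin d → ℝ)
    (T : Finset (Fin d)) (b : Fin d → ℝ) :
    oodLoss p β T b = ∑ j, oodFreq p T j * (b j - β j) ^ 2 := by
  have hT := isProb_oodFreq hq T
  unfold oodLoss oodLaw
  have h := pi_featureLaw hT
  simp only [oodFreq] at h
  rw [h, integral_sum_dirac _ (fun g => rowWeight_nonneg hT g)]
  rw [← rowMean_sq (oodFreq p T) (fun j => b j - β j)]
  unfold rowMean
  refine Finset.sum_congr rfl fun g _ => ?_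
  congr 2
  simp only [dotProduct, ← Finset.sum_sub_distrib, sub_mul]

/-- A lower bound for the probability of an event about the training data. -/
theorem mean_le_trainLaw {n d : ℕ} {p : ℕ → ℝ} (hq : IsProb (freq d p)) (σ : ℝ)
    [IsProbabilityMeasure (noiseLaw n σ)]
    (S : Set ((Fin n → Fin d → ℝ) × (Fin n → ℝ))) :
    mean (freq d p) (fun Y => (noiseLaw n σ).real {ξ | (realMat Y, ξ) ∈ S}) ≤
      (trainLaw n d p σ).real S := by
  have h1 : trainLaw n d p σ = ∑ Y : Fin n → Fin d → SignType,
      ENNReal.ofReal (matWeight (freq d p) Y) •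
        (noiseLaw n σ).map (Prod.mk (realMat Y)) := by
    unfold trainLaw
    rw [designLaw_eq_sum hq]
    rw [← Measure.sum_fintype, Measure.prod_sum_left, Measure.sum_fintype]
    refine Finset.sum_congr rfl fun Y _ => ?_
    rw [Measure.prod_smul_left, Measure.dirac_prod]
  have h2 : ∑ Y : Fin n → Fin d → SignType, ENNReal.ofReal (matWeight (freq d p) Y) *
      (noiseLaw n σ) {ξ | (realMat Y, ξ) ∈ S} ≤ trainLaw n d p σ S := by
    rw [h1]
    simp only [Measure.coe_finsetSum, Finset.sum_apply, Measure.smul_apply, smul_eq_mul]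
    refine Finset.sum_le_sum fun Y _ => mul_le_mul_right ?_ _
    -- This inequality holds for every set `S`, measurable or not.
    exact Measure.le_map_apply (by fun_prop : Measurable (Prod.mk (realMat Y))).aemeasurable S
  have : IsFiniteMeasure (trainLaw n d p σ) := by
    rw [h1]
    constructor
    simp only [Measure.coe_finsetSum, Finset.sum_apply, Measure.smul_apply, smul_eq_mul]
    exact ENNReal.sum_lt_top.2 fun Y _ =>
      ENNReal.mul_lt_top ENNReal.ofReal_lt_top (measure_lt_top _ _)
  have h3 := ENNReal.toReal_mono (measure_ne_top _ S) h2
  rw [ENNReal.toReal_sum fun Y _ =>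
    ENNReal.mul_ne_top ENNReal.ofReal_ne_top (measure_ne_top _ _)] at h3
  simp only [ENNReal.toReal_mul, ENNReal.toReal_ofReal (matWeight_nonneg hq _)] at h3
  exact h3

end

end LongTail

namespace LongTail

noncomputable section

/-! ### Gaussian integrals -/

/-- The factor `exp (l x² / v)` only rescales the variance in the Gaussian density. The exponent is
normalized by `v` so that the value depends on `l` alone. -/
theorem integrable_exp_sq_gaussianReal {v : NNReal} (hv : v ≠ 0) {l : ℝ} (hl : l < 1 / 2) :
    Integrable (fun x => Real.exp (l / v * x ^ 2)) (gaussianReal 0 v) ∧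
      ∫ x, Real.exp (l / v * x ^ 2) ∂(gaussianReal 0 v) = 1 / √(1 - 2 * l) := by
  have hv' : (0 : ℝ) < v := by positivity
  have hb : 0 < (1 - 2 * l) / (2 * v) := by
    apply div_pos <;> linarith
  have key : ∀ x : ℝ, gaussianPDFReal 0 v x * Real.exp (l / v * x ^ 2) =
      (√(2 * Real.pi * v))⁻¹ * Real.exp (-((1 - 2 * l) / (2 * v)) * x ^ 2) := by
    intro x
    rw [gaussianPDFReal, mul_assoc, ← Real.exp_add]
    congr 2
    field_simp
    ring
  constructor
  · rw [gaussianReal_of_var_ne_zero 0 hv,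
      integrable_withDensity_iff (measurable_gaussianPDF 0 v)
        (Filter.Eventually.of_forall fun _ => gaussianPDF_lt_top)]
    simp only [toReal_gaussianPDF, mul_comm _ (gaussianPDFReal _ _ _), key]
    exact (integrable_exp_neg_mul_sq hb).const_mul _
  · rw [integral_gaussianReal_eq_integral_smul hv]
    simp only [smul_eq_mul, key]
    rw [integral_const_mul, integral_gaussian, ← Real.sqrt_inv, ← Real.sqrt_mul (by positivity),
      one_div, ← Real.sqrt_inv]
    congr 1
    have : (1 - 2 * l) ≠ 0 := by linarith
    field_simp

theorem one_div_sqrt_one_sub_le {t : ℝ} (h0 : 0 ≤ t) (h1 : t ≤ 1 / 2) :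
    1 / √(1 - t) ≤ Real.exp t := by
  have h2 : Real.exp (-2 * t) ≤ 1 - t := by
    have h3 : 1 + 2 * t ≤ Real.exp (2 * t) := by linarith [Real.add_one_le_exp (2 * t)]
    rw [show -2 * t = -(2 * t) by ring, Real.exp_neg]
    apply inv_le_of_inv_le₀ (by linarith)
    refine le_trans ?_ h3
    rw [inv_le_iff_one_le_mul₀ (by linarith)]
    nlinarith
  have h4 : Real.exp (-t) ≤ √(1 - t) := by
    apply Real.le_sqrt_of_sq_le
    rw [← Real.exp_nat_mul]
    refine le_trans (le_of_eq ?_) h2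
    congr 1; push_cast; ring
  rw [div_le_iff₀ (lt_of_lt_of_le (Real.exp_pos _) h4)]
  calc (1 : ℝ) = Real.exp t * Real.exp (-t) := by rw [← Real.exp_add]; simp
    _ ≤ _ := mul_le_mul_of_nonneg_left h4 (Real.exp_pos _).le

theorem integral_exp_mul_gaussianReal (t : ℝ) :
    ∫ x, Real.exp (t * x) ∂(gaussianReal 0 1) = Real.exp (t ^ 2 / 2) := by
  have := congrFun (mgf_id_gaussianReal (μ := 0) (v := 1)) t
  simpa [mgf] using this

/-! ### Quadratic forms in random signs -/

/-- The real sign of a truth value. -/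
def sgn (b : Bool) : ℝ := if b = true then -1 else 1

theorem sum_exp_sgn_mul_le {ι : Type*} [Fintype ι] [DecidableEq ι] (t : ι → ℝ) :
    ∑ s : ι → Bool, Real.exp (∑ i, sgn (s i) * t i) ≤
      2 ^ Fintype.card ι * Real.exp (∑ i, t i ^ 2 / 2) := by
  have h1 : ∑ s : ι → Bool, Real.exp (∑ i, sgn (s i) * t i) =
      ∏ i, ∑ b : Bool, Real.exp (sgn b * t i) := by
    rw [Finset.prod_univ_sum]
    simp only [Real.exp_sum, Fintype.piFinset_univ]
  rw [h1, Real.exp_sum, ← Finset.card_univ, ← Finset.prod_const, ← Finset.prod_mul_distrib]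
  refine Finset.prod_le_prod (fun i _ => Finset.sum_nonneg fun _ _ => (Real.exp_pos _).le)
    fun i _ => ?_
  have := Real.cosh_le_exp_half_sq (t i)
  rw [Real.cosh_eq] at this
  simp only [sgn, Fintype.sum_bool]
  norm_num
  linarith

theorem exists_diagonalization {ι : Type*} [Fintype ι] [DecidableEq ι] (A : Matrix ι ι ℝ)
    (hA : A.IsHermitian) :
    ∃ (U : Matrix ι ι ℝ) (D : ι → ℝ), U.transpose * U = 1 ∧ U * U.transpose = 1 ∧
      A = U * Matrix.diagonal D * U.transpose := by
  refine ⟨hA.eigenvectorUnitary, hA.eigenvalues, ?_, ?_, ?_⟩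
  · have := Unitary.coe_star_mul_self hA.eigenvectorUnitary
    simpa [Matrix.star_eq_conjTranspose] using this
  · have := Unitary.coe_mul_star_self hA.eigenvectorUnitary
    simpa [Matrix.star_eq_conjTranspose] using this
  · have := hA.spectral_theorem
    simpa [Matrix.star_eq_conjTranspose, Unitary.conjStarAlgAut_apply, Function.comp_def]
      using this

open Matrix in
theorem diagonalized_quadratic {ι : Type*} [Fintype ι] [DecidableEq ι] (U : Matrix ι ι ℝ)
    (D : ι → ℝ) (x : ι → ℝ) :
    x ⬝ᵥ (U * Matrix.diagonal D * U.transpose) *ᵥ x = ∑ l, D l * (Uᵀ *ᵥ x) l ^ 2 := by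
  rw [← Matrix.mulVec_mulVec, ← Matrix.mulVec_mulVec, Matrix.dotProduct_mulVec,
    ← Matrix.mulVec_transpose]
  simp only [dotProduct, Matrix.mulVec_diagonal]
  exact Finset.sum_congr rfl fun l _ => by ring

open Matrix in
theorem orthogonal_norm {ι : Type*} [Fintype ι] [DecidableEq ι] {U : Matrix ι ι ℝ}
    (h : U.transpose * U = 1) (x : ι → ℝ) : ∑ i, (U *ᵥ x) i ^ 2 = ∑ i, x i ^ 2 := by
  have : (U *ᵥ x) ⬝ᵥ (U *ᵥ x) = x ⬝ᵥ x := by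
    rw [Matrix.dotProduct_mulVec, ← Matrix.mulVec_transpose, Matrix.mulVec_mulVec, h,
      Matrix.one_mulVec]
  simpa [dotProduct, sq] using this

open Matrix in
/-- The exponential moment of a quadratic form in independent random signs. -/
theorem sum_exp_quadratic_le {ι : Type*} [Fintype ι] [DecidableEq ι] (A : Matrix ι ι ℝ)
    (hA : A.IsHermitian) (h0 : ∀ x : ι → ℝ, 0 ≤ x ⬝ᵥ A *ᵥ x)
    (h1 : ∀ x : ι → ℝ, x ⬝ᵥ A *ᵥ x ≤ x ⬝ᵥ x) :
    ∑ s : ι → Bool, Real.exp (((fun i => sgn (s i)) ⬝ᵥ A *ᵥ (fun i => sgn (s i))) / 4) ≤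
      2 ^ Fintype.card ι * Real.exp (A.trace / 2) := by
  obtain ⟨U, D, hU, hU', hAU⟩ := exists_diagonalization A hA
  have hcol : ∀ l, (U.transpose *ᵥ (U *ᵥ Pi.single l 1)) = Pi.single l 1 := by
    intro l; rw [Matrix.mulVec_mulVec, hU, Matrix.one_mulVec]
  have hq : ∀ l, (U *ᵥ Pi.single l 1) ⬝ᵥ A *ᵥ (U *ᵥ Pi.single l 1) = D l := by
    intro l
    rw [hAU, diagonalized_quadratic, hcol]
    simp [Pi.single_apply]
  have hD0 : ∀ l, 0 ≤ D l := fun l => by rw [← hq l]; exact h0 _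
  have hD1 : ∀ l, D l ≤ 1 := fun l => by
    rw [← hq l]; refine (h1 _).trans ?_
    have := orthogonal_norm hU (Pi.single l 1)
    simp only [dotProduct, ← sq]
    rw [this]
    simp [Pi.single_apply]
  have htr : A.trace = ∑ l, D l := by
    rw [hAU, Matrix.trace_mul_comm, ← Matrix.mul_assoc, hU, Matrix.one_mul, Matrix.trace_diagonal]
  -- Gaussian linearization: `exp (t² / 2)` is the mean of `exp (t g)`. In an eigenbasis this turns
  -- the quadratic form into a linear one, for which the independent signs factorize.
  have hlin : ∀ s : ι → Bool,
      Real.exp (((fun i => sgn (s i)) ⬝ᵥ A *ᵥ (fun i => sgn (s i))) / 4) =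
        ∫ g : ι → ℝ, ∏ l, Real.exp (√(D l / 2) * (Uᵀ *ᵥ (fun i => sgn (s i))) l * g l)
          ∂(Measure.pi fun _ => gaussianReal 0 1) := by
    intro s
    rw [integral_fintype_prod_eq_prod (𝕜 := ℝ) (fun l (x : ℝ) =>
      Real.exp (√(D l / 2) * (Uᵀ *ᵥ (fun i => sgn (s i))) l * x))]
    simp only [integral_exp_mul_gaussianReal]
    rw [← Real.exp_sum, hAU, diagonalized_quadratic, Finset.sum_div]
    congr 1
    refine Finset.sum_congr rfl fun l _ => ?_
    rw [mul_pow, Real.sq_sqrt (by linarith [hD0 l])]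
    ring
  have hint : ∀ s : ι → Bool, Integrable (fun g : ι → ℝ =>
      ∏ l, Real.exp (√(D l / 2) * (Uᵀ *ᵥ (fun i => sgn (s i))) l * g l))
      (Measure.pi fun _ => gaussianReal 0 1) := fun s =>
    Integrable.fintype_prod (f := fun l (x : ℝ) =>
      Real.exp (√(D l / 2) * (Uᵀ *ᵥ (fun i => sgn (s i))) l * x))
      (fun l => integrable_exp_mul_gaussianReal _)
  have hexp : ∀ l, Integrable (fun x => Real.exp (D l / 4 / ((1 : NNReal) : ℝ) * x ^ 2))
      (gaussianReal 0 1) ∧ ∫ x, Real.exp (D l / 4 / ((1 : NNReal) : ℝ) * x ^ 2)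
        ∂(gaussianReal 0 1) = 1 / √(1 - 2 * (D l / 4)) :=
    fun l => integrable_exp_sq_gaussianReal one_ne_zero (by linarith [hD1 l])
  simp only [hlin]
  rw [← integral_finsetSum _ fun s _ => hint s]
  calc ∫ g : ι → ℝ, ∑ s : ι → Bool,
        ∏ l, Real.exp (√(D l / 2) * (Uᵀ *ᵥ (fun i => sgn (s i))) l * g l)
          ∂(Measure.pi fun _ => gaussianReal 0 1)
      ≤ ∫ g : ι → ℝ, 2 ^ Fintype.card ι *
          ∏ l, Real.exp (D l / 4 / ((1 : NNReal) : ℝ) * g l ^ 2)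
          ∂(Measure.pi fun _ => gaussianReal 0 1) := by
        refine integral_mono (integrable_finsetSum _ fun s _ => hint s)
          ((Integrable.fintype_prod fun l => (hexp l).1).const_mul _) fun g => ?_
        -- Once the sum over signs is inside the integral, `cosh t ≤ exp (t² / 2)` applies in each
        -- coordinate. Orthogonality of `U` makes the exponent the diagonal form `∑ D_l g_l² / 4`.
        have := sum_exp_sgn_mul_le (U *ᵥ fun l => √(D l / 2) * g l)
        rw [← Finset.sum_div, orthogonal_norm hU, Finset.sum_div] at this
        simp only [← Real.exp_sum]
        refine le_of_eq_of_le (Finset.sum_congr rfl fun s _ => ?_) (this.trans (le_of_eq ?_))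
        · congr 1
          have e : ∀ x y : ι → ℝ, ∑ l, x l * (Uᵀ *ᵥ y) l = ∑ i, y i * (U *ᵥ x) i := by
            intro x y
            show x ⬝ᵥ (Uᵀ *ᵥ y) = y ⬝ᵥ (U *ᵥ x)
            rw [Matrix.dotProduct_mulVec, ← Matrix.mulVec_transpose, Matrix.transpose_transpose,
              dotProduct_comm]
          rw [← e]
          exact Finset.sum_congr rfl fun l _ => by ring
        · congr 2
          refine Finset.sum_congr rfl fun l _ => ?_
          rw [mul_pow, Real.sq_sqrt (by linarith [hD0 l])]
          simp; ring
    _ = 2 ^ Fintype.card ι * ∏ l, (1 / √(1 - 2 * (D l / 4))) := by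
        rw [integral_const_mul, integral_fintype_prod_eq_prod (𝕜 := ℝ) (fun l (x : ℝ) =>
          Real.exp (D l / 4 / ((1 : NNReal) : ℝ) * x ^ 2))]
        simp only [fun l => (hexp l).2]
    _ ≤ 2 ^ Fintype.card ι * Real.exp (A.trace / 2) := by
        rw [htr, Finset.sum_div, Real.exp_sum]
        refine mul_le_mul_of_nonneg_left (Finset.prod_le_prod (fun l _ => by positivity)
          fun l _ => ?_) (by positivity)
        have := one_div_sqrt_one_sub_le (t := D l / 2) (by linarith [hD0 l]) (by linarith [hD1 l])
        rwa [show 2 * (D l / 4) = D l / 2 by ring]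

end

end LongTail

namespace LongTail

noncomputable section

/-! ### Quadratic functionals of the label noise -/

instance noiseLaw_isProbabilityMeasure (n : ℕ) (σ : ℝ) : IsProbabilityMeasure (noiseLaw n σ) := by
  unfold noiseLaw; infer_instance

/-- A linear form in independent Gaussians is Gaussian, since characteristic functions multiply. -/
theorem noiseLaw_map_linear (n : ℕ) (σ : ℝ) (u : Fin n → ℝ) :
    (noiseLaw n σ).map (fun ξ => ∑ i, u i * ξ i) =
      gaussianReal 0 (σ ^ 2 * ∑ i, u i ^ 2).toNNReal := by
  have h1 : (noiseLaw n σ).map (fun ξ => ∑ i, u i * ξ i) =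
      ((noiseLaw n σ).map (fun ξ i => u i * ξ i)).map (fun p => ∑ i, p i) := by
    rw [Measure.map_map (by fun_prop) (by fun_prop)]
    rfl
  have h2 : (noiseLaw n σ).map (fun ξ i => u i * ξ i) =
      Measure.pi fun i => gaussianReal 0 (u i ^ 2 * σ ^ 2).toNNReal := by
    unfold noiseLaw
    rw [Measure.pi_map_pi (f := fun i x => u i * x) (fun i => by fun_prop)]
    congr 1
    funext i
    rw [gaussianReal_map_const_mul, mul_zero]
    congr 1
    apply NNReal.eq
    rw [NNReal.coe_mul, Real.coe_toNNReal _ (sq_nonneg σ),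
      Real.coe_toNNReal _ (mul_nonneg (sq_nonneg _) (sq_nonneg σ))]
    rfl
  rw [h1, h2]
  apply Measure.ext_of_charFun
  rw [charFun_map_sum_pi_eq_prod]
  funext t
  simp only [Finset.prod_apply, charFun_gaussianReal]
  rw [← Complex.exp_sum]
  congr 1
  have hs : 0 ≤ ∑ i, u i ^ 2 := Finset.sum_nonneg fun i _ => sq_nonneg _
  simp only [Real.coe_toNNReal _ (mul_nonneg (sq_nonneg (u _)) (sq_nonneg σ)),
    Real.coe_toNNReal _ (mul_nonneg (sq_nonneg σ) hs)]
  push_cast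
  rw [Finset.mul_sum, Finset.sum_mul, Finset.sum_div, mul_zero, zero_mul, zero_sub,
    ← Finset.sum_neg_distrib]
  refine Finset.sum_congr rfl fun i _ => ?_
  ring

theorem integral_linear_sq (n : ℕ) (σ : ℝ) (u : Fin n → ℝ) :
    Integrable (fun ξ => (∑ i, u i * ξ i) ^ 2) (noiseLaw n σ) ∧
      ∫ ξ, (∑ i, u i * ξ i) ^ 2 ∂(noiseLaw n σ) = σ ^ 2 * ∑ i, u i ^ 2 := by
  have hm : AEMeasurable (fun ξ : Fin n → ℝ => ∑ i, u i * ξ i) (noiseLaw n σ) :=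
    (by fun_prop : Measurable fun ξ : Fin n → ℝ => ∑ i, u i * ξ i).aemeasurable
  have hs : 0 ≤ ∑ i, u i ^ 2 := Finset.sum_nonneg fun i _ => sq_nonneg _
  have hi : Integrable (fun x : ℝ => x ^ 2)
      ((noiseLaw n σ).map (fun ξ => ∑ i, u i * ξ i)) := by
    rw [noiseLaw_map_linear]
    exact (memLp_id_gaussianReal 2).integrable_sq
  refine ⟨hi.comp_aemeasurable hm, ?_⟩
  rw [← integral_map (φ := fun ξ : Fin n → ℝ => ∑ i, u i * ξ i) (f := fun x : ℝ => x ^ 2) hm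
    hi.aestronglyMeasurable, noiseLaw_map_linear]
  have h := variance_id_gaussianReal (μ := 0) (v := (σ ^ 2 * ∑ i, u i ^ 2).toNNReal)
  rw [variance_of_integral_eq_zero aemeasurable_id (by simp)] at h
  simpa [Real.coe_toNNReal _ (mul_nonneg (sq_nonneg σ) hs)] using h

theorem integral_exp_linear_sq (n : ℕ) {σ : ℝ} (hσ : 0 < σ) (u : Fin n → ℝ) :
    Integrable (fun ξ => Real.exp ((∑ i, u i * ξ i) ^ 2 / (4 * σ ^ 2 * ∑ i, u i ^ 2)))
        (noiseLaw n σ) ∧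
      ∫ ξ, Real.exp ((∑ i, u i * ξ i) ^ 2 / (4 * σ ^ 2 * ∑ i, u i ^ 2)) ∂(noiseLaw n σ) ≤ 2 := by
  have hs : 0 ≤ ∑ i, u i ^ 2 := Finset.sum_nonneg fun i _ => sq_nonneg _
  rcases hs.eq_or_lt with h0 | h0
  -- The form is zero; the quotient has denominator `0`, so the exponent is `0` and the mean is `1`.
  · simp [← h0]
  have hm : AEMeasurable (fun ξ : Fin n → ℝ => ∑ i, u i * ξ i) (noiseLaw n σ) :=
    (by fun_prop : Measurable fun ξ : Fin n → ℝ => ∑ i, u i * ξ i).aemeasurable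
  set v : NNReal := (σ ^ 2 * ∑ i, u i ^ 2).toNNReal with hv
  have hvr : (v : ℝ) = σ ^ 2 * ∑ i, u i ^ 2 := Real.coe_toNNReal _ (by positivity)
  have hv0 : v ≠ 0 := by
    intro h
    rw [h] at hvr
    have : 0 < σ ^ 2 * ∑ i, u i ^ 2 := by positivity
    simp at hvr
    rcases hvr with h | h <;> linarith
  have key := integrable_exp_sq_gaussianReal hv0 (l := 1 / 4) (by norm_num)
  have e : ∀ x : ℝ, x ^ 2 / (4 * σ ^ 2 * ∑ i, u i ^ 2) = 1 / 4 / (v : ℝ) * x ^ 2 := by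
    intro x; rw [hvr]; field_simp
  simp only [e]
  have hi : Integrable (fun x : ℝ => Real.exp (1 / 4 / (v : ℝ) * x ^ 2))
      ((noiseLaw n σ).map (fun ξ => ∑ i, u i * ξ i)) := by
    rw [noiseLaw_map_linear]; exact key.1
  refine ⟨hi.comp_aemeasurable hm, ?_⟩
  rw [← integral_map (φ := fun ξ : Fin n → ℝ => ∑ i, u i * ξ i)
    (f := fun x : ℝ => Real.exp (1 / 4 / (v : ℝ) * x ^ 2)) hm hi.aestronglyMeasurable,
    noiseLaw_map_linear, key.2]
  rw [div_le_iff₀ (by apply Real.sqrt_pos.2; norm_num)]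
  have : (1 / 2 : ℝ) ≤ √(1 - 2 * (1 / 4)) := by
    apply Real.le_sqrt_of_sq_le; norm_num
  linarith

theorem noiseLaw_zero (n : ℕ) : noiseLaw n 0 = Measure.dirac 0 := by
  unfold noiseLaw
  simp only [ne_eq, OfNat.ofNat_ne_zero, not_false_eq_true, zero_pow, Real.toNNReal_zero,
    gaussianReal_zero_var]
  refine Measure.pi_eq fun s hs => ?_
  rw [Measure.dirac_apply' _ (MeasurableSet.univ_pi hs)]
  simp only [Measure.dirac_apply' _ (hs _)]
  by_cases h : ∀ i, (0 : ℝ) ∈ s i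
  · rw [Set.indicator_of_mem (show (0 : Fin n → ℝ) ∈ Set.univ.pi s from Set.mem_univ_pi.2 h)]
    simp [Set.indicator_of_mem (h _)]
  · rw [Set.indicator_of_notMem
      (show (0 : Fin n → ℝ) ∉ Set.univ.pi s from fun h' => h (Set.mem_univ_pi.1 h'))]
    push Not at h
    obtain ⟨i, hi⟩ := h
    exact (Finset.prod_eq_zero (Finset.mem_univ i) (Set.indicator_of_notMem hi _)).symm

/-- A weighted sum of squares of Gaussian linear forms exceeds a large multiple of its mean with
small probability. -/
theorem noiseLaw_markov {τ : Type*} (s : Finset τ) (n : ℕ) (σ : ℝ) (c : τ → ℝ)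
    (ρ : τ → Fin n → ℝ) (hc : ∀ a ∈ s, 0 ≤ c a) {M t : ℝ} (hM : 0 < M) (ht : 0 < t)
    (h : ∑ a ∈ s, c a * ∑ i, ρ a i ^ 2 ≤ M) :
    (noiseLaw n σ).real {ξ | t * (σ ^ 2 * M) < ∑ a ∈ s, c a * (∑ i, ρ a i * ξ i) ^ 2} ≤ 1 / t := by
  -- Without noise both sides of the event vanish almost surely, and the inequality defining it is
  -- strict.
  by_cases hσ : σ = 0
  · subst hσ
    rw [noiseLaw_zero, Measure.real, Measure.dirac_apply, Set.indicator_of_notMem]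
    · simp; positivity
    · simp
  have hpos : 0 < t * (σ ^ 2 * M) := by positivity
  have hi : Integrable (fun ξ => ∑ a ∈ s, c a * (∑ i, ρ a i * ξ i) ^ 2) (noiseLaw n σ) :=
    integrable_finsetSum _ fun a _ => ((integral_linear_sq n σ (ρ a)).1).const_mul _
  have h1 := mul_meas_ge_le_integral_of_nonneg (μ := noiseLaw n σ)
    (f := fun ξ => ∑ a ∈ s, c a * (∑ i, ρ a i * ξ i) ^ 2)
    (Filter.Eventually.of_forall fun ξ => Finset.sum_nonneg fun a ha =>
      mul_nonneg (hc a ha) (sq_nonneg _)) hi (t * (σ ^ 2 * M))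
  have h2 : ∫ ξ, ∑ a ∈ s, c a * (∑ i, ρ a i * ξ i) ^ 2 ∂(noiseLaw n σ) ≤ σ ^ 2 * M := by
    rw [integral_finsetSum _ fun a _ => ((integral_linear_sq n σ (ρ a)).1).const_mul _]
    simp only [integral_const_mul, (integral_linear_sq n σ _).2]
    calc _ = σ ^ 2 * ∑ a ∈ s, c a * ∑ i, ρ a i ^ 2 := by
          rw [Finset.mul_sum]; exact Finset.sum_congr rfl fun _ _ => by ring
      _ ≤ _ := mul_le_mul_of_nonneg_left h (sq_nonneg _)
  have h3 : (noiseLaw n σ).real {ξ | t * (σ ^ 2 * M) < ∑ a ∈ s, c a * (∑ i, ρ a i * ξ i) ^ 2} ≤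
      (noiseLaw n σ).real {ξ | t * (σ ^ 2 * M) ≤ ∑ a ∈ s, c a * (∑ i, ρ a i * ξ i) ^ 2} :=
    measureReal_mono (Set.ofPred_subset_ofPred.2 fun ξ hξ => hξ.le)
  refine h3.trans ?_
  rw [le_div_iff₀ ht]
  have h4 := h1.trans h2
  have : 0 < σ ^ 2 * M := by positivity
  nlinarith

/-- Jensen's inequality with the missing mass `1 - ∑ w` placed at the point `0`, from the tangent to
the exponential at the mean. -/
theorem exp_convex_combination {τ : Type*} (s : Finset τ) (w x : τ → ℝ) (hw : ∀ a ∈ s, 0 ≤ w a)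
    (hw1 : ∑ a ∈ s, w a ≤ 1) :
    Real.exp (∑ a ∈ s, w a * x a) ≤ ∑ a ∈ s, w a * Real.exp (x a) + (1 - ∑ a ∈ s, w a) := by
  set m := ∑ a ∈ s, w a * x a with hm
  have tangent : ∀ y : ℝ, Real.exp m * (1 + y - m) ≤ Real.exp y := by
    intro y
    calc Real.exp m * (1 + y - m) ≤ Real.exp m * Real.exp (y - m) :=
          mul_le_mul_of_nonneg_left (by linarith [Real.add_one_le_exp (y - m)]) (Real.exp_pos _).le
      _ = Real.exp y := by rw [← Real.exp_add]; congr 1; ring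
  have h1 : ∑ a ∈ s, w a * (Real.exp m * (1 + x a - m)) ≤ ∑ a ∈ s, w a * Real.exp (x a) :=
    Finset.sum_le_sum fun a ha => mul_le_mul_of_nonneg_left (tangent _) (hw a ha)
  have h2 : ∑ a ∈ s, w a * (Real.exp m * (1 + x a - m)) =
      Real.exp m * ((1 - m) * ∑ a ∈ s, w a + m) := by
    rw [mul_add, Finset.mul_sum, Finset.mul_sum]
    rw [show Real.exp m * m = Real.exp m * ∑ a ∈ s, w a * x a from rfl, Finset.mul_sum,
      ← Finset.sum_add_distrib]
    exact Finset.sum_congr rfl fun _ _ => by ring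
  have h3 := tangent 0
  rw [Real.exp_zero] at h3
  nlinarith

/-- A weighted sum of squares of Gaussian linear forms has exponential tails. -/
theorem noiseLaw_tail {τ : Type*} (s : Finset τ) (n : ℕ) (σ : ℝ) (c : τ → ℝ)
    (ρ : τ → Fin n → ℝ) (hc : ∀ a ∈ s, 0 ≤ c a) {M : ℝ} (hM : 0 < M) (t : ℝ)
    (h : ∑ a ∈ s, c a * ∑ i, ρ a i ^ 2 ≤ M) :
    (noiseLaw n σ).real {ξ | 4 * M * σ ^ 2 * t < ∑ a ∈ s, c a * (∑ i, ρ a i * ξ i) ^ 2} ≤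
      2 * Real.exp (-t) := by
  by_cases hσ : σ = 0
  · subst hσ
    rw [noiseLaw_zero, Measure.real, Measure.dirac_apply, Set.indicator_of_notMem]
    · simp [(Real.exp_pos (-t)).le]
    · simp
  -- The noise law depends on `σ` only through its square.
  wlog hσ' : 0 < σ generalizing σ with H
  · have h1 : 0 < -σ := by
      rcases lt_or_gt_of_ne hσ with h | h
      · linarith
      · exact absurd h hσ'
    have := H (-σ) h1.ne' h1
    simpa [noiseLaw] using this
  -- The forms may be strongly dependent, so no product structure is used. The exponent `∑ c_a ⟨ρ_a,
  -- ξ⟩² / (4 M σ²)` is a subconvex combination, with weights `c_a ‖ρ_a‖² / M`, of normalized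
  -- squares whose exponentials all have mean at most `2`.
  set F : (Fin n → ℝ) → ℝ := fun ξ =>
    ∑ a ∈ s, c a * (∑ i, ρ a i ^ 2) / M *
      Real.exp ((∑ i, ρ a i * ξ i) ^ 2 / (4 * σ ^ 2 * ∑ i, ρ a i ^ 2)) +
      (1 - ∑ a ∈ s, c a * (∑ i, ρ a i ^ 2) / M) with hF
  have hw : ∀ a ∈ s, 0 ≤ c a * (∑ i, ρ a i ^ 2) / M := fun a ha =>
    div_nonneg (mul_nonneg (hc a ha) (Finset.sum_nonneg fun i _ => sq_nonneg _)) hM.le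
  have hw1 : ∑ a ∈ s, c a * (∑ i, ρ a i ^ 2) / M ≤ 1 := by
    rw [← Finset.sum_div, div_le_one hM]; exact h
  have hFi : Integrable F (noiseLaw n σ) :=
    (integrable_finsetSum _ fun a _ =>
      ((integral_exp_linear_sq n hσ' (ρ a)).1).const_mul _).add (integrable_const _)
  have hFint : ∫ ξ, F ξ ∂(noiseLaw n σ) ≤ 2 := by
    rw [hF, integral_add (integrable_finsetSum _ fun a _ =>
      ((integral_exp_linear_sq n hσ' (ρ a)).1).const_mul _) (integrable_const _),
      integral_finsetSum _ fun a _ => ((integral_exp_linear_sq n hσ' (ρ a)).1).const_mul _]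
    simp only [integral_const_mul, integral_const, probReal_univ, one_smul]
    have : ∑ a ∈ s, c a * (∑ i, ρ a i ^ 2) / M * ∫ ξ, Real.exp ((∑ i, ρ a i * ξ i) ^ 2 /
        (4 * σ ^ 2 * ∑ i, ρ a i ^ 2)) ∂(noiseLaw n σ) ≤
        ∑ a ∈ s, c a * (∑ i, ρ a i ^ 2) / M * 2 :=
      Finset.sum_le_sum fun a ha =>
        mul_le_mul_of_nonneg_left (integral_exp_linear_sq n hσ' (ρ a)).2 (hw a ha)
    rw [← Finset.sum_mul] at this
    linarith
  have hpt : ∀ ξ, Real.exp ((∑ a ∈ s, c a * (∑ i, ρ a i * ξ i) ^ 2) / (4 * M * σ ^ 2)) ≤ F ξ := by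
    intro ξ
    refine le_of_eq_of_le ?_ (exp_convex_combination s _ _ hw hw1)
    congr 1
    rw [Finset.sum_div]
    refine Finset.sum_congr rfl fun a _ => ?_
    have hr : 0 ≤ ∑ i, ρ a i ^ 2 := Finset.sum_nonneg fun i _ => sq_nonneg _
    rcases hr.eq_or_lt with h0 | h0
    · have hz : ∀ i, ρ a i = 0 := fun i => by
        have := (Finset.sum_eq_zero_iff_of_nonneg fun i _ => sq_nonneg (ρ a i)).1 h0.symm i
          (Finset.mem_univ i)
        exact pow_eq_zero_iff (two_ne_zero) |>.1 this
      simp [hz]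
    · field_simp
  have hFnn : ∀ ξ, 0 ≤ F ξ := fun ξ => (Real.exp_pos _).le.trans (hpt ξ)
  have h1 := mul_meas_ge_le_integral_of_nonneg (μ := noiseLaw n σ)
    (Filter.Eventually.of_forall hFnn) hFi (Real.exp t)
  have h3 : (noiseLaw n σ).real {ξ | 4 * M * σ ^ 2 * t <
      ∑ a ∈ s, c a * (∑ i, ρ a i * ξ i) ^ 2} ≤ (noiseLaw n σ).real {ξ | Real.exp t ≤ F ξ} := by
    refine measureReal_mono (Set.ofPred_subset_ofPred.2 fun ξ hξ => ?_)
    refine le_trans (Real.exp_le_exp.2 ?_) (hpt ξ)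
    rw [le_div_iff₀ (by positivity)]
    linarith
  refine h3.trans ?_
  rw [Real.exp_neg, ← div_eq_mul_inv, le_div_iff₀ (Real.exp_pos t), mul_comm]
  exact h1.trans hFint

end

end LongTail

namespace LongTail

set_option linter.unusedSectionVars false

noncomputable section

/-! ### Projections onto the column space of a submatrix -/

-- With `U` diagonalizing the Gram matrix, `B = G U` has orthogonal columns spanning the column
-- space of `G`, and `P` normalizes them. The convention `0⁻¹ = 0` discards the zero columns, so the
-- trace counts the non-zero ones.
open Matrix in
theorem exists_projection {ι γ : Type*} [Fintype ι] [DecidableEq ι] [Fintype γ] [DecidableEq γ]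
    (G : Matrix ι γ ℝ) :
    ∃ P : Matrix ι ι ℝ, Pᵀ = P ∧ P * P = P ∧ P * G = G ∧ (∃ C : Matrix γ ι ℝ, P = G * C) ∧
      P.trace ≤ Fintype.card γ := by
  obtain ⟨U, D, hU, hU', hA⟩ := exists_diagonalization (Gᵀ * G)
    (by simpa using Matrix.isHermitian_conjTranspose_mul_self G)
  set B := G * U with hB
  have hBB : Bᵀ * B = Matrix.diagonal D := by
    rw [hB, Matrix.transpose_mul, Matrix.mul_assoc, ← Matrix.mul_assoc Gᵀ, hA]
    calc Uᵀ * (U * Matrix.diagonal D * Uᵀ * U) = (Uᵀ * U) * Matrix.diagonal D * (Uᵀ * U) := by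
          simp only [Matrix.mul_assoc]
      _ = _ := by rw [hU, Matrix.one_mul, Matrix.mul_one]
  have hD : ∀ l, D l = ∑ i, B i l ^ 2 := by
    intro l
    have := congrFun (congrFun hBB l) l
    simp only [Matrix.mul_apply, Matrix.transpose_apply, Matrix.diagonal_apply_eq] at this
    rw [← this]
    exact Finset.sum_congr rfl fun _ _ => by ring
  have hB0 : ∀ i l, B i l * ((D l)⁻¹ * D l) = B i l := by
    intro i l
    by_cases h : D l = 0
    · have h1 := (Finset.sum_eq_zero_iff_of_nonneg fun i _ => sq_nonneg (B i l)).1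
        ((hD l).symm.trans h) i (Finset.mem_univ i)
      rw [pow_eq_zero_iff two_ne_zero |>.1 h1, zero_mul]
    · rw [inv_mul_cancel₀ h, mul_one]
  have hPB : B * Matrix.diagonal (fun l => (D l)⁻¹) * Bᵀ * B = B := by
    rw [Matrix.mul_assoc, hBB, Matrix.mul_assoc, Matrix.diagonal_mul_diagonal]
    ext i l
    rw [Matrix.mul_diagonal, hB0]
  refine ⟨B * Matrix.diagonal (fun l => (D l)⁻¹) * Bᵀ, ?_, ?_, ?_,
    ⟨U * Matrix.diagonal (fun l => (D l)⁻¹) * Bᵀ, ?_⟩, ?_⟩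
  · simp [Matrix.transpose_mul, Matrix.mul_assoc]
  · rw [← Matrix.mul_assoc, ← Matrix.mul_assoc, hPB]
  · have : G = B * Uᵀ := by rw [hB, Matrix.mul_assoc, hU', Matrix.mul_one]
    conv_lhs => rw [this, ← Matrix.mul_assoc, hPB, ← this]
  · rw [hB]; simp only [Matrix.mul_assoc]
  · rw [Matrix.trace_mul_comm, ← Matrix.mul_assoc, hBB, Matrix.diagonal_mul_diagonal,
      Matrix.trace_diagonal]
    calc ∑ l, D l * (D l)⁻¹ ≤ ∑ _l : γ, (1 : ℝ) := Finset.sum_le_sum fun l _ => by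
          by_cases h : D l = 0
          · simp [h]
          · rw [mul_inv_cancel₀ h]
      _ = _ := by simp

/-! ### Leverages and domination of rows. -/

variable {ι κ : Type*} [Fintype ι] [Fintype κ] [DecidableEq ι] [DecidableEq κ]

/-- The linear form of the row `i` in the variables in `Q`. -/
def lin (Y : ι → κ → SignType) (Q : Finset κ) (z : κ → ℝ) (i : ι) : ℝ :=
  ∑ b ∈ Q, (Y i b : ℝ) * z b

/-- The squared norm of the image of `z` in the rows `R`. -/
def energy (Y : ι → κ → SignType) (R : Finset ι) (Q : Finset κ) (z : κ → ℝ) : ℝ :=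
  ∑ i ∈ R, lin Y Q z i ^ 2

/-- The row `g` is dominated by the rows `R`: its leverage is at most `1 / 16`. -/
def Dominated (Y : ι → κ → SignType) (R : Finset ι) (Q : Finset κ) (g : κ → SignType) : Prop :=
  ∀ z : κ → ℝ, (∑ b ∈ Q, (g b : ℝ) * z b) ^ 2 ≤ 1 / 16 * energy Y R Q z

theorem energy_nonneg (Y : ι → κ → SignType) (R : Finset ι) (Q : Finset κ) (z : κ → ℝ) :
    0 ≤ energy Y R Q z := Finset.sum_nonneg fun _ _ => sq_nonneg _

theorem energy_mono (Y : ι → κ → SignType) {R R' : Finset ι} (h : R ⊆ R') (Q : Finset κ)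
    (z : κ → ℝ) : energy Y R Q z ≤ energy Y R' Q z :=
  Finset.sum_le_sum_of_subset_of_nonneg h fun _ _ _ => sq_nonneg _

/-- `P` is the orthogonal projection onto the space of the columns `Q` restricted to `R`. -/
structure IsColumnProjection (Y : ι → κ → SignType) (R : Finset ι) (Q : Finset κ)
    (P : Matrix ι ι ℝ) : Prop where
  symm : ∀ i j, P i j = P j i
  idem : P * P = P
  fixes : ∀ z, Matrix.mulVec P (fun i => if i ∈ R then lin Y Q z i else 0) =
    fun i => if i ∈ R then lin Y Q z i else 0
  range : ∀ i, ∃ z, ∀ j, P j i = if j ∈ R then lin Y Q z j else 0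
  trace_le : P.trace ≤ Q.card

theorem exists_isColumnProjection (Y : ι → κ → SignType) (R : Finset ι) (Q : Finset κ) :
    ∃ P, IsColumnProjection Y R Q P := by
  obtain ⟨P, h1, h2, h3, ⟨C, h4⟩, h5⟩ := exists_projection
    (Matrix.of fun (i : ι) (b : Q) => if i ∈ R then (Y i b : ℝ) else 0)
  refine ⟨P, fun i j => congrFun (congrFun h1.symm i) j, h2, fun z => ?_, fun i => ?_, by
    simpa using h5⟩
  · have e : (fun i => if i ∈ R then lin Y Q z i else 0) = Matrix.mulVec
        (Matrix.of fun (i : ι) (b : Q) => if i ∈ R then (Y i b : ℝ) else 0)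
        (fun b => z b) := by
      funext i
      simp only [Matrix.mulVec, dotProduct, Matrix.of_apply, lin]
      split_ifs
      · exact (Finset.sum_coe_sort Q fun b => (Y i b : ℝ) * z b).symm
      · simp
    rw [e, Matrix.mulVec_mulVec, h3]
  · refine ⟨fun b => if h : b ∈ Q then C ⟨b, h⟩ i else 0, fun j => ?_⟩
    rw [h4, Matrix.mul_apply]
    simp only [Matrix.of_apply, lin]
    split_ifs
    · rw [← Finset.sum_coe_sort Q]
      refine Finset.sum_congr rfl fun b _ => ?_
      simp
    · simp

namespace IsColumnProjection

variable {Y : ι → κ → SignType} {R : Finset ι} {Q : Finset κ} {P : Matrix ι ι ℝ}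

theorem sum_sq (h : IsColumnProjection Y R Q P) (i : ι) : ∑ j, P j i ^ 2 = P i i := by
  conv_rhs => rw [← h.idem, Matrix.mul_apply]
  exact Finset.sum_congr rfl fun j _ => by rw [h.symm i j]; ring

theorem diag_nonneg (h : IsColumnProjection Y R Q P) (i : ι) : 0 ≤ P i i := by
  rw [← h.sum_sq i]; exact Finset.sum_nonneg fun _ _ => sq_nonneg _

theorem diag_le_one (h : IsColumnProjection Y R Q P) (i : ι) : P i i ≤ 1 := by
  have h1 : P i i ^ 2 ≤ P i i := by
    conv_rhs => rw [← h.sum_sq i]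
    exact Finset.single_le_sum (f := fun j => P j i ^ 2) (fun j _ => sq_nonneg _)
      (Finset.mem_univ i)
  nlinarith [h.diag_nonneg i]

theorem sum_diag_le (h : IsColumnProjection Y R Q P) (U : Finset ι) :
    ∑ i ∈ U, P i i ≤ Q.card :=
  (Finset.sum_le_sum_of_subset_of_nonneg (Finset.subset_univ U)
    fun i _ _ => h.diag_nonneg i).trans h.trace_le

/-- A dominated row has small leverage. -/
theorem diag_le_of_dominated (h : IsColumnProjection Y R Q P) {R' : Finset ι} (hR : R' ⊆ R)
    {i : ι} (hi : Dominated Y R' Q (Y i)) : P i i ≤ 1 / 16 := by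
  -- Domination is tested on the vector whose image is the column `i` of `P`: this gives `P i i ^ 2
  -- ≤ P i i / 16`.
  obtain ⟨z, hz⟩ := h.range i
  have h1 := hi z
  have h2 : energy Y R' Q z ≤ P i i := by
    rw [← h.sum_sq i]
    refine (energy_mono Y hR Q z).trans ?_
    refine le_trans (le_of_eq ?_) (Finset.sum_le_sum_of_subset_of_nonneg (Finset.subset_univ R)
      fun j _ _ => sq_nonneg (P j i))
    exact Finset.sum_congr rfl fun j hj => by rw [hz j, if_pos hj]
  have h0 := h.diag_nonneg i
  by_cases hiR : i ∈ R
  · have h3 : P i i = ∑ b ∈ Q, (Y i b : ℝ) * z b := by rw [hz i, if_pos hiR]; rfl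
    rw [← h3] at h1
    by_contra hc
    push Not at hc
    nlinarith
  · rw [hz i, if_neg hiR]; norm_num

/-- A row with small leverage is dominated by the other rows. -/
theorem dominated_of_diag_le (h : IsColumnProjection Y R Q P) {i : ι} (hiR : i ∈ R)
    (hi : P i i ≤ 1 / 17) : Dominated Y (R.erase i) Q (Y i) := by
  intro z
  have h1 := congrFun (h.fixes z) i
  simp only [Matrix.mulVec, dotProduct, if_pos hiR] at h1
  have hy : (∑ j, (if j ∈ R then lin Y Q z j else 0) ^ 2) = energy Y R Q z := by
    unfold energy
    simp only [ite_pow, ne_eq, OfNat.ofNat_ne_zero, not_false_eq_true, zero_pow,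
      Finset.sum_ite_mem, Finset.univ_inter]
  -- If `y` is the image of `z` and `E` its energy on the other rows, Cauchy–Schwarz gives `y_i² ≤
  -- P_ii (y_i² + E)`, so `y_i² ≤ P_ii / (1 - P_ii) * E`. At `P_ii = 1 / 17` the factor is `1 / 16`.
  have h2 := Finset.sum_mul_sq_le_sq_mul_sq Finset.univ (fun j => P i j)
    (fun j => if j ∈ R then lin Y Q z j else 0)
  rw [h1, hy] at h2
  have h3 : ∑ j, P i j ^ 2 = P i i := by
    rw [← h.sum_sq i]; exact Finset.sum_congr rfl fun j _ => by rw [h.symm i j]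
  rw [h3] at h2
  have h4 : energy Y R Q z = lin Y Q z i ^ 2 + energy Y (R.erase i) Q z :=
    (Finset.add_sum_erase R (fun i => lin Y Q z i ^ 2) hiR).symm
  have h5 := energy_nonneg Y (R.erase i) Q z
  show lin Y Q z i ^ 2 ≤ _
  rw [h4] at h2
  nlinarith [sq_nonneg (lin Y Q z i)]

end IsColumnProjection

/-- Few rows are not dominated by the others. -/
theorem card_not_dominated_le (Y : ι → κ → SignType) (R : Finset ι) (Q : Finset κ) :
    ∑ i ∈ R, ind (¬Dominated Y (R.erase i) Q (Y i)) ≤ 17 * Q.card := by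
  obtain ⟨P, hP⟩ := exists_isColumnProjection Y R Q
  calc ∑ i ∈ R, ind (¬Dominated Y (R.erase i) Q (Y i)) ≤ ∑ i ∈ R, 17 * P i i := by
        refine Finset.sum_le_sum fun i hi => ?_
        by_cases h : Dominated Y (R.erase i) Q (Y i)
        · rw [ind_of_not (not_not.2 h)]; linarith [hP.diag_nonneg i]
        · rw [ind_of h]
          by_contra hc
          push Not at hc
          exact h (hP.dominated_of_diag_le hi (by linarith))
    _ ≤ 17 * Q.card := by
        rw [← Finset.mul_sum]
        have := hP.sum_diag_le R
        linarith

theorem coe_flip (a : κ) (s : ι → Bool) (Y : ι → κ → SignType) (i : ι) :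
    ((flip a s Y i a : SignType) : ℝ) = sgn (s i) * (Y i a : ℝ) := by
  unfold flip sgn
  by_cases h : s i = true <;> simp [h]

theorem coe_sq_le_one (s : SignType) : ((s : ℝ)) ^ 2 ≤ 1 := by
  cases s <;> simp

theorem coe_sq_of_ne_zero {s : SignType} (h : s ≠ 0) : ((s : ℝ)) ^ 2 = 1 := by
  cases s
  · exact absurd rfl h
  · simp
  · simp

open Matrix in
/-- A column with random signs is far from a given column space, provided that this space has
small leverage on its support. -/
theorem sum_flip_near_le {Y : ι → κ → SignType} {R : Finset ι} {Q : Finset κ} {a : κ}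
    {P : Matrix ι ι ℝ} (hP : IsColumnProjection Y R Q P)
    {U : Finset ι} (hU : U = R.filter fun i => Y i a ≠ 0)
    (htr : ∑ i ∈ U, P i i ≤ (U.card : ℝ) / 8) :
    (∑ s : ι → Bool, ind (∃ z : κ → ℝ,
      ∑ i ∈ R, (((flip a s Y i a : SignType) : ℝ) + lin Y Q z i) ^ 2 < (U.card : ℝ) / 2)) /
      2 ^ Fintype.card ι ≤ Real.exp (-(U.card : ℝ) / 16) := by
  set y : ι → ℝ := fun i => if i ∈ R then (Y i a : ℝ) else 0 with hy
  set A : Matrix ι ι ℝ := Matrix.of fun i j => y i * P i j * y j with hA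
  have hquad : ∀ x : ι → ℝ, x ⬝ᵥ P *ᵥ x = ∑ i, (P *ᵥ x) i ^ 2 := by
    intro x
    have hs : Pᵀ = P := by ext i j; exact hP.symm j i
    have : (P *ᵥ x) ⬝ᵥ (P *ᵥ x) = x ⬝ᵥ P *ᵥ x := by
      rw [Matrix.dotProduct_mulVec, ← Matrix.mulVec_transpose, hs, Matrix.mulVec_mulVec, hP.idem,
        dotProduct_comm]
    rw [← this]
    simp only [dotProduct, sq]
  have hquad_le : ∀ x : ι → ℝ, x ⬝ᵥ P *ᵥ x ≤ ∑ i, x i ^ 2 := by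
    intro x
    have h1 : 0 ≤ ∑ i, (x i - (P *ᵥ x) i) ^ 2 := Finset.sum_nonneg fun _ _ => sq_nonneg _
    have h2 : ∑ i, (x i - (P *ᵥ x) i) ^ 2 =
        ∑ i, x i ^ 2 - 2 * (x ⬝ᵥ P *ᵥ x) + ∑ i, (P *ᵥ x) i ^ 2 := by
      simp only [dotProduct, Finset.mul_sum, ← Finset.sum_sub_distrib, ← Finset.sum_add_distrib]
      exact Finset.sum_congr rfl fun _ _ => by ring
    rw [← hquad] at h2
    linarith
  have hAq : ∀ x : ι → ℝ, x ⬝ᵥ A *ᵥ x = (fun i => y i * x i) ⬝ᵥ P *ᵥ (fun i => y i * x i) := by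
    intro x
    simp only [dotProduct, Matrix.mulVec, hA, Matrix.of_apply, Finset.mul_sum]
    exact Finset.sum_congr rfl fun _ _ => Finset.sum_congr rfl fun _ _ => by ring
  have hy1 : ∀ i, y i ^ 2 ≤ 1 := by
    intro i
    simp only [hy]
    split_ifs
    · exact coe_sq_le_one _
    · norm_num
  have hyU : ∀ i, y i ^ 2 = if i ∈ U then 1 else 0 := by
    intro i
    simp only [hy, hU, Finset.mem_filter]
    by_cases h1 : i ∈ R <;> by_cases h2 : Y i a = 0 <;> simp [h1, h2]
    simpa using coe_sq_of_ne_zero h2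
  have hAtr : A.trace = ∑ i ∈ U, P i i := by
    simp only [Matrix.trace, Matrix.diag_apply, hA, Matrix.of_apply]
    have h1 : ∀ i, y i * P i i * y i = if i ∈ U then P i i else 0 := by
      intro i
      calc y i * P i i * y i = y i ^ 2 * P i i := by ring
        _ = _ := by rw [hyU]; split_ifs <;> simp
    simp [h1, Finset.sum_ite_mem]
  have hmain := sum_exp_quadratic_le A (by
      ext i j
      simp only [Matrix.conjTranspose_apply, hA, Matrix.of_apply, star_trivial]
      rw [hP.symm j i]; ring)
    (fun x => by rw [hAq, hquad]; exact Finset.sum_nonneg fun _ _ => sq_nonneg _)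
    (fun x => by
      rw [hAq]
      refine (hquad_le _).trans ?_
      simp only [dotProduct]
      refine Finset.sum_le_sum fun i _ => ?_
      nlinarith [hy1 i, sq_nonneg (x i)])
  -- The flipped column `v` has squared norm `|U|`. If a vector of the column space is within
  -- squared distance `|U| / 2`, then the projection of `v` has squared norm above `|U| / 2`. The
  -- trace of the conjugated projection is at most `|U| / 8`, so the exponential moment leaves `exp
  -- (-|U|/8 + |U|/16)`.
  have hpt : ∀ s : ι → Bool, ind (∃ z : κ → ℝ,
      ∑ i ∈ R, (((flip a s Y i a : SignType) : ℝ) + lin Y Q z i) ^ 2 < (U.card : ℝ) / 2) ≤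
      Real.exp (-(U.card : ℝ) / 8) *
        Real.exp (((fun i => sgn (s i)) ⬝ᵥ A *ᵥ (fun i => sgn (s i))) / 4) := by
    intro s
    by_cases h : ∃ z : κ → ℝ,
      ∑ i ∈ R, (((flip a s Y i a : SignType) : ℝ) + lin Y Q z i) ^ 2 < (U.card : ℝ) / 2
    swap
    · rw [ind_of_not h]; positivity
    rw [ind_of h, ← Real.exp_add]
    apply Real.one_le_exp
    obtain ⟨z, hz⟩ := h
    set v : ι → ℝ := fun i => y i * sgn (s i) with hv
    set w : ι → ℝ := fun i => if i ∈ R then lin Y Q z i else 0 with hw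
    have e1 : ∑ i ∈ R, (((flip a s Y i a : SignType) : ℝ) + lin Y Q z i) ^ 2 =
        ∑ i, (v i + w i) ^ 2 := by
      rw [← Finset.sum_subset (Finset.subset_univ R)]
      · refine Finset.sum_congr rfl fun i hi => ?_
        simp only [hv, hw, hy, if_pos hi, coe_flip]
        ring
      · intro i _ hi
        simp [hv, hw, hy, if_neg hi]
    have e2 : ∑ i, v i ^ 2 = U.card := by
      have : ∀ i, v i ^ 2 = if i ∈ U then 1 else 0 := by
        intro i
        rw [← hyU i]
        simp only [hv, mul_pow]
        unfold sgn
        split_ifs <;> simp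
      simp [this]
    have e3 : P *ᵥ w = w := hP.fixes z
    have e4 : 0 ≤ (v + w) ⬝ᵥ P *ᵥ (v + w) := by
      rw [hquad]; exact Finset.sum_nonneg fun _ _ => sq_nonneg _
    have hs : Pᵀ = P := by ext i j; exact hP.symm j i
    have e5 : w ⬝ᵥ P *ᵥ v = w ⬝ᵥ v := by
      rw [Matrix.dotProduct_mulVec, ← Matrix.mulVec_transpose, hs, e3]
    rw [Matrix.mulVec_add, e3, add_dotProduct, dotProduct_add, dotProduct_add, e5] at e4
    have e6 : ∑ i, (v i + w i) ^ 2 = ∑ i, v i ^ 2 + (v ⬝ᵥ w + (w ⬝ᵥ v + w ⬝ᵥ w)) := by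
      simp only [dotProduct, ← Finset.sum_add_distrib]
      exact Finset.sum_congr rfl fun _ _ => by ring
    have e7 := hAq (fun i => sgn (s i))
    rw [e7]
    show 0 ≤ -(U.card : ℝ) / 8 + v ⬝ᵥ P *ᵥ v / 4
    rw [e1, e6, e2] at hz
    linarith
  rw [div_le_iff₀ (by positivity)]
  refine (Finset.sum_le_sum fun s _ => hpt s).trans ?_
  rw [← Finset.mul_sum]
  refine (mul_le_mul_of_nonneg_left hmain (Real.exp_pos _).le).trans ?_
  rw [← mul_assoc, mul_comm (Real.exp _) (2 ^ _), mul_assoc, ← Real.exp_add, mul_comm]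
  refine mul_le_mul_of_nonneg_right (Real.exp_le_exp.2 ?_) (by positivity)
  rw [hAtr]
  linarith

end

end LongTail

namespace LongTail

set_option linter.unusedSectionVars false

noncomputable section

variable {ι κ : Type*} [Fintype ι] [Fintype κ] [DecidableEq ι] [DecidableEq κ]

/-! ### Dependence on the entries -/

theorem lin_congr {Y Y' : ι → κ → SignType} {Q : Finset κ} {i : ι}
    (h : ∀ b ∈ Q, Y i b = Y' i b) (z : κ → ℝ) : lin Y Q z i = lin Y' Q z i :=
  Finset.sum_congr rfl fun b hb => by rw [h b hb]

theorem energy_congr {Y Y' : ι → κ → SignType} {R : Finset ι} {Q : Finset κ}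
    (h : ∀ i ∈ R, ∀ b ∈ Q, Y i b = Y' i b) (z : κ → ℝ) : energy Y R Q z = energy Y' R Q z :=
  Finset.sum_congr rfl fun i hi => by rw [lin_congr (h i hi)]

theorem dominated_congr {Y Y' : ι → κ → SignType} {R : Finset ι} {Q : Finset κ}
    {g g' : κ → SignType} (h : ∀ i ∈ R, ∀ b ∈ Q, Y i b = Y' i b) (hg : ∀ b ∈ Q, g b = g' b) :
    Dominated Y R Q g ↔ Dominated Y' R Q g' := by
  unfold Dominated
  refine forall_congr' fun z => ?_
  rw [energy_congr h, Finset.sum_congr rfl fun b hb => by rw [hg b hb]]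

theorem Dominated.mono {Y : ι → κ → SignType} {R R' : Finset ι} {Q : Finset κ}
    {g : κ → SignType} (h : Dominated Y R Q g) (hR : R ⊆ R') : Dominated Y R' Q g := fun z =>
  (h z).trans (mul_le_mul_of_nonneg_left (energy_mono Y hR Q z) (by norm_num))

/-! ### Typical leverages of fresh rows -/

/-- The probability that a fresh row is not dominated by the rows `R`. -/
def freshProb (q : κ → ℝ) (Y : ι → κ → SignType) (R : Finset ι) (Q : Finset κ) : ℝ :=
  rowMean q fun g => ind (¬Dominated Y R Q g)

/-- Fresh rows often fail to be dominated by the rows `R`. -/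
def Sparse (q : κ → ℝ) (Y : ι → κ → SignType) (R : Finset ι) (Q : Finset κ) : Prop :=
  1 / 256 < freshProb q Y R Q

theorem freshProb_congr {q : κ → ℝ} {Y Y' : ι → κ → SignType} {R : Finset ι} {Q : Finset κ}
    (h : ∀ i ∈ R, ∀ b ∈ Q, Y i b = Y' i b) : freshProb q Y R Q = freshProb q Y' R Q := by
  unfold freshProb
  congr 1
  funext g
  rw [dominated_congr h fun _ _ => rfl]

theorem sparse_congr {q : κ → ℝ} {Y Y' : ι → κ → SignType} {R : Finset ι} {Q : Finset κ}
    (h : ∀ i ∈ R, ∀ b ∈ Q, Y i b = Y' i b) : Sparse q Y R Q ↔ Sparse q Y' R Q := by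
  unfold Sparse; rw [freshProb_congr h]

theorem Sparse.anti {q : κ → ℝ} (hq : IsProb q) {Y : ι → κ → SignType} {R R' : Finset ι}
    {Q : Finset κ} (h : Sparse q Y R' Q) (hR : R ⊆ R') : Sparse q Y R Q :=
  lt_of_lt_of_le h (rowMean_mono hq fun _ => ind_mono fun hn hd => hn (hd.mono hR))

/-- Leave-one-out. If `R` is sparse then so is each `R.erase i`, yet all but `17 |Q|` of the rows
`i` are dominated by the others. Row `i` is independent of `R.erase i`, so given that the latter is
sparse, row `i` is dominated with probability at most `255 / 256`. -/
theorem mean_sparse_step {q : κ → ℝ} (hq : IsProb q) (R : Finset ι) (Q : Finset κ) :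
    ((R.card : ℝ) - 17 * Q.card) * mean q (fun Y : ι → κ → SignType => ind (Sparse q Y R Q)) ≤
      ∑ i ∈ R, 255 / 256 * mean q (fun Y : ι → κ → SignType => ind (Sparse q Y (R.erase i) Q)) := by
  have h1 : ∀ i ∈ R, mean q (fun Y : ι → κ → SignType =>
      ind (Sparse q Y (R.erase i) Q) * ind (Dominated Y (R.erase i) Q (Y i))) ≤
      255 / 256 * mean q (fun Y : ι → κ → SignType => ind (Sparse q Y (R.erase i) Q)) := by
    intro i hi
    rw [mean_resample q (fun i' _ => i' = i), ← mean_mul_left]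
    refine mean_mono hq fun Y => ?_
    have e : ∀ Y' : ι → κ → SignType, ∀ i' ∈ R.erase i, ∀ b ∈ Q,
        merge (fun i' _ => i' = i) Y' Y i' b = Y i' b := fun Y' i' hi' b _ =>
      merge_of_not (A := fun i' _ => i' = i) (Finset.ne_of_mem_erase hi') _ _
    have e2 : ∀ Y' : ι → κ → SignType, ∀ b ∈ Q,
        merge (fun i' _ => i' = i) Y' Y i b = Y' i b := fun Y' b _ =>
      merge_of (A := fun i' _ => i' = i) rfl _ _
    simp only [sparse_congr (e _), dominated_congr (e _) (e2 _)]
    rw [mean_mul_left, mean_row q i (fun g => ind (Dominated Y (R.erase i) Q g)), mul_comm]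
    have e3 : rowMean q (fun g => ind (Dominated Y (R.erase i) Q g)) =
        1 - freshProb q Y (R.erase i) Q := by
      have h := rowMean_add q (fun g => ind (Dominated Y (R.erase i) Q g))
        (fun g => ind (¬Dominated Y (R.erase i) Q g))
      have h' : (fun g => ind (Dominated Y (R.erase i) Q g) +
          ind (¬Dominated Y (R.erase i) Q g)) = fun _ => 1 := by
        funext g; rw [ind_not]; ring
      rw [h', rowMean_const] at h
      unfold freshProb
      linarith
    rw [e3]
    by_cases hs : Sparse q Y (R.erase i) Q
    · rw [ind_of hs]
      unfold Sparse at hs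
      linarith
    · rw [ind_of_not hs]; simp
  refine le_trans ?_ (Finset.sum_le_sum h1)
  rw [← mean_sum, ← mean_mul_left]
  refine mean_mono hq fun Y => ?_
  by_cases hs : Sparse q Y R Q
  · have h2 := card_not_dominated_le Y R Q
    simp only [ind_not, Finset.sum_sub_distrib, Finset.sum_const, nsmul_eq_mul, mul_one] at h2
    rw [ind_of hs]
    have h3 : ∑ i ∈ R, ind (Sparse q Y (R.erase i) Q) * ind (Dominated Y (R.erase i) Q (Y i)) =
        ∑ i ∈ R, ind (Dominated Y (R.erase i) Q (Y i)) :=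
      Finset.sum_congr rfl fun i _ => by
        rw [ind_of (hs.anti hq (Finset.erase_subset i R)), one_mul]
    rw [h3]
    linarith
  · rw [ind_of_not hs, mul_zero]
    exact Finset.sum_nonneg fun _ _ => mul_nonneg (ind_nonneg _) (ind_nonneg _)

/-- With many more rows than columns, fresh rows are typically dominated. -/
theorem mean_sparse_le {q : κ → ℝ} (hq : IsProb q) (Q : Finset κ) (m : ℕ) :
    ∀ R : Finset ι, R.card = 8704 * Q.card + m →
      mean q (fun Y : ι → κ → SignType => ind (Sparse q Y R Q)) ≤ (511 / 512) ^ m := by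
  induction m with
  | zero =>
    intro R _
    simpa [mean_const] using
      mean_mono (ι := ι) hq (g := fun _ => 1) fun Y => ind_le_one (Sparse q Y R Q)
  | succ m ih =>
    intro R hR
    have h1 := mean_sparse_step hq R Q
    have h2 : ∑ i ∈ R, 255 / 256 *
        mean q (fun Y : ι → κ → SignType => ind (Sparse q Y (R.erase i) Q)) ≤
        ∑ _i ∈ R, (255 / 256 : ℝ) * (511 / 512) ^ m := by
      refine Finset.sum_le_sum fun i hi => mul_le_mul_of_nonneg_left (ih _ ?_) (by norm_num)
      rw [Finset.card_erase_of_mem hi, hR]; omega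
    rw [Finset.sum_const, nsmul_eq_mul] at h2
    have h3 : (R.card : ℝ) = 8704 * Q.card + m + 1 := by rw [hR]; push_cast; ring
    have h4 : (0 : ℝ) < R.card - 17 * Q.card := by
      rw [h3]
      have : (0 : ℝ) ≤ Q.card := by positivity
      have : (0 : ℝ) ≤ m := by positivity
      linarith
    -- The threshold `8704 = 17 * 512` is chosen so that each row beyond it gains the factor `511 /
    -- 512`.
    have h5 : (R.card : ℝ) * (255 / 256) ≤ (511 / 512) * (R.card - 17 * Q.card) := by
      rw [h3]
      have : (0 : ℝ) ≤ Q.card := by positivity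
      have : (0 : ℝ) ≤ m := by positivity
      linarith
    have h6 : (0 : ℝ) ≤ (511 / 512) ^ m := by positivity
    refine le_of_mul_le_mul_left ?_ h4
    calc _ ≤ (R.card : ℝ) * (255 / 256 * (511 / 512) ^ m) := h1.trans h2
      _ = (R.card : ℝ) * (255 / 256) * (511 / 512) ^ m := by ring
      _ ≤ (511 / 512) * (R.card - 17 * Q.card) * (511 / 512) ^ m :=
          mul_le_mul_of_nonneg_right h5 h6
      _ = _ := by rw [pow_succ]; ring

theorem mean_sparse_le_exp {q : κ → ℝ} (hq : IsProb q) {Q : Finset κ} {R : Finset ι} {ν : ℝ}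
    (hR : ν / 4 ≤ R.card) (hQ : 8704 * (Q.card : ℝ) ≤ ν / 8) :
    mean q (fun Y : ι → κ → SignType => ind (Sparse q Y R Q)) ≤ Real.exp (-ν / 4096) := by
  have hν : 0 ≤ ν := by
    have : (0 : ℝ) ≤ Q.card := by positivity
    linarith
  have h1 : 8704 * Q.card ≤ R.card := by
    have : (8704 : ℝ) * Q.card ≤ R.card := by linarith
    exact_mod_cast this
  have h2 := mean_sparse_le hq Q (R.card - 8704 * Q.card) R (by omega)
  refine h2.trans ?_
  have h3 : (511 / 512 : ℝ) ≤ Real.exp (-1 / 512) := by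
    have := Real.add_one_le_exp (-1 / 512 : ℝ)
    linarith
  refine (pow_le_pow_left₀ (by norm_num) h3 _).trans ?_
  rw [← Real.exp_nat_mul]
  apply Real.exp_le_exp.2
  rw [Nat.cast_sub h1]
  push_cast
  linarith

/-! ### Bad columns -/

/-- The column `a` is well separated from the other columns in `Q`, on the rows `R`. -/
def GoodCol (δ : κ → ℝ) (Y : ι → κ → SignType) (R : Finset ι) (Q : Finset κ) (a : κ) : Prop :=
  ∀ z : κ → ℝ, δ a * z a ^ 2 ≤ energy Y R Q z

/-- The rows of `R` in which the columns `J` vanish. -/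
def clearRows (Y : ι → κ → SignType) (R : Finset ι) (J : Finset κ) : Finset ι :=
  R.filter fun i => ∀ c ∈ J, Y i c = 0

/-- The least number of columns in `Q` without which, on the rows where these vanish, all columns
are well separated. -/
def badNum (δ : κ → ℝ) (Y : ι → κ → SignType) (R : Finset ι) (Q : Finset κ) : ℕ :=
  sInf {m | ∃ J ⊆ Q, J.card = m ∧ ∀ b ∈ Q \ J, GoodCol δ Y (clearRows Y R J) (Q \ J) b}

theorem badNum_spec (δ : κ → ℝ) (Y : ι → κ → SignType) (R : Finset ι) (Q : Finset κ) :
    ∃ J ⊆ Q, J.card = badNum δ Y R Q ∧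
      ∀ b ∈ Q \ J, GoodCol δ Y (clearRows Y R J) (Q \ J) b :=
  Nat.sInf_mem (s := {m | ∃ J ⊆ Q, J.card = m ∧
    ∀ b ∈ Q \ J, GoodCol δ Y (clearRows Y R J) (Q \ J) b})
    ⟨Q.card, Q, subset_rfl, rfl, by simp⟩

theorem badNum_le {δ : κ → ℝ} {Y : ι → κ → SignType} {R : Finset ι} {Q J : Finset κ}
    (hJ : J ⊆ Q) (h : ∀ b ∈ Q \ J, GoodCol δ Y (clearRows Y R J) (Q \ J) b) :
    badNum δ Y R Q ≤ J.card := Nat.sInf_le ⟨J, hJ, rfl, h⟩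

theorem badNum_le_card (δ : κ → ℝ) (Y : ι → κ → SignType) (R : Finset ι) (Q : Finset κ) :
    badNum δ Y R Q ≤ Q.card := badNum_le subset_rfl (by simp)

theorem badNum_eq_zero {δ : κ → ℝ} {Y : ι → κ → SignType} {R : Finset ι} {Q : Finset κ}
    (h : ∀ b ∈ Q, GoodCol δ Y R Q b) : badNum δ Y R Q = 0 :=
  Nat.le_zero.1 (badNum_le (J := ∅) (by simp) (by simpa [clearRows] using h))

theorem goodCol_of_badNum_eq_zero {δ : κ → ℝ} {Y : ι → κ → SignType} {R : Finset ι}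
    {Q : Finset κ} (h : badNum δ Y R Q = 0) : ∀ b ∈ Q, GoodCol δ Y R Q b := by
  obtain ⟨J, -, hJ, hg⟩ := badNum_spec δ Y R Q
  rw [h, Finset.card_eq_zero] at hJ
  subst hJ
  simpa [clearRows] using hg

/-- An optimal set for the smaller problem together with `a` is admissible for the larger one,
because removed columns also remove their supports from the rows. This is the peeling step of the
induction on columns. -/
theorem badNum_le_succ (δ : κ → ℝ) (Y : ι → κ → SignType) (R : Finset ι) {Q : Finset κ} {a : κ}
    (ha : a ∈ Q) :
    badNum δ Y R Q ≤ badNum δ Y (R \ R.filter fun i => Y i a ≠ 0) (Q.erase a) + 1 := by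
  obtain ⟨J, hJ, hc, hg⟩ := badNum_spec δ Y (R \ R.filter fun i => Y i a ≠ 0) (Q.erase a)
  have haJ : a ∉ J := fun h => (Finset.mem_erase.1 (hJ h)).1 rfl
  rw [← hc, ← Finset.card_insert_of_notMem haJ]
  have e1 : Q \ insert a J = Q.erase a \ J := by
    ext b; simp only [Finset.mem_sdiff, Finset.mem_insert, Finset.mem_erase]; tauto
  have e2 : clearRows Y R (insert a J) =
      clearRows Y (R \ R.filter fun i => Y i a ≠ 0) J := by
    ext i
    simp only [clearRows, Finset.mem_filter, Finset.mem_insert, forall_eq_or_imp,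
      Finset.mem_sdiff]
    tauto
  refine badNum_le (Finset.insert_subset ha (hJ.trans (Finset.erase_subset a Q))) ?_
  rw [e1, e2]
  exact hg

theorem goodCol_congr {δ : κ → ℝ} {Y Y' : ι → κ → SignType} {R : Finset ι} {Q : Finset κ}
    (h : ∀ i ∈ R, ∀ b ∈ Q, Y i b = Y' i b) (a : κ) :
    GoodCol δ Y R Q a ↔ GoodCol δ Y' R Q a := by
  unfold GoodCol
  exact forall_congr' fun z => by rw [energy_congr h]

theorem badNum_congr {δ : κ → ℝ} {Y Y' : ι → κ → SignType} {R : Finset ι} {Q : Finset κ}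
    (h : ∀ i ∈ R, ∀ b ∈ Q, Y i b = Y' i b) : badNum δ Y R Q = badNum δ Y' R Q := by
  unfold badNum
  congr 1
  ext m
  simp only [Set.mem_ofPred_eq]
  refine exists_congr fun J => and_congr_right fun hJ => and_congr_right fun _ => ?_
  have e : clearRows Y R J = clearRows Y' R J := by
    unfold clearRows
    refine Finset.filter_congr fun i hi => forall_congr' fun c => ?_
    refine forall_congr' fun hc => ?_
    rw [h i hi c (hJ hc)]
  rw [e]
  refine forall_congr' fun b => forall_congr' fun _ => goodCol_congr (fun i hi c hc => ?_) b
  exact h i (Finset.mem_filter.1 hi).1 c (Finset.mem_sdiff.1 hc).1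

/-- A bad column is rare or close to the span of the other columns. -/
theorem near_of_not_goodCol {δ : κ → ℝ} {Y : ι → κ → SignType} {R : Finset ι} {Q : Finset κ}
    {a : κ} (ha : a ∈ Q) (h : ¬GoodCol δ Y R Q a) :
    ∃ z : κ → ℝ, ∑ i ∈ R, ((Y i a : ℝ) + lin Y (Q.erase a) z i) ^ 2 < δ a := by
  unfold GoodCol at h
  push Not at h
  obtain ⟨z, hz⟩ := h
  have h0 := energy_nonneg Y R Q z
  have hza : z a ≠ 0 := by
    intro h'; rw [h'] at hz; simp at hz; linarith
  refine ⟨fun b => z b / z a, ?_⟩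
  have e : ∀ i, (Y i a : ℝ) + lin Y (Q.erase a) (fun b => z b / z a) i = lin Y Q z i / z a := by
    intro i
    unfold lin
    rw [← Finset.add_sum_erase Q _ ha, add_div, mul_div_assoc, div_self hza, mul_one,
      Finset.sum_div]
    congr 1
    exact Finset.sum_congr rfl fun _ _ => by ring
  simp only [e, div_pow]
  rw [← Finset.sum_div, div_lt_iff₀ (by positivity)]
  exact hz

end

end LongTail

namespace LongTail

set_option linter.unusedSectionVars false

noncomputable section

variable {ι κ : Type*} [Fintype ι] [Fintype κ] [DecidableEq ι] [DecidableEq κ]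

/-! ### The number of bad columns has exponential moments -/

/-- The rows of `R` in which the column `a` is non-zero. -/
def colSupp (Y : ι → κ → SignType) (R : Finset ι) (a : κ) : Finset ι :=
  R.filter fun i => Y i a ≠ 0

/-- Many of the rows `U` are not dominated by the other rows of `R`. -/
def Exposed (Y : ι → κ → SignType) (R : Finset ι) (Q : Finset κ) (U : Finset ι) : Prop :=
  (U.card : ℝ) / 16 < ∑ i ∈ U, ind (¬Dominated Y (R \ U) Q (Y i))

/-- Some vector in the span of the columns `Q` is close to the column `a`. -/
def Near (Y : ι → κ → SignType) (R : Finset ι) (Q : Finset κ) (a : κ) (c : ℝ) : Prop :=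
  ∃ z : κ → ℝ, ∑ i ∈ R, ((Y i a : ℝ) + lin Y Q z i) ^ 2 < c

theorem colSupp_congr {Y Y' : ι → κ → SignType} {R : Finset ι} {a : κ}
    (h : ∀ i ∈ R, Y i a = Y' i a) : colSupp Y R a = colSupp Y' R a :=
  Finset.filter_congr fun i hi => by rw [h i hi]

theorem exposed_congr {Y Y' : ι → κ → SignType} {R : Finset ι} {Q : Finset κ} {U : Finset ι}
    (h : ∀ i, ∀ b ∈ Q, Y i b = Y' i b) : Exposed Y R Q U ↔ Exposed Y' R Q U := by
  unfold Exposed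
  rw [Finset.sum_congr rfl fun i _ => by
    rw [dominated_congr (fun i _ => h i) (h i)]]

theorem colSupp_flip (a : κ) (s : ι → Bool) (Y : ι → κ → SignType) (R : Finset ι) :
    colSupp (flip a s Y) R a = colSupp Y R a := by
  unfold colSupp
  refine Finset.filter_congr fun i _ => ?_
  unfold flip
  split_ifs <;> simp

theorem flip_of_ne {a b : κ} (h : b ≠ a) (s : ι → Bool) (Y : ι → κ → SignType) (i : ι) :
    flip a s Y i b = Y i b := by simp [flip, h]

/-- The leverage of the support of a column that is not exposed is small. -/
theorem sum_diag_le_of_not_exposed {Y : ι → κ → SignType} {R U : Finset ι} {Q : Finset κ}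
    {P : Matrix ι ι ℝ} (hP : IsColumnProjection Y R Q P) (hR : 16 * (Q.card : ℝ) ≤ R.card)
    (h : ¬(2 * U.card < R.card ∧ Exposed Y R Q U)) :
    ∑ i ∈ U, P i i ≤ (U.card : ℝ) / 8 := by
  by_cases h1 : 2 * U.card < R.card
  · have h2 : ¬Exposed Y R Q U := fun h' => h ⟨h1, h'⟩
    unfold Exposed at h2
    push Not at h2
    -- Dominated rows have leverage at most `1 / 16`, and the at most `|U| / 16` others at most `1`.
    -- When instead `U` is at least half of `R`, the total trace `|Q| ≤ |R| / 16` suffices.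
    calc ∑ i ∈ U, P i i ≤ ∑ i ∈ U, (1 / 16 + ind (¬Dominated Y (R \ U) Q (Y i))) := by
          refine Finset.sum_le_sum fun i _ => ?_
          by_cases hd : Dominated Y (R \ U) Q (Y i)
          · have := hP.diag_le_of_dominated Finset.sdiff_subset hd
            linarith [ind_nonneg (¬Dominated Y (R \ U) Q (Y i))]
          · rw [ind_of hd]; linarith [hP.diag_le_one i]
      _ ≤ (U.card : ℝ) / 8 := by
          rw [Finset.sum_add_distrib, Finset.sum_const, nsmul_eq_mul]
          linarith
  · have h2 : (R.card : ℝ) ≤ 2 * U.card := by exact_mod_cast not_lt.1 h1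
    have := hP.sum_diag_le U
    linarith

/-- A column with fixed support and random signs is rarely close to an unexposed span. -/
theorem mean_near_le {q : κ → ℝ} (hq : IsProb q) {R U : Finset ι} {Q : Finset κ} {a : κ}
    (ha : a ∉ Q) (hR : 16 * (Q.card : ℝ) ≤ R.card) {f : (ι → κ → SignType) → ℝ}
    (hf0 : ∀ Y, 0 ≤ f Y) (hf : DependsOnly (fun _ b => b ≠ a) f) :
    mean q (fun Y => ind (colSupp Y R a = U) *
      (ind (¬(2 * U.card < R.card ∧ Exposed Y R Q U) ∧ Near Y R Q a ((U.card : ℝ) / 2)) * f Y)) ≤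
    Real.exp (-(U.card : ℝ) / 16) * mean q (fun Y => ind (colSupp Y R a = U) * f Y) := by
  -- Flipping signs in column `a` leaves its support, the exposure of `U` and `f` unchanged; only
  -- the closeness to the span depends on the signs.
  rw [mean_flip_average q a, ← mean_mul_left]
  refine mean_mono hq fun Y => ?_
  have hne : ∀ b ∈ Q, b ≠ a := fun b hb h => ha (h ▸ hb)
  have e1 : ∀ s, f (flip a s Y) = f Y := fun s => hf _ _ fun i b hb => flip_of_ne hb s Y i
  have e2 : ∀ s, Exposed (flip a s Y) R Q U ↔ Exposed Y R Q U := fun s =>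
    exposed_congr fun i b hb => flip_of_ne (hne b hb) s Y i
  have e3 : ∀ s z i, lin (flip a s Y) Q z i = lin Y Q z i := fun s z i =>
    lin_congr (fun b hb => flip_of_ne (hne b hb) s Y i) z
  simp only [e1, e2, colSupp_flip, ind_and]
  by_cases hU : colSupp Y R a = U
  swap
  · simp [ind_of_not hU]
  by_cases hE : 2 * U.card < R.card ∧ Exposed Y R Q U
  · simp only [ind_of_not (not_not.2 hE), zero_mul, mul_zero, Finset.sum_const_zero, zero_div]
    exact mul_nonneg (Real.exp_pos _).le (mul_nonneg (ind_nonneg _) (hf0 Y))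
  obtain ⟨P, hP⟩ := exists_isColumnProjection Y R Q
  have h := sum_flip_near_le (a := a) hP (U := U) hU.symm (sum_diag_le_of_not_exposed hP hR hE)
  simp only [ind_of hU, ind_of hE, one_mul, Near, e3, ← Finset.sum_mul]
  rw [mul_div_right_comm]
  exact mul_le_mul_of_nonneg_right h (hf0 Y)

/-- The rows `U` are rarely exposed when fresh rows are typically dominated. -/
theorem mean_exposed_le {q : κ → ℝ} (hq : IsProb q) {R U : Finset ι} {Q : Finset κ}
    {f : (ι → κ → SignType) → ℝ}
    (hf0 : ∀ Y, 0 ≤ f Y) (hf : DependsOnly (fun i _ => i ∉ U) f) :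
    mean q (fun Y => ind (Exposed Y R Q U) * (ind (¬Sparse q Y (R \ U) Q) * f Y)) ≤
      Real.exp (-(U.card : ℝ) / 16) * mean q f := by
  -- Given the other rows, the rows in `U` are fresh, so the number of undominated ones is a sum of
  -- independent indicators of mean at most `1 / 256` when `R \ U` is not sparse.
  rw [mean_resample q (fun i _ => i ∈ U), ← mean_mul_left]
  refine mean_mono hq fun Y => ?_
  have e0 : ∀ Y' : ι → κ → SignType, ∀ i ∈ R \ U, ∀ b ∈ Q,
      merge (fun i _ => i ∈ U) Y' Y i b = Y i b := fun Y' i hi b _ =>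
    merge_of_not (A := fun i _ => i ∈ U) (Finset.mem_sdiff.1 hi).2 _ _
  have e1 : ∀ Y' : ι → κ → SignType, f (merge (fun i _ => i ∈ U) Y' Y) = f Y := fun Y' =>
    hf.merge_eq_of_not (fun i j h => h) _ _
  have e2 : ∀ Y' : ι → κ → SignType,
      Exposed (merge (fun i _ => i ∈ U) Y' Y) R Q U ↔
      (U.card : ℝ) / 16 < ∑ i ∈ U, ind (¬Dominated Y (R \ U) Q (Y' i)) := by
    intro Y'
    unfold Exposed
    rw [Finset.sum_congr rfl fun i hi => by
      rw [dominated_congr (e0 Y') (g' := Y' i)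
        fun b _ => merge_of (A := fun i _ => i ∈ U) hi _ _]]
  simp only [e1, e2, sparse_congr (e0 _)]
  rw [mean_mul_right]
  by_cases hs : Sparse q Y (R \ U) Q
  · rw [ind_of_not (not_not.2 hs), zero_mul, mul_zero]
    exact mul_nonneg (Real.exp_pos _).le (hf0 Y)
  rw [ind_of hs, one_mul]
  refine mul_le_mul_of_nonneg_right ?_ (hf0 Y)
  have h1 : ∀ Y' : ι → κ → SignType,
      ind ((U.card : ℝ) / 16 < ∑ i ∈ U, ind (¬Dominated Y (R \ U) Q (Y' i))) ≤
      Real.exp (-(U.card : ℝ) / 8) *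
        ∏ i ∈ U, Real.exp (2 * ind (¬Dominated Y (R \ U) Q (Y' i))) := by
    intro Y'
    rw [← Real.exp_sum, ← Real.exp_add, ← Finset.mul_sum]
    by_cases h : (U.card : ℝ) / 16 < ∑ i ∈ U, ind (¬Dominated Y (R \ U) Q (Y' i))
    · rw [ind_of h]; exact Real.one_le_exp (by linarith)
    · rw [ind_of_not h]; exact (Real.exp_pos _).le
  refine (mean_mono hq h1).trans ?_
  rw [mean_mul_left, mean_prod_finset q U
    (fun g => Real.exp (2 * ind (¬Dominated Y (R \ U) Q g)))]
  have hexp2 : Real.exp 2 < 8 := by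
    have := Real.exp_one_lt_d9
    have h' : Real.exp 2 = Real.exp 1 * Real.exp 1 := by rw [← Real.exp_add]; norm_num
    rw [h']
    nlinarith [Real.exp_pos 1]
  -- The mean is at most `1 + 7 / 256 ≤ 1 + 1 / 32`, as `exp 2 < 8`.
  have h2 : rowMean q (fun g => Real.exp (2 * ind (¬Dominated Y (R \ U) Q g))) ≤
      Real.exp (1 / 32) := by
    have h3 : (fun g => Real.exp (2 * ind (¬Dominated Y (R \ U) Q g))) =
        fun g => 1 + (Real.exp 2 - 1) * ind (¬Dominated Y (R \ U) Q g) := by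
      funext g
      by_cases h : Dominated Y (R \ U) Q g
      · rw [ind_of_not (not_not.2 h)]; simp
      · rw [ind_of h]; simp
    rw [h3, rowMean_add, rowMean_const, rowMean_mul_left]
    unfold Sparse freshProb at hs
    push Not at hs
    have h4 : 0 ≤ rowMean q fun g => ind (¬Dominated Y (R \ U) Q g) :=
      rowMean_nonneg hq fun _ => ind_nonneg _
    have h5 := Real.add_one_le_exp (1 / 32 : ℝ)
    have h6 : 1 ≤ Real.exp 2 := Real.one_le_exp (by norm_num)
    nlinarith
  calc _ ≤ Real.exp (-(U.card : ℝ) / 8) * Real.exp (1 / 32) ^ U.card :=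
        mul_le_mul_of_nonneg_left (pow_le_pow_left₀
          (rowMean_nonneg hq fun _ => (Real.exp_pos _).le) h2 _) (Real.exp_pos _).le
    _ ≤ _ := by
        rw [← Real.exp_nat_mul, ← Real.exp_add]
        apply Real.exp_le_exp.2
        have : (0 : ℝ) ≤ U.card := by positivity
        linarith

/-- The contribution of one value of the support of a column to the mean over bad columns. -/
theorem mean_bad_supp_le {q δ : κ → ℝ} (hq : IsProb q) {R U : Finset ι} {Q : Finset κ} {a : κ}
    (ha : a ∈ Q) {x : ℝ} (hx : 1 ≤ x) (hR : 16 * (Q.card : ℝ) ≤ R.card) :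
    mean q (fun Y => ind (colSupp Y R a = U) *
      (ind (¬GoodCol δ Y R Q a) * x ^ badNum δ Y (R \ U) (Q.erase a))) ≤
    mean q (fun Y : ι → κ → SignType => ind (colSupp Y R a = U)) *
      (mean q (fun Y : ι → κ → SignType => x ^ badNum δ Y (R \ U) (Q.erase a)) *
        (ind ((U.card : ℝ) / 2 < δ a) + 2 * Real.exp (-(U.card : ℝ) / 16)) +
      ind (2 * U.card < R.card) * (x ^ Q.card *
        mean q (fun Y : ι → κ → SignType => ind (Sparse q Y (R \ U) (Q.erase a))))) := by
  set f : (ι → κ → SignType) → ℝ := fun Y => x ^ badNum δ Y (R \ U) (Q.erase a) with hf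
  have hx0 : 0 < x := by linarith
  have hf0 : ∀ Y, 0 ≤ f Y := fun Y => by positivity
  have hfcol : DependsOnly (fun _ b => b ≠ a) f := fun Y Y' h => by
    simp only [hf]
    rw [badNum_congr fun i _ b hb => h i b (Finset.ne_of_mem_erase hb)]
  have hfrow : DependsOnly (fun i _ => i ∉ U) f := fun Y Y' h => by
    simp only [hf]
    rw [badNum_congr fun i hi b _ => h i b (Finset.mem_sdiff.1 hi).2]
  have hcol : DependsOnly (fun _ b => b = a)
      (fun Y : ι → κ → SignType => ind (colSupp Y R a = U)) := fun Y Y' h => by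
    simp only []
    rw [colSupp_congr fun i _ => h i a rfl]
  have hindep : ∀ g : (ι → κ → SignType) → ℝ, DependsOnly (fun _ b => b ≠ a) g →
      mean q (fun Y => ind (colSupp Y R a = U) * g Y) =
        mean q (fun Y => ind (colSupp Y R a = U)) * mean q g := fun g hg =>
    mean_mul_of_dependsOnly q (fun _ _ h => h) hcol hg
  set p := mean q (fun Y : ι → κ → SignType => ind (colSupp Y R a = U)) with hp
  have hp0 : 0 ≤ p := mean_nonneg hq fun _ => ind_nonneg _
  have hQ' : 16 * ((Q.erase a).card : ℝ) ≤ R.card := by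
    refine le_trans ?_ hR
    have : (Q.erase a).card ≤ Q.card := Finset.card_le_card (Finset.erase_subset a Q)
    have : ((Q.erase a).card : ℝ) ≤ Q.card := by exact_mod_cast this
    linarith
  have hsp : ∀ Y Y' : ι → κ → SignType, (∀ i b, b ≠ a → Y i b = Y' i b) →
      (Sparse q Y (R \ U) (Q.erase a) ↔ Sparse q Y' (R \ U) (Q.erase a)) := fun Y Y' h =>
    sparse_congr fun i _ b hb => h i b (Finset.ne_of_mem_erase hb)
  have hex : ∀ Y Y' : ι → κ → SignType, (∀ i b, b ≠ a → Y i b = Y' i b) →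
      (Exposed Y R (Q.erase a) U ↔ Exposed Y' R (Q.erase a) U) := fun Y Y' h =>
    exposed_congr fun i b hb => h i b (Finset.ne_of_mem_erase hb)
  -- A bad column with support `U` has one of four causes: `U` is too small; the column is close to
  -- a span of small leverage on `U`; `U` is exposed although `R \ U` is not sparse; `R \ U` is
  -- sparse. In the last case `f` is replaced by its maximum `x ^ |Q|`, since it is not independent
  -- of sparsity.
  have hpt : ∀ Y, ind (colSupp Y R a = U) * (ind (¬GoodCol δ Y R Q a) * f Y) ≤
      ind ((U.card : ℝ) / 2 < δ a) * (ind (colSupp Y R a = U) * f Y) +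
      (ind (colSupp Y R a = U) * (ind (¬(2 * U.card < R.card ∧ Exposed Y R (Q.erase a) U) ∧
        Near Y R (Q.erase a) a ((U.card : ℝ) / 2)) * f Y) +
      (ind (colSupp Y R a = U) *
        (ind (Exposed Y R (Q.erase a) U) * (ind (¬Sparse q Y (R \ U) (Q.erase a)) * f Y)) +
      ind (2 * U.card < R.card) * (ind (colSupp Y R a = U) *
        (x ^ Q.card * ind (Sparse q Y (R \ U) (Q.erase a)))))) := by
    intro Y
    have n1 := hf0 Y
    have t1 : 0 ≤ ind ((U.card : ℝ) / 2 < δ a) * (ind (colSupp Y R a = U) * f Y) :=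
      mul_nonneg (ind_nonneg _) (mul_nonneg (ind_nonneg _) n1)
    have t2 : 0 ≤ ind (colSupp Y R a = U) *
        (ind (¬(2 * U.card < R.card ∧ Exposed Y R (Q.erase a) U) ∧
        Near Y R (Q.erase a) a ((U.card : ℝ) / 2)) * f Y) :=
      mul_nonneg (ind_nonneg _) (mul_nonneg (ind_nonneg _) n1)
    have t3 : 0 ≤ ind (colSupp Y R a = U) *
        (ind (Exposed Y R (Q.erase a) U) * (ind (¬Sparse q Y (R \ U) (Q.erase a)) * f Y)) :=
      mul_nonneg (ind_nonneg _) (mul_nonneg (ind_nonneg _) (mul_nonneg (ind_nonneg _) n1))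
    have t4 : 0 ≤ ind (2 * U.card < R.card) * (ind (colSupp Y R a = U) *
        (x ^ Q.card * ind (Sparse q Y (R \ U) (Q.erase a)))) :=
      mul_nonneg (ind_nonneg _) (mul_nonneg (ind_nonneg _)
        (mul_nonneg (by positivity) (ind_nonneg _)))
    by_cases hUa : colSupp Y R a = U
    swap
    · rw [ind_of_not hUa, zero_mul]; rw [ind_of_not hUa] at t1 t2 t3 t4; linarith
    by_cases hg : GoodCol δ Y R Q a
    · rw [ind_of_not (not_not.2 hg), zero_mul, mul_zero]; linarith
    have hlhs : ind (colSupp Y R a = U) * (ind (¬GoodCol δ Y R Q a) * f Y) = f Y := by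
      rw [ind_of hUa, ind_of hg]; ring
    rw [hlhs]
    by_cases h1 : (U.card : ℝ) / 2 < δ a
    · have e : ind ((U.card : ℝ) / 2 < δ a) * (ind (colSupp Y R a = U) * f Y) = f Y := by
        rw [ind_of hUa, ind_of h1]; ring
      linarith
    have hnear : Near Y R (Q.erase a) a ((U.card : ℝ) / 2) := by
      obtain ⟨z, hz⟩ := near_of_not_goodCol ha hg
      exact ⟨z, hz.trans_le (not_lt.1 h1)⟩
    by_cases h2 : 2 * U.card < R.card ∧ Exposed Y R (Q.erase a) U
    swap
    · have e : ind (colSupp Y R a = U) *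
          (ind (¬(2 * U.card < R.card ∧ Exposed Y R (Q.erase a) U) ∧
          Near Y R (Q.erase a) a ((U.card : ℝ) / 2)) * f Y) = f Y := by
        rw [ind_of hUa, ind_of ⟨h2, hnear⟩]; ring
      linarith
    by_cases h3 : Sparse q Y (R \ U) (Q.erase a)
    · have e : ind (2 * U.card < R.card) * (ind (colSupp Y R a = U) *
          (x ^ Q.card * ind (Sparse q Y (R \ U) (Q.erase a)))) = x ^ Q.card := by
        rw [ind_of hUa, ind_of h2.1, ind_of h3]; ring
      have h4 : f Y ≤ x ^ Q.card := pow_le_pow_right₀ hx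
        ((badNum_le_card _ _ _ _).trans (Finset.card_le_card (Finset.erase_subset a Q)))
      linarith
    · have e : ind (colSupp Y R a = U) * (ind (Exposed Y R (Q.erase a) U) *
          (ind (¬Sparse q Y (R \ U) (Q.erase a)) * f Y)) = f Y := by
        rw [ind_of hUa, ind_of h2.2, ind_of h3]; ring
      linarith
  refine (mean_mono hq hpt).trans ?_
  rw [mean_add, mean_add, mean_add, mean_mul_left, mean_mul_left]
  have b1 := hindep f hfcol
  have b2 := mean_near_le hq (Finset.notMem_erase a Q) hQ' hf0 hfcol (U := U)
  rw [b1] at b2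
  have b3 := hindep (fun Y => ind (Exposed Y R (Q.erase a) U) *
    (ind (¬Sparse q Y (R \ U) (Q.erase a)) * f Y)) (fun Y Y' h => by
      simp only []
      rw [hex Y Y' h, hsp Y Y' h, hfcol Y Y' h])
  have b3' := mul_le_mul_of_nonneg_left (mean_exposed_le hq (R := R) (Q := Q.erase a) hf0 hfrow) hp0
  rw [← b3] at b3'
  have b4 := hindep (fun Y => x ^ Q.card * ind (Sparse q Y (R \ U) (Q.erase a)))
    (fun Y Y' h => by simp only []; rw [hsp Y Y' h])
  rw [mean_mul_left] at b4
  rw [b1, b4]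
  linarith

end

end LongTail

/-! ### Summation over supports and induction on the columns. -/

namespace LongTail

set_option linter.unusedSectionVars false

noncomputable section

variable {ι κ : Type*} [Fintype ι] [Fintype κ] [DecidableEq ι] [DecidableEq κ]

/-- The exponential moments of the size of the support of a column. -/
theorem mean_exp_colSupp_le {q : κ → ℝ} (hq : IsProb q) (R : Finset ι) (a : κ) (s : ℝ) :
    mean q (fun Y : ι → κ → SignType => Real.exp (-s * (colSupp Y R a).card)) ≤
      Real.exp (-(q a * (1 - Real.exp (-s)) * R.card)) := by
  have h1 : ∀ Y : ι → κ → SignType, Real.exp (-s * (colSupp Y R a).card) =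
      ∏ i ∈ R, Real.exp (-s * ind (Y i a ≠ 0)) := by
    intro Y
    rw [← Real.exp_sum, ← Finset.mul_sum]
    congr 2
    unfold colSupp
    rw [Finset.card_filter]
    push_cast
    exact Finset.sum_congr rfl fun i _ => by by_cases h : Y i a = 0 <;> simp [ind, h]
  simp only [h1]
  rw [mean_prod_finset q R (fun g => Real.exp (-s * ind (g a ≠ 0))),
    rowMean_coord q a (fun t => Real.exp (-s * ind (t ≠ 0))), sum_signType]
  have e0 : ind ((0 : SignType) ≠ 0) = 0 := ind_of_not (by decide)
  have e1 : ind ((1 : SignType) ≠ 0) = 1 := ind_of (by decide)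
  have e2 : ind ((-1 : SignType) ≠ 0) = 1 := ind_of (by decide)
  have h01 := hq a
  have h2 : signWeight (q a) 0 * Real.exp (-s * ind ((0 : SignType) ≠ 0)) +
      signWeight (q a) 1 * Real.exp (-s * ind ((1 : SignType) ≠ 0)) +
      signWeight (q a) (-1) * Real.exp (-s * ind ((-1 : SignType) ≠ 0)) =
      1 - q a * (1 - Real.exp (-s)) := by
    rw [e0, e1, e2]
    simp [signWeight]
    ring
  rw [h2]
  have h3 : 0 ≤ 1 - q a * (1 - Real.exp (-s)) := by
    have := Real.exp_pos (-s)
    nlinarith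
  have h4 : 1 - q a * (1 - Real.exp (-s)) ≤ Real.exp (-(q a * (1 - Real.exp (-s)))) := by
    have := Real.add_one_le_exp (-(q a * (1 - Real.exp (-s))))
    linarith
  refine (pow_le_pow_left₀ h3 h4 _).trans (le_of_eq ?_)
  rw [← Real.exp_nat_mul]
  congr 1
  ring

theorem sum_ind_colSupp (Y : ι → κ → SignType) (R : Finset ι) (a : κ) (g : Finset ι → ℝ) :
    ∑ U ∈ R.powerset, ind (colSupp Y R a = U) * g U = g (colSupp Y R a) := by
  rw [Finset.sum_eq_single (colSupp Y R a)]
  · rw [ind_of rfl, one_mul]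
  · intro U _ hU
    rw [ind_of_not (Ne.symm hU), zero_mul]
  · intro h
    exact absurd (Finset.mem_powerset.2 (Finset.filter_subset _ _)) h

/-- The rates `1` and `1 / 16` of the two bounds in the size of the support, each reduced by the `1
/ 2048` charged per deleted row, are still large enough to beat the threshold `δ`. -/
theorem exp_small_constants :
    Real.exp (-(1 - 1 / 2048 : ℝ)) ≤ 9 / 20 ∧ Real.exp (-(1 / 16 - 1 / 2048 : ℝ)) ≤ 32 / 33 := by
  constructor
  · have h := Real.quadratic_le_exp_of_nonneg (x := 1 - 1 / 2048) (by norm_num)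
    rw [Real.exp_neg]
    apply inv_le_of_inv_le₀ (by norm_num)
    refine le_trans ?_ h
    norm_num
  · have h := Real.add_one_le_exp (1 / 16 - 1 / 2048 : ℝ)
    rw [Real.exp_neg]
    apply inv_le_of_inv_le₀ (by norm_num)
    refine le_trans ?_ h
    norm_num

/-- The contribution of one bad column. -/
theorem mean_bad_le {q δ : κ → ℝ} (hq : IsProb q) {R I : Finset ι} {Q K : Finset κ} {a : κ}
    (ha : a ∈ Q) (hQK : Q ⊆ K) {x ν : ℝ} (hx : 1 ≤ x) (hν : 0 < ν) (hδ : δ a = ν * q a / 8)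
    (hRI : R ⊆ I) (hR : ν / 2 ≤ R.card) (hK : 8704 * (K.card : ℝ) ≤ ν / 8)
    (hxK : x ^ K.card ≤ Real.exp (ν / 8192))
    (ih : ∀ R ⊆ I, mean q (fun Y : ι → κ → SignType => x ^ badNum δ Y R (Q.erase a)) ≤
      2 * Real.exp (((I.card : ℝ) - R.card) / 2048)) :
    mean q (fun Y => ind (¬GoodCol δ Y R Q a) *
      x ^ badNum δ Y (R \ colSupp Y R a) (Q.erase a)) ≤
    2 * Real.exp (((I.card : ℝ) - R.card) / 2048) *
      (3 * Real.exp (-(ν * q a / 100)) + Real.exp (-ν / 8192)) := by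
  set D := ((I.card : ℝ) - R.card) / 2048 with hD
  have hQ : (Q.card : ℝ) ≤ K.card := by exact_mod_cast Finset.card_le_card hQK
  have hRQ : 16 * (Q.card : ℝ) ≤ R.card := by
    have : (0 : ℝ) ≤ Q.card := by positivity
    linarith
  have hq01 := hq a
  have hD1 : 1 ≤ Real.exp D := Real.one_le_exp (by
    have : (R.card : ℝ) ≤ I.card := by exact_mod_cast Finset.card_le_card hRI
    rw [hD]; linarith)
  have h1 : mean q (fun Y => ind (¬GoodCol δ Y R Q a) *
      x ^ badNum δ Y (R \ colSupp Y R a) (Q.erase a)) =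
      ∑ U ∈ R.powerset, mean q (fun Y => ind (colSupp Y R a = U) *
      (ind (¬GoodCol δ Y R Q a) * x ^ badNum δ Y (R \ U) (Q.erase a))) := by
    rw [← mean_sum]
    congr 1
    funext Y
    rw [sum_ind_colSupp Y R a (fun U => ind (¬GoodCol δ Y R Q a) *
      x ^ badNum δ Y (R \ U) (Q.erase a))]
  -- The induction hypothesis for `R \ U` costs an extra `exp (|U| / 2048)`, absorbed into both
  -- exponents of `|U|`. The last summand is the sparse case: `exp (ν / 8192) * exp (-ν / 4096)`.
  set c : Finset ι → ℝ := fun U =>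
    2 * Real.exp D * (Real.exp (ν * q a / 4) * Real.exp (-(1 - 1 / 2048) * U.card) +
      2 * Real.exp (-(1 / 16 - 1 / 2048) * U.card)) + Real.exp (-ν / 8192) with hc
  have h2 : ∀ U ∈ R.powerset, mean q (fun Y => ind (colSupp Y R a = U) *
      (ind (¬GoodCol δ Y R Q a) * x ^ badNum δ Y (R \ U) (Q.erase a))) ≤
      mean q (fun Y : ι → κ → SignType => ind (colSupp Y R a = U) * c U) := by
    intro U hU
    rw [Finset.mem_powerset] at hU
    refine (mean_bad_supp_le hq ha hx hRQ).trans ?_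
    rw [mean_mul_right]
    refine mul_le_mul_of_nonneg_left ?_ (mean_nonneg hq fun _ => ind_nonneg _)
    have hUR : U.card ≤ R.card := Finset.card_le_card hU
    have hcard : ((R \ U).card : ℝ) = R.card - U.card := by
      rw [Finset.card_sdiff_of_subset hU, Nat.cast_sub hUR]
    refine add_le_add ?_ ?_
    · have i1 := ih (R \ U) (Finset.sdiff_subset.trans hRI)
      rw [hcard, show ((I.card : ℝ) - (R.card - U.card)) / 2048 = D + U.card / 2048 by
        rw [hD]; ring, Real.exp_add] at i1
      -- Chernoff's method: the event says `|U| < 2 δ_a = ν q_a / 4`, while the mean of `|U|` is at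
      -- least `ν q_a / 2`.
      have i2 : ind ((U.card : ℝ) / 2 < δ a) ≤ Real.exp (ν * q a / 4 - U.card) := by
        by_cases h : (U.card : ℝ) / 2 < δ a
        · rw [ind_of h]
          rw [hδ] at h
          exact Real.one_le_exp (by linarith)
        · rw [ind_of_not h]; exact (Real.exp_pos _).le
      calc _ ≤ (2 * (Real.exp D * Real.exp ((U.card : ℝ) / 2048))) *
            (Real.exp (ν * q a / 4 - U.card) + 2 * Real.exp (-(U.card : ℝ) / 16)) :=
            mul_le_mul i1 (by linarith)
              (add_nonneg (ind_nonneg _) (by positivity)) (by positivity)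
        _ = 2 * Real.exp D * (Real.exp ((U.card : ℝ) / 2048) * Real.exp (ν * q a / 4 - U.card) +
            2 * (Real.exp ((U.card : ℝ) / 2048) * Real.exp (-(U.card : ℝ) / 16))) := by ring
        _ = _ := by
            have e1 : Real.exp ((U.card : ℝ) / 2048) * Real.exp (ν * q a / 4 - U.card) =
                Real.exp (ν * q a / 4) * Real.exp (-(1 - 1 / 2048) * U.card) := by
              rw [← Real.exp_add, ← Real.exp_add]; congr 1; ring
            have e2 : Real.exp ((U.card : ℝ) / 2048) * Real.exp (-(U.card : ℝ) / 16) =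
                Real.exp (-(1 / 16 - 1 / 2048) * U.card) := by
              rw [← Real.exp_add]; congr 1; ring
            rw [e1, e2]
    · by_cases h : 2 * U.card < R.card
      swap
      · rw [ind_of_not h, zero_mul]; exact (Real.exp_pos _).le
      rw [ind_of h, one_mul]
      have h' : 2 * (U.card : ℝ) < R.card := by exact_mod_cast h
      have hQe : ((Q.erase a).card : ℝ) ≤ Q.card := by
        exact_mod_cast Finset.card_le_card (Finset.erase_subset a Q)
      have i3 := mean_sparse_le_exp (ι := ι) hq (Q := Q.erase a) (R := R \ U) (ν := ν)
        (by rw [hcard]; linarith) (by linarith)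
      have i4 : x ^ Q.card ≤ Real.exp (ν / 8192) :=
        (pow_le_pow_right₀ hx (Finset.card_le_card hQK)).trans hxK
      calc _ ≤ Real.exp (ν / 8192) * Real.exp (-ν / 4096) :=
            mul_le_mul i4 i3 (mean_nonneg hq fun _ => ind_nonneg _) (Real.exp_pos _).le
        _ = _ := by rw [← Real.exp_add]; congr 1; ring
  rw [h1]
  refine (Finset.sum_le_sum h2).trans ?_
  rw [← mean_sum]
  simp only [sum_ind_colSupp]
  simp only [hc]
  rw [mean_add, mean_const, mean_mul_left, mean_add, mean_mul_left, mean_mul_left]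
  obtain ⟨k1, k2⟩ := exp_small_constants
  have hqR : q a * (ν / 2) ≤ q a * R.card := mul_le_mul_of_nonneg_left hR hq01.1
  have hqν : 0 ≤ q a * ν := mul_nonneg hq01.1 hν.le
  have m1 : Real.exp (ν * q a / 4) * mean q (fun Y : ι → κ → SignType =>
      Real.exp (-(1 - 1 / 2048) * (colSupp Y R a).card)) ≤ Real.exp (-(ν * q a / 100)) := by
    refine (mul_le_mul_of_nonneg_left (mean_exp_colSupp_le hq R a (1 - 1 / 2048))
      (Real.exp_pos _).le).trans ?_
    rw [← Real.exp_add]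
    apply Real.exp_le_exp.2
    have : q a * (1 - Real.exp (-(1 - 1 / 2048))) * R.card ≥ 11 / 20 * (q a * R.card) := by
      have : (0 : ℝ) ≤ q a * R.card := by linarith
      nlinarith
    linarith
  have m2 : mean q (fun Y : ι → κ → SignType =>
      Real.exp (-(1 / 16 - 1 / 2048) * (colSupp Y R a).card)) ≤ Real.exp (-(ν * q a / 100)) := by
    refine (mean_exp_colSupp_le hq R a (1 / 16 - 1 / 2048)).trans ?_
    apply Real.exp_le_exp.2
    have : q a * (1 - Real.exp (-(1 / 16 - 1 / 2048))) * R.card ≥ 1 / 33 * (q a * R.card) := by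
      have : (0 : ℝ) ≤ q a * R.card := by linarith
      nlinarith
    linarith
  have m3 : Real.exp (-ν / 8192) ≤ 2 * Real.exp D * Real.exp (-ν / 8192) := by
    have := Real.exp_pos (-ν / 8192)
    nlinarith
  have m4 : 2 * Real.exp D * (Real.exp (ν * q a / 4) * mean q (fun Y : ι → κ → SignType =>
      Real.exp (-(1 - 1 / 2048) * (colSupp Y R a).card)) +
      2 * mean q (fun Y : ι → κ → SignType =>
      Real.exp (-(1 / 16 - 1 / 2048) * (colSupp Y R a).card))) ≤
      2 * Real.exp D * (Real.exp (-(ν * q a / 100)) + 2 * Real.exp (-(ν * q a / 100))) :=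
    mul_le_mul_of_nonneg_left (by linarith) (by positivity)
  linarith

/-- The exponential moments of the number of bad columns. -/
theorem mean_pow_badNum_le {q δ : κ → ℝ} (hq : IsProb q) {I : Finset ι} {K : Finset κ}
    {x ν : ℝ} (hx : 1 ≤ x) (hν : 0 < ν) (hδ : ∀ a ∈ K, δ a = ν * q a / 8)
    (hI : 3 / 4 * ν ≤ I.card) (hK : 8704 * (K.card : ℝ) ≤ ν / 8)
    (hxK : x ^ K.card ≤ Real.exp (ν / 8192))
    (hsum : ∑ a ∈ K, x * (3 * Real.exp (-(ν * q a / 100)) + Real.exp (-ν / 8192)) ≤ 1 / 2)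
    (Q : Finset κ) : Q ⊆ K → ∀ R ⊆ I,
      mean q (fun Y : ι → κ → SignType => x ^ badNum δ Y R Q) ≤
        2 * Real.exp (((I.card : ℝ) - R.card) / 2048) := by
  induction Q using Finset.strongInduction with
  | H Q ih =>
  intro hQK R hRI
  have hx0 : 0 ≤ x := by linarith
  have hRc : (R.card : ℝ) ≤ I.card := by exact_mod_cast Finset.card_le_card hRI
  have hD1 : 1 ≤ Real.exp (((I.card : ℝ) - R.card) / 2048) := Real.one_le_exp (by linarith)
  -- When fewer than `ν / 2` rows remain, more than `ν / 4` have been deleted from `I`, and the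
  -- factor `exp ((|I| - |R|) / 2048)` already exceeds the trivial bound `x ^ |K| ≤ exp (ν / 8192)`.
  by_cases hR : ν / 2 ≤ R.card
  swap
  · push Not at hR
    have h1 : ∀ Y : ι → κ → SignType, x ^ badNum δ Y R Q ≤
        2 * Real.exp (((I.card : ℝ) - R.card) / 2048) := by
      intro Y
      calc x ^ badNum δ Y R Q ≤ x ^ K.card := pow_le_pow_right₀ hx
            ((badNum_le_card _ _ _ _).trans (Finset.card_le_card hQK))
        _ ≤ Real.exp (ν / 8192) := hxK
        _ ≤ Real.exp (((I.card : ℝ) - R.card) / 2048) := Real.exp_le_exp.2 (by linarith)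
        _ ≤ _ := by linarith
    refine (mean_mono hq h1).trans (le_of_eq (mean_const _ _))
  -- Either no column is bad and the power is `1`, or some bad column can be peeled off; the sum is
  -- a union bound over the choice.
  have hpt : ∀ Y : ι → κ → SignType, x ^ badNum δ Y R Q ≤ 1 + ∑ a ∈ Q, x *
      (ind (¬GoodCol δ Y R Q a) * x ^ badNum δ Y (R \ colSupp Y R a) (Q.erase a)) := by
    intro Y
    have hnn : ∀ a ∈ Q, 0 ≤ x *
        (ind (¬GoodCol δ Y R Q a) * x ^ badNum δ Y (R \ colSupp Y R a) (Q.erase a)) :=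
      fun a _ => mul_nonneg hx0 (mul_nonneg (ind_nonneg _) (by positivity))
    by_cases hg : ∀ b ∈ Q, GoodCol δ Y R Q b
    · rw [badNum_eq_zero hg, pow_zero]
      linarith [Finset.sum_nonneg hnn]
    · push Not at hg
      obtain ⟨a, ha, hb⟩ := hg
      have h1 := Finset.single_le_sum hnn ha
      rw [ind_of hb, one_mul] at h1
      have h2 : x ^ badNum δ Y R Q ≤ x ^ (badNum δ Y (R \ colSupp Y R a) (Q.erase a) + 1) :=
        pow_le_pow_right₀ hx (badNum_le_succ δ Y R ha)
      rw [pow_succ'] at h2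
      linarith
  refine (mean_mono hq hpt).trans ?_
  rw [mean_add, mean_const, mean_sum]
  simp only [mean_mul_left]
  have hb : ∑ a ∈ Q, x * mean q (fun Y => ind (¬GoodCol δ Y R Q a) *
      x ^ badNum δ Y (R \ colSupp Y R a) (Q.erase a)) ≤
      2 * Real.exp (((I.card : ℝ) - R.card) / 2048) * (1 / 2) := by
    refine le_trans ?_ (mul_le_mul_of_nonneg_left hsum (by positivity))
    rw [Finset.mul_sum]
    refine (Finset.sum_le_sum fun a ha => mul_le_mul_of_nonneg_left
      (mean_bad_le hq ha hQK hx hν (hδ a (hQK ha)) hRI hR hK hxK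
        (ih _ (Finset.erase_ssubset ha) ((Finset.erase_subset a Q).trans hQK))) hx0).trans ?_
    refine (le_of_eq (Finset.sum_congr rfl fun a _ => by ring)).trans
      (Finset.sum_le_sum_of_subset_of_nonneg hQK
        (f := fun a => 2 * Real.exp (((I.card : ℝ) - R.card) / 2048) *
          (x * (3 * Real.exp (-(ν * q a / 100)) + Real.exp (-ν / 8192)))) fun a _ _ => by positivity)
  linarith

end

end LongTail

namespace LongTail

set_option linter.unusedSectionVars false

noncomputable section

/-! ### The pseudoinverse of a design matrix -/

section Pinv

open Matrix

variable {n d : ℕ} (X : Fin n → Fin d → ℝ)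

theorem isHermitian_gram : ((of X)ᵀ * of X).IsHermitian := by
  simpa using Matrix.isHermitian_conjTranspose_mul_self (of X)

/-- The pseudoinverse of a design matrix. -/
def pinv : Matrix (Fin d) (Fin n) ℝ := symPinv ((of X)ᵀ * of X) (isHermitian_gram X) * (of X)ᵀ

/-- The image of a vector under a design matrix. -/
def img (z : Fin d → ℝ) (i : Fin n) : ℝ := ∑ j, X i j * z j

/-- The noise part of the estimator. -/
def noisePart (ξ : Fin n → ℝ) (j : Fin d) : ℝ := ∑ i, pinv X j i * ξ i

/-- The component of `β` in the kernel of the design matrix. -/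
def residual (β : Fin d → ℝ) : Fin d → ℝ := β - pinv X *ᵥ (of X *ᵥ β)

/-- The squared norm of a row of the pseudoinverse. -/
def rowNorm (j : Fin d) : ℝ := ∑ i, pinv X j i ^ 2

theorem rowNorm_nonneg (j : Fin d) : 0 ≤ rowNorm X j := Finset.sum_nonneg fun _ _ => sq_nonneg _

theorem mulVec_eq_img (z : Fin d → ℝ) : of X *ᵥ z = img X z := rfl

theorem pinv_mulVec (ξ : Fin n → ℝ) : pinv X *ᵥ ξ = noisePart X ξ := rfl

theorem betaHat_sub (β : Fin d → ℝ) (ξ : Fin n → ℝ) (j : Fin d) :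
    betaHat X (labels X β ξ) j - β j = noisePart X ξ j - residual X β j := by
  have : betaHat X (labels X β ξ) = pinv X *ᵥ (of X *ᵥ β + ξ) := by
    unfold betaHat labels pinv
    rw [mulVec_mulVec]
  rw [this, mulVec_add, residual, ← pinv_mulVec]
  simp only [Pi.add_apply, Pi.sub_apply]
  ring

theorem proj_transpose : (pinv X * of X)ᵀ = pinv X * of X := by
  have := (symPinv_penrose _ (isHermitian_gram X)).2.2.2
  unfold pinv
  rwa [Matrix.mul_assoc]

theorem proj_mul_pinv : pinv X * of X * pinv X = pinv X := by
  have := (symPinv_penrose _ (isHermitian_gram X)).2.1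
  unfold pinv
  calc _ = symPinv ((of X)ᵀ * of X) (isHermitian_gram X) * ((of X)ᵀ * of X) *
        symPinv ((of X)ᵀ * of X) (isHermitian_gram X) * (of X)ᵀ := by
        simp only [Matrix.mul_assoc]
    _ = _ := by rw [this]

/-- The normal equations. The first Penrose equation for `XᵀX` gives this after multiplication by
`X` on the right, and `M XᵀX = 0` forces `M Xᵀ = 0`. -/
theorem gram_mul_pinv : (of X)ᵀ * of X * pinv X = (of X)ᵀ := by
  have h := (symPinv_penrose _ (isHermitian_gram X)).1
  set S := symPinv ((of X)ᵀ * of X) (isHermitian_gram X) with hS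
  have h1 : ((of X)ᵀ * of X * S - 1) * ((of X)ᵀ * of X) = 0 := by
    rw [Matrix.sub_mul, h, Matrix.one_mul, sub_self]
  have h2 : ((of X)ᵀ * of X * S - 1) * (of X)ᵀ = 0 := by
    have := (Matrix.mul_self_mul_conjTranspose_eq_zero (of X)ᵀ ((of X)ᵀ * of X * S - 1)).1
      (by simpa using h1)
    exact this
  rw [Matrix.sub_mul, Matrix.one_mul, sub_eq_zero] at h2
  calc (of X)ᵀ * of X * pinv X = (of X)ᵀ * of X * S * (of X)ᵀ := by
        simp only [pinv, ← hS, Matrix.mul_assoc]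
    _ = _ := h2

theorem mul_proj : of X * (pinv X * of X) = of X := by
  have h : (of X)ᵀ * (of X * (pinv X * of X) - of X) = 0 := by
    rw [Matrix.mul_sub, sub_eq_zero, ← Matrix.mul_assoc, ← Matrix.mul_assoc, gram_mul_pinv]
  have h2 : (of X)ᴴ * of X * (pinv X * of X - 1) = 0 := by
    rw [← h, Matrix.mul_sub, Matrix.mul_sub]
    simp [Matrix.mul_assoc]
  have h3 := (Matrix.conjTranspose_mul_self_mul_eq_zero (of X) _).1 h2
  rw [Matrix.mul_sub, Matrix.mul_one, sub_eq_zero] at h3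
  exact h3

theorem img_residual (β : Fin d → ℝ) : img X (residual X β) = 0 := by
  rw [← mulVec_eq_img, residual, mulVec_sub, mulVec_mulVec, mulVec_mulVec, Matrix.mul_assoc, mul_proj,
    sub_self]

theorem noisePart_dotProduct (ξ : Fin n → ℝ) {w : Fin d → ℝ} (hw : img X w = 0) :
    noisePart X ξ ⬝ᵥ w = 0 := by
  rw [← pinv_mulVec, ← proj_mul_pinv, ← mulVec_mulVec, dotProduct_comm, dotProduct_mulVec,
    ← mulVec_transpose, proj_transpose, ← mulVec_mulVec, mulVec_eq_img, hw]
  simp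

theorem proj_dotProduct (β : Fin d → ℝ) {w : Fin d → ℝ} (hw : img X w = 0) :
    (pinv X *ᵥ (of X *ᵥ β)) ⬝ᵥ w = 0 := noisePart_dotProduct X _ hw

theorem sum_sq_residual_le (β : Fin d → ℝ) : ∑ j, residual X β j ^ 2 ≤ ∑ j, β j ^ 2 := by
  have h := proj_dotProduct X β (img_residual X β)
  have e : ∀ j, β j = (pinv X *ᵥ (of X *ᵥ β)) j + residual X β j := by
    intro j; simp [residual]
  have : ∑ j, β j ^ 2 = ∑ j, (pinv X *ᵥ (of X *ᵥ β)) j ^ 2 + ∑ j, residual X β j ^ 2 +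
      2 * ((pinv X *ᵥ (of X *ᵥ β)) ⬝ᵥ residual X β) := by
    rw [dotProduct, Finset.mul_sum, ← Finset.sum_add_distrib, ← Finset.sum_add_distrib]
    refine Finset.sum_congr rfl fun j _ => ?_
    conv_lhs => rw [e j]
    ring
  rw [this, h]
  have : 0 ≤ ∑ j, (pinv X *ᵥ (of X *ᵥ β)) j ^ 2 := Finset.sum_nonneg fun _ _ => sq_nonneg _
  linarith

theorem img_single_of_zero {j : Fin d} (h : ∀ i, X i j = 0) : img X (Pi.single j 1) = 0 := by
  funext i
  simp [img, Pi.single_apply, h]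

theorem noisePart_of_zero (ξ : Fin n → ℝ) {j : Fin d} (h : ∀ i, X i j = 0) :
    noisePart X ξ j = 0 := by
  have := noisePart_dotProduct X ξ (img_single_of_zero X h)
  simpa using this

theorem residual_of_zero (β : Fin d → ℝ) {j : Fin d} (h : ∀ i, X i j = 0) :
    residual X β j = β j := by
  have := noisePart_of_zero X (of X *ᵥ β) h
  rw [← pinv_mulVec] at this
  rw [residual, Pi.sub_apply, this, sub_zero]

/-- Among the solutions of the same linear system, the noise part is the shortest. -/
theorem sum_sq_noisePart_le (ξ : Fin n → ℝ) {z : Fin d → ℝ}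
    (hz : img X z = img X (noisePart X ξ)) :
    ∑ j, noisePart X ξ j ^ 2 ≤ ∑ j, z j ^ 2 := by
  have h0 : img X (z - noisePart X ξ) = 0 := by
    rw [← mulVec_eq_img, mulVec_sub, mulVec_eq_img, mulVec_eq_img, hz, sub_self]
  have h := noisePart_dotProduct X ξ h0
  have : ∑ j, z j ^ 2 = ∑ j, noisePart X ξ j ^ 2 + ∑ j, (z - noisePart X ξ) j ^ 2 +
      2 * (noisePart X ξ ⬝ᵥ (z - noisePart X ξ)) := by
    rw [dotProduct, Finset.mul_sum, ← Finset.sum_add_distrib, ← Finset.sum_add_distrib]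
    refine Finset.sum_congr rfl fun j _ => ?_
    simp only [Pi.sub_apply]
    ring
  rw [this, h]
  have : 0 ≤ ∑ j, (z - noisePart X ξ) j ^ 2 := Finset.sum_nonneg fun _ _ => sq_nonneg _
  linarith

theorem sum_sq_img_noisePart_le (ξ : Fin n → ℝ) :
    ∑ i, img X (noisePart X ξ) i ^ 2 ≤ ∑ i, ξ i ^ 2 := by
  have h : img X (noisePart X ξ) ⬝ᵥ (img X (noisePart X ξ) - ξ) = 0 := by
    rw [← mulVec_eq_img, ← pinv_mulVec, dotProduct_comm, dotProduct_mulVec, ← mulVec_transpose,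
      mulVec_sub, mulVec_mulVec, mulVec_mulVec, gram_mul_pinv, sub_self,
      zero_dotProduct]
  have : ∑ i, ξ i ^ 2 = ∑ i, img X (noisePart X ξ) i ^ 2 +
      ∑ i, (img X (noisePart X ξ) - ξ) i ^ 2 -
      2 * (img X (noisePart X ξ) ⬝ᵥ (img X (noisePart X ξ) - ξ)) := by
    rw [dotProduct, Finset.mul_sum, ← Finset.sum_add_distrib, ← Finset.sum_sub_distrib]
    refine Finset.sum_congr rfl fun j _ => ?_
    simp only [Pi.sub_apply]
    ring
  rw [this, h]
  have : 0 ≤ ∑ i, (img X (noisePart X ξ) - ξ) i ^ 2 := Finset.sum_nonneg fun _ _ => sq_nonneg _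
  linarith

/-- Bounds for a coordinate of the noise part are bounds for the row norm. -/
theorem rowNorm_le_of_noisePart {j : Fin d} {c : ℝ} (hc : 0 ≤ c)
    (h : ∀ ξ, noisePart X ξ j ^ 2 ≤ c * ∑ i, img X (noisePart X ξ) i ^ 2) : rowNorm X j ≤ c := by
  have h1 : rowNorm X j ^ 2 ≤ c * rowNorm X j := by
    -- The noise tested is row `j` of the pseudoinverse itself: with `r` its squared norm, the bound
    -- reads `r² ≤ c r`.
    have e : noisePart X (fun i => pinv X j i) j = rowNorm X j :=
      Finset.sum_congr rfl fun _ _ => by ring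
    have := (h fun i => pinv X j i).trans
      (mul_le_mul_of_nonneg_left (sum_sq_img_noisePart_le X _) hc)
    rwa [e] at this
  rcases (rowNorm_nonneg X j).eq_or_lt with h0 | h0
  · rw [← h0]; exact hc
  · nlinarith

theorem rowNorm_le_of_forall {j : Fin d} {c : ℝ} (hc : 0 ≤ c)
    (h : ∀ z : Fin d → ℝ, z j ^ 2 ≤ c * ∑ i, img X z i ^ 2) : rowNorm X j ≤ c :=
  rowNorm_le_of_noisePart X hc fun _ => h _

theorem rowNorm_of_zero {j : Fin d} (h : ∀ i, X i j = 0) : rowNorm X j = 0 :=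
  le_antisymm (rowNorm_le_of_noisePart X le_rfl fun ξ => by simp [noisePart_of_zero X ξ h])
    (rowNorm_nonneg X j)

/-- A linear form which does not see the kernel is bounded through the pseudoinverse. -/
theorem sq_dotProduct_le (c z : Fin d → ℝ) (hc : ∀ w, img X w = 0 → c ⬝ᵥ w = 0) :
    (c ⬝ᵥ z) ^ 2 ≤ (∑ a, ∑ b, (∑ i, pinv X a i * pinv X b i) * (c a * c b)) *
      ∑ i, img X z i ^ 2 := by
  -- The form takes the same value on `z` and on `X† X z`, as these differ by a kernel vector.
  -- Cauchy–Schwarz then applies to `c X†`.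
  have h1 : c ⬝ᵥ z = c ⬝ᵥ (pinv X *ᵥ img X z) := by
    have h := hc _ (img_residual X z)
    rw [residual, dotProduct_sub, sub_eq_zero] at h
    exact h
  have h2 : c ⬝ᵥ (pinv X *ᵥ img X z) = ∑ i, (∑ a, c a * pinv X a i) * img X z i := by
    rw [dotProduct_mulVec]; rfl
  have h3 : ∑ a, ∑ b, (∑ i, pinv X a i * pinv X b i) * (c a * c b) =
      ∑ i, (∑ a, c a * pinv X a i) ^ 2 := by
    have e : ∀ i, (∑ a, c a * pinv X a i) ^ 2 =
        ∑ a, ∑ b, pinv X a i * pinv X b i * (c a * c b) := by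
      intro i
      rw [sq, Finset.sum_mul_sum]
      exact Finset.sum_congr rfl fun a _ => Finset.sum_congr rfl fun b _ => by ring
    simp only [e, Finset.sum_mul]
    rw [Finset.sum_comm (s := (Finset.univ : Finset (Fin n)))]
    exact Finset.sum_congr rfl fun a _ => Finset.sum_comm
  rw [h1, h2, h3]
  exact Finset.sum_mul_sq_le_sq_mul_sq _ _ _

end Pinv

end

end LongTail

namespace LongTail

set_option linter.unusedSectionVars false

noncomputable section

/-! ### Small solutions of integer systems -/

/-- An entry of the adjugate is a determinant with one row replaced by a unit vector; the Leibniz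
formula bounds it by `m! N ^ m ≤ N ^ (2 m)`. -/
theorem abs_adjugate_le {γ : Type*} [Fintype γ] [DecidableEq γ] (A : Matrix γ γ ℤ) {N m : ℕ}
    (hA : ∀ a b, |A a b| ≤ N) (hN : 1 ≤ N) (hm : Fintype.card γ ≤ m) (hmN : m ≤ N) (a b : γ) :
    |A.adjugate a b| ≤ (N : ℤ) ^ (2 * m) := by
  rw [Matrix.adjugate_apply]
  have h := Matrix.det_le (A := A.updateRow b (Pi.single a 1)) (abv := AbsoluteValue.abs)
    (x := (N : ℤ)) (fun i j => by
      rw [AbsoluteValue.abs_apply, Matrix.updateRow_apply]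
      split_ifs
      · rw [Pi.single_apply]
        split_ifs
        · simpa using hN
        · simp
      · exact hA i j)
  rw [AbsoluteValue.abs_apply] at h
  refine h.trans ?_
  rw [nsmul_eq_mul]
  have h1 : (Fintype.card γ).factorial * N ^ Fintype.card γ ≤ N ^ (2 * m) := by
    calc _ ≤ N ^ m * N ^ m := by
          refine Nat.mul_le_mul ?_ (Nat.pow_le_pow_right hN hm)
          calc _ ≤ (Fintype.card γ) ^ (Fintype.card γ) := Nat.factorial_le_pow _
            _ ≤ N ^ (Fintype.card γ) := Nat.pow_le_pow_left (hm.trans hmN) _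
            _ ≤ N ^ m := Nat.pow_le_pow_right hN hm
      _ = _ := by rw [← pow_add]; congr 1; ring
  exact_mod_cast h1

-- Cramer's rule for the normal equations: `BᵀB` is an invertible integer matrix, so its determinant
-- has absolute value at least `1`, and `det * z = adj (BᵀB) Bᵀ (B z)`. Integrality replaces any
-- estimate of the smallest singular value.
open Matrix in
theorem abs_le_of_injective {ρ γ : Type*} [Fintype ρ] [Fintype γ] [DecidableEq γ]
    (B : Matrix ρ γ ℤ) (hB : ∀ r c, |B r c| ≤ 2) {N m : ℕ} (hN : 4 * Fintype.card ρ + 1 ≤ N)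
    (hm : Fintype.card γ ≤ m) (hmN : m ≤ N) (z : γ → ℝ) {G : ℝ} (hG : 0 ≤ G)
    (hz : ∀ r, |∑ c, (B r c : ℝ) * z c| ≤ G)
    (hinj : ∀ y : γ → ℝ, (∀ r, ∑ c, (B r c : ℝ) * y c = 0) → y = 0) (c : γ) :
    |z c| ≤ (N : ℝ) ^ (2 * m + 2) * G := by
  set A : Matrix γ γ ℤ := Bᵀ * B with hA
  set B' : Matrix ρ γ ℝ := B.map (Int.castRingHom ℝ) with hB'
  have hA' : A.map (Int.castRingHom ℝ) = B'ᵀ * B' := by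
    rw [hA, Matrix.map_mul, ← Matrix.transpose_map]
  have hdet : A.det ≠ 0 := by
    intro h0
    have h1 : (B'ᵀ * B').det = 0 := by
      rw [← hA', ← RingHom.mapMatrix_apply, ← RingHom.map_det, h0, map_zero]
    obtain ⟨v, hv, hv0⟩ := Matrix.exists_mulVec_eq_zero_iff.2 h1
    have h2 : B' *ᵥ v = 0 := by
      have := (Matrix.conjTranspose_mul_self_mulVec_eq_zero B' v).1 (by simpa using hv0)
      exact this
    exact hv (hinj v fun r => by simpa [hB', mulVec, dotProduct] using congrFun h2 r)
  have h1 : A.det • z = (A.adjugate.map (Int.castRingHom ℝ)) *ᵥ (B'ᵀ *ᵥ (B' *ᵥ z)) := by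
    rw [mulVec_mulVec, mulVec_mulVec, Matrix.mul_assoc _ B'ᵀ, ← hA',
      ← Matrix.map_mul, Matrix.adjugate_mul]
    have e : (A.det • (1 : Matrix γ γ ℤ)).map (Int.castRingHom ℝ) = (A.det : ℝ) • 1 := by
      ext i j
      rw [Matrix.map_apply, Matrix.smul_apply, Matrix.smul_apply, Matrix.one_apply,
        Matrix.one_apply]
      split_ifs <;> simp
    rw [e, smul_mulVec, one_mulVec]
    ext c
    simp
  have h2 : ∀ c', |(B'ᵀ *ᵥ (B' *ᵥ z)) c'| ≤ N * G := by
    intro c'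
    refine (Finset.abs_sum_le_sum_abs _ _).trans ?_
    calc ∑ r, |B'ᵀ c' r * (B' *ᵥ z) r| ≤ ∑ _r : ρ, 2 * G := Finset.sum_le_sum fun r _ => by
          rw [abs_mul]
          refine mul_le_mul ?_ (hz r) (abs_nonneg _) (by norm_num)
          have := hB r c'
          simp only [hB', Matrix.transpose_apply, Matrix.map_apply, eq_intCast]
          exact_mod_cast this
      _ = (2 * Fintype.card ρ : ℝ) * G := by simp; ring
      _ ≤ N * G := by
        refine mul_le_mul_of_nonneg_right ?_ hG
        have : 2 * Fintype.card ρ ≤ N := by omega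
        exact_mod_cast this
  have hAle : ∀ a b, |A a b| ≤ (N : ℤ) := by
    intro a b
    rw [hA, Matrix.mul_apply]
    refine (Finset.abs_sum_le_sum_abs _ _).trans ?_
    calc ∑ r, |Bᵀ a r * B r b| ≤ ∑ _r : ρ, (4 : ℤ) := Finset.sum_le_sum fun r _ => by
          rw [abs_mul]
          calc _ ≤ (2 : ℤ) * 2 := mul_le_mul (hB r a) (hB r b) (abs_nonneg _) (by norm_num)
            _ = 4 := by norm_num
      _ = 4 * (Fintype.card ρ : ℤ) := by simp; ring
      _ ≤ N := by have : 4 * Fintype.card ρ ≤ N := by omega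
                  exact_mod_cast this
  have h3 : |(A.det • z) c| ≤ (N : ℝ) ^ (2 * m + 2) * G := by
    rw [h1]
    refine (Finset.abs_sum_le_sum_abs _ _).trans ?_
    calc _ ≤ ∑ _c : γ, (N : ℝ) ^ (2 * m) * (N * G) := Finset.sum_le_sum fun c' _ => by
          rw [abs_mul]
          refine mul_le_mul ?_ (h2 c') (abs_nonneg _) (by positivity)
          have := abs_adjugate_le A hAle (by omega) hm hmN c c'
          simp only [Matrix.map_apply, eq_intCast]
          exact_mod_cast this
      _ = (Fintype.card γ : ℝ) * ((N : ℝ) ^ (2 * m) * (N * G)) := by simp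
      _ ≤ N * ((N : ℝ) ^ (2 * m) * (N * G)) := by
        refine mul_le_mul_of_nonneg_right ?_ (by positivity)
        exact_mod_cast hm.trans hmN
      _ = _ := by ring
  refine le_trans ?_ h3
  rw [Pi.smul_apply, zsmul_eq_mul, abs_mul]
  have : (1 : ℝ) ≤ |(A.det : ℝ)| := by exact_mod_cast Int.one_le_abs hdet
  nlinarith [abs_nonneg (z c)]

/-- An integer system with entries bounded by `2` has a solution of controlled size. -/
theorem exists_small_solution {ρ γ : Type*} [Fintype ρ] [DecidableEq γ]
    (B : ρ → γ → ℤ) (hB : ∀ r c, |B r c| ≤ 2) {N m : ℕ} (hN : 4 * Fintype.card ρ + 1 ≤ N)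
    (hmN : m ≤ N) {G : ℝ} (hG : 0 ≤ G) (J : Finset γ) : J.card ≤ m →
      ∀ z : γ → ℝ, (∀ r, |∑ c ∈ J, (B r c : ℝ) * z c| ≤ G) →
      ∃ z' : γ → ℝ, (∀ r, ∑ c ∈ J, (B r c : ℝ) * z' c = ∑ c ∈ J, (B r c : ℝ) * z c) ∧
        ∀ c ∈ J, |z' c| ≤ (N : ℝ) ^ (2 * m + 2) * G := by
  induction J using Finset.strongInduction with
  | H J ih =>
  intro hm z hz
  -- A kernel vector allows one coordinate to be shifted to zero and dropped. Once no kernel is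
  -- left, Cramer's rule bounds the solution at hand.
  by_cases hker : ∃ y : γ → ℝ, (∃ c ∈ J, y c ≠ 0) ∧ ∀ r, ∑ c ∈ J, (B r c : ℝ) * y c = 0
  · obtain ⟨y, ⟨c, hc, hyc⟩, hy⟩ := hker
    set z1 : γ → ℝ := fun b => z b - z c / y c * y b with hz1
    have e1 : ∀ r, ∑ b ∈ J.erase c, (B r b : ℝ) * z1 b = ∑ b ∈ J, (B r b : ℝ) * z b := by
      intro r
      have h1 : ∑ b ∈ J, (B r b : ℝ) * z1 b = ∑ b ∈ J, (B r b : ℝ) * z b := by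
        have : ∀ b, (B r b : ℝ) * z1 b = (B r b : ℝ) * z b - z c / y c * ((B r b : ℝ) * y b) := by
          intro b; rw [hz1]; ring
        simp only [this, Finset.sum_sub_distrib, ← Finset.mul_sum, hy, mul_zero, sub_zero]
      rw [← h1, ← Finset.add_sum_erase J _ hc]
      have : z1 c = 0 := by simp [hz1, hyc]
      rw [this]; ring
    obtain ⟨z', h1, h2⟩ := ih _ (Finset.erase_ssubset hc)
      ((Finset.card_le_card (Finset.erase_subset c J)).trans hm) z1
      (fun r => by rw [e1]; exact hz r)
    refine ⟨fun b => if b = c then 0 else z' b, fun r => ?_, fun b hb => ?_⟩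
    · rw [← Finset.add_sum_erase J _ hc]
      simp only [if_true, mul_zero, zero_add]
      rw [← e1, ← h1]
      exact Finset.sum_congr rfl fun b hb => by rw [if_neg (Finset.ne_of_mem_erase hb)]
    · by_cases hbc : b = c
      · simp only [hbc, if_true, abs_zero]; positivity
      · simp only [hbc, if_false]
        exact h2 b (Finset.mem_erase.2 ⟨hbc, hb⟩)
  · push Not at hker
    refine ⟨z, fun _ => rfl, fun c hc => ?_⟩
    have conv : ∀ (y : γ → ℝ) r, ∑ b : J, (B r b : ℝ) * y b = ∑ b ∈ J, (B r b : ℝ) * y b :=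
      fun y r => Finset.sum_coe_sort J fun b => (B r b : ℝ) * y b
    refine abs_le_of_injective (Matrix.of fun r (b : J) => B r b) (fun r b => hB r b) hN
      (by simpa using hm) hmN (fun b : J => z b) hG (fun r => ?_) (fun y hy => ?_) ⟨c, hc⟩
    · simp only [Matrix.of_apply]
      rw [conv]; exact hz r
    · by_contra h
      obtain ⟨b, hb⟩ := Function.ne_iff.1 h
      set y' : γ → ℝ := fun b => if h : b ∈ J then y ⟨b, h⟩ else 0 with hy'
      have e : ∀ b : J, y' b = y b := fun b => by simp [hy']
      obtain ⟨r, hr⟩ := hker y' ⟨b, b.2, by rw [e]; exact hb⟩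
      apply hr
      rw [← conv, ← hy r]
      exact Finset.sum_congr rfl fun b _ => by rw [e]; rfl

end

end LongTail

namespace LongTail

set_option linter.unusedSectionVars false

noncomputable section

/-! ### Design matrices with at most one long-tail feature per sample -/

theorem mem_clearRows {ι κ : Type*} [Fintype ι] [Fintype κ] [DecidableEq ι] [DecidableEq κ]
    {Y : ι → κ → SignType} {R : Finset ι} {J : Finset κ} {i : ι} :
    i ∈ clearRows Y R J ↔ i ∈ R ∧ ∀ c ∈ J, Y i c = 0 := Finset.mem_filter

variable {n d : ℕ}

/-- The common columns. -/
def commonCols (d k : ℕ) : Finset (Fin d) := Finset.univ.filter fun j => (j : ℕ) + 1 ≤ k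

/-- The samples without long-tail features. -/
def cleanRows (k : ℕ) (Y : Fin n → Fin d → SignType) : Finset (Fin n) :=
  Finset.univ.filter fun i => ∀ l ∉ commonCols d k, Y i l = 0

/-- Every sample has at most one long-tail feature. -/
def SingleTail (k : ℕ) (Y : Fin n → Fin d → SignType) : Prop :=
  ∀ i, ∀ l ∉ commonCols d k, ∀ l' ∉ commonCols d k, Y i l ≠ 0 → Y i l' ≠ 0 → l = l'

theorem mem_commonCols {k : ℕ} {j : Fin d} : j ∈ commonCols d k ↔ (j : ℕ) + 1 ≤ k := by
  simp [commonCols]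

theorem lin_compl_of_clean {k : ℕ} {Y : Fin n → Fin d → SignType} {i : Fin n}
    (hi : i ∈ cleanRows k Y) (z : Fin d → ℝ) : lin Y (commonCols d k)ᶜ z i = 0 :=
  Finset.sum_eq_zero fun l hl => by
    rw [(Finset.mem_filter.1 hi).2 l (Finset.mem_compl.1 hl)]; simp

theorem lin_compl_of_singleTail {k : ℕ} {Y : Fin n → Fin d → SignType} (h : SingleTail k Y)
    {i : Fin n} {l : Fin d} (hl : l ∉ commonCols d k) (hil : Y i l ≠ 0) (z : Fin d → ℝ) :
    lin Y (commonCols d k)ᶜ z i = Y i l * z l := by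
  refine Finset.sum_eq_single l (fun l' hl' hne => ?_) fun h' =>
    absurd (Finset.mem_compl.2 hl) h'
  have : Y i l' = 0 := by
    by_contra h0
    exact hne (h i l' (Finset.mem_compl.1 hl') l hl h0 hil)
  rw [this]; simp

theorem img_realMat (Y : Fin n → Fin d → SignType) (k : ℕ) (z : Fin d → ℝ) (i : Fin n) :
    img (realMat Y) z i = lin Y (commonCols d k) z i + lin Y (commonCols d k)ᶜ z i :=
  (Finset.sum_add_sum_compl (commonCols d k) fun j => (Y i j : ℝ) * z j).symm

theorem lin_sdiff (Y : Fin n → Fin d → SignType) {J K : Finset (Fin d)} (hJ : J ⊆ K)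
    (z : Fin d → ℝ) (i : Fin n) : lin Y K z i = lin Y (K \ J) z i + lin Y J z i :=
  (Finset.sum_sdiff hJ (f := fun j => (Y i j : ℝ) * z j)).symm

theorem energy_clearRows_le {k : ℕ} (Y : Fin n → Fin d → SignType) {J : Finset (Fin d)}
    (hJ : J ⊆ commonCols d k) (z : Fin d → ℝ) :
    energy Y (clearRows Y (cleanRows k Y) J) (commonCols d k \ J) z ≤
      ∑ i, img (realMat Y) z i ^ 2 := by
  refine le_trans (Finset.sum_le_sum fun i hi => ?_) (Finset.sum_le_sum_of_subset_of_nonneg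
    (Finset.subset_univ (clearRows Y (cleanRows k Y) J)) fun i _ _ => sq_nonneg _)
  obtain ⟨h1, h2⟩ := mem_clearRows.1 hi
  have h3 : lin Y J z i = 0 := Finset.sum_eq_zero fun c hc => by rw [h2 c hc]; simp
  rw [img_realMat Y k, lin_compl_of_clean h1, lin_sdiff Y hJ, h3, add_zero, add_zero]

theorem energy_cleanRows_le {k : ℕ} (Y : Fin n → Fin d → SignType) (z : Fin d → ℝ) :
    energy Y (cleanRows k Y) (commonCols d k) z ≤
      ∑ i ∈ cleanRows k Y, img (realMat Y) z i ^ 2 :=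
  Finset.sum_le_sum fun i hi => by
    rw [img_realMat Y k, lin_compl_of_clean hi, add_zero]

theorem abs_coe_le_one (s : SignType) : |(s : ℝ)| ≤ 1 := by
  cases s <;> simp

theorem abs_coe_int_le_one (s : SignType) : |(s : ℤ)| ≤ 1 := by
  cases s <;> simp

theorem coe_coe_sign (s : SignType) : ((s : ℤ) : ℝ) = (s : ℝ) := by
  cases s <;> simp

theorem abs_lin_le (Y : Fin n → Fin d → SignType) (Q : Finset (Fin d)) {z : Fin d → ℝ} {U : ℝ}
    (h : ∀ b ∈ Q, |z b| ≤ U) (hU : 0 ≤ U) (i : Fin n) : |lin Y Q z i| ≤ d * U := by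
  refine (Finset.abs_sum_le_sum_abs _ _).trans ?_
  calc _ ≤ ∑ _b ∈ Q, U := Finset.sum_le_sum fun b hb => by
        rw [abs_mul]
        calc _ ≤ 1 * U := mul_le_mul (abs_coe_le_one _) (h b hb) (abs_nonneg _) (by norm_num)
          _ = U := one_mul U
    _ = Q.card * U := by simp
    _ ≤ d * U := by
      refine mul_le_mul_of_nonneg_right ?_ hU
      have := Finset.card_le_univ Q
      rw [Fintype.card_fin] at this
      exact_mod_cast this

/-- The integer system which the coefficients of the bad columns have to solve. -/
def integerSystem (k : ℕ) (Y : Fin n → Fin d → SignType) :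
    Fin n ⊕ (Fin n × Fin n × Fin d) → Fin d → ℤ := by
  classical exact fun r c => match r with
  | Sum.inl i => if i ∈ cleanRows k Y then (Y i c : ℤ) else 0
  | Sum.inr (i, i', l) => if l ∉ commonCols d k ∧ Y i l ≠ 0 ∧ Y i' l ≠ 0 then
      (Y i l : ℤ) * Y i c - (Y i' l : ℤ) * Y i' c else 0

theorem abs_integerSystem_le (k : ℕ) (Y : Fin n → Fin d → SignType)
    (r : Fin n ⊕ (Fin n × Fin n × Fin d)) (c : Fin d) : |integerSystem k Y r c| ≤ 2 := by
  unfold integerSystem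
  rcases r with i | ⟨i, i', l⟩
  · dsimp only
    split_ifs
    · exact (abs_coe_int_le_one _).trans (by norm_num)
    · simp
  · dsimp only
    split_ifs
    · refine (abs_sub _ _).trans ?_
      rw [abs_mul, abs_mul]
      have h1 := abs_coe_int_le_one (Y i l)
      have h2 := abs_coe_int_le_one (Y i c)
      have h3 := abs_coe_int_le_one (Y i' l)
      have h4 := abs_coe_int_le_one (Y i' c)
      have h5 := mul_le_mul h1 h2 (abs_nonneg _) (by norm_num)
      have h6 := mul_le_mul h3 h4 (abs_nonneg _) (by norm_num)
      linarith
    · simp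

theorem sum_integerSystem_inl {k : ℕ} {Y : Fin n → Fin d → SignType} {i : Fin n}
    (hi : i ∈ cleanRows k Y) (J : Finset (Fin d)) (z : Fin d → ℝ) :
    ∑ c ∈ J, (integerSystem k Y (Sum.inl i) c : ℝ) * z c = lin Y J z i :=
  Finset.sum_congr rfl fun c _ => by simp only [integerSystem, hi, if_true, coe_coe_sign]

theorem sum_integerSystem_inr {k : ℕ} {Y : Fin n → Fin d → SignType} {i i' : Fin n} {l : Fin d}
    (hl : l ∉ commonCols d k) (hi : Y i l ≠ 0) (hi' : Y i' l ≠ 0) (J : Finset (Fin d))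
    (z : Fin d → ℝ) :
    ∑ c ∈ J, (integerSystem k Y (Sum.inr (i, i', l)) c : ℝ) * z c =
      Y i l * lin Y J z i - Y i' l * lin Y J z i' := by
  unfold lin
  rw [Finset.mul_sum, Finset.mul_sum, ← Finset.sum_sub_distrib]
  refine Finset.sum_congr rfl fun c _ => ?_
  have : integerSystem k Y (Sum.inr (i, i', l)) c =
      (Y i l : ℤ) * Y i c - (Y i' l : ℤ) * Y i' c := by
    simp only [integerSystem]
    rw [if_pos ⟨hl, hi, hi'⟩]
  rw [this]
  push_cast
  ring

/-- For two samples with the same long-tail feature `l`, multiplying each equation by its sign at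
`l` and subtracting eliminates the coefficient of `l`. This is the role of the second kind of
equation, and the reason for the entries bounded by `2`. -/
theorem abs_integerSystem_apply_le {k : ℕ} {Y : Fin n → Fin d → SignType} (hY : SingleTail k Y)
    (J : Finset (Fin d)) (z : Fin d → ℝ) {L : ℝ} (hL0 : 0 ≤ L)
    (hL : ∀ i, |lin Y J z i + lin Y (commonCols d k)ᶜ z i| ≤ L)
    (r : Fin n ⊕ (Fin n × Fin n × Fin d)) :
    |∑ c ∈ J, (integerSystem k Y r c : ℝ) * z c| ≤ 2 * L := by
  rcases r with i | ⟨i, i', l⟩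
  · by_cases hi : i ∈ cleanRows k Y
    · rw [sum_integerSystem_inl hi]
      have := hL i
      rw [lin_compl_of_clean hi, add_zero] at this
      linarith
    · simp [integerSystem, hi]; positivity
  · by_cases h : l ∉ commonCols d k ∧ Y i l ≠ 0 ∧ Y i' l ≠ 0
    · obtain ⟨hl, h1, h2⟩ := h
      rw [sum_integerSystem_inr hl h1 h2]
      have e : (Y i l : ℝ) * lin Y J z i - Y i' l * lin Y J z i' =
          Y i l * (lin Y J z i + lin Y (commonCols d k)ᶜ z i) -
            Y i' l * (lin Y J z i' + lin Y (commonCols d k)ᶜ z i') := by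
        rw [lin_compl_of_singleTail hY hl h1, lin_compl_of_singleTail hY hl h2]
        have s1 := coe_sq_of_ne_zero h1
        have s2 := coe_sq_of_ne_zero h2
        linear_combination (-z l) * s1 + z l * s2
      rw [e]
      refine (abs_sub _ _).trans ?_
      rw [abs_mul, abs_mul]
      have h5 := mul_le_mul (abs_coe_le_one (Y i l)) (hL i) (abs_nonneg _) (by norm_num)
      have h6 := mul_le_mul (abs_coe_le_one (Y i' l)) (hL i') (abs_nonneg _) (by norm_num)
      linarith
    · simp only [integerSystem, h, if_false]
      simp; positivity

/-- Solving for the long-tail coefficients. -/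
theorem exists_tail_coefficients {k : ℕ} {Y : Fin n → Fin d → SignType} (hY : SingleTail k Y)
    (J : Finset (Fin d)) (z z' : Fin d → ℝ)
    (h : ∀ r, ∑ c ∈ J, (integerSystem k Y r c : ℝ) * z' c =
      ∑ c ∈ J, (integerSystem k Y r c : ℝ) * z c) {L : ℝ} (hL0 : 0 ≤ L)
    (hL : ∀ i, |lin Y J z i + lin Y (commonCols d k)ᶜ z i - lin Y J z' i| ≤ L) :
    ∃ t : Fin d → ℝ, (∀ l, |t l| ≤ L) ∧ ∀ i, lin Y J z' i + lin Y (commonCols d k)ᶜ t i =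
      lin Y J z i + lin Y (commonCols d k)ᶜ z i := by
  classical
  -- The coefficient of `l` is read off from one sample containing `l`; the equations for pairs make
  -- all other samples containing `l` agree. Features never seen get the coefficient `0`.
  refine ⟨fun l => if h : ∃ i, Y i l ≠ 0 then Y h.choose l *
    (lin Y J z h.choose + lin Y (commonCols d k)ᶜ z h.choose - lin Y J z' h.choose) else 0,
    fun l => ?_, fun i => ?_⟩
  · dsimp only
    split_ifs with hl
    · rw [abs_mul]
      have h5 := mul_le_mul (abs_coe_le_one (Y hl.choose l)) (hL hl.choose) (abs_nonneg _)
        (by norm_num)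
      linarith
    · simpa using hL0
  · by_cases hi : i ∈ cleanRows k Y
    · have := h (Sum.inl i)
      rw [sum_integerSystem_inl hi, sum_integerSystem_inl hi] at this
      rw [lin_compl_of_clean hi, lin_compl_of_clean hi, this]
    · simp only [cleanRows, Finset.mem_filter, Finset.mem_univ, true_and] at hi
      push Not at hi
      obtain ⟨l, hl, hil⟩ := hi
      have hex : ∃ i, Y i l ≠ 0 := ⟨i, hil⟩
      rw [lin_compl_of_singleTail hY hl hil, dif_pos hex]
      have h2 := h (Sum.inr (i, hex.choose, l))
      rw [sum_integerSystem_inr hl hil hex.choose_spec,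
        sum_integerSystem_inr hl hil hex.choose_spec] at h2
      rw [lin_compl_of_singleTail hY hl hex.choose_spec,
        lin_compl_of_singleTail hY hl hil]
      have s1 := coe_sq_of_ne_zero hil
      have s2 := coe_sq_of_ne_zero hex.choose_spec
      linear_combination (Y i l : ℝ) * h2 + (lin Y J z i - lin Y J z' i) * s1 +
        Y i l * z l * s2

/-- The system has `n + n² d` equations; `d ^ 5` is the bound `N` used in Cramer's rule. -/
theorem le_of_system_card {n d : ℕ} (hd : 10 ≤ d) (hnd : n ≤ d) :
    4 * Fintype.card (Fin n ⊕ (Fin n × Fin n × Fin d)) + 1 ≤ d ^ 5 := by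
  simp only [Fintype.card_sum, Fintype.card_prod, Fintype.card_fin]
  have h1 : n * (n * d) ≤ d * (d * d) :=
    Nat.mul_le_mul hnd (Nat.mul_le_mul hnd le_rfl)
  have h2 : d ^ 5 = d * (d * d) * (d * d) := by ring
  have h3 : 100 ≤ d * d := Nat.mul_le_mul hd hd
  have h4 : d ≤ d * (d * d) := Nat.le_mul_of_pos_right _ (by positivity)
  have h5 : d * (d * d) * 100 ≤ d ^ 5 := by rw [h2]; exact Nat.mul_le_mul_left _ h3
  omega

/-- Every vector can be replaced by one with the same image and controlled norm. -/
theorem exists_short_preimage {k : ℕ} {Y : Fin n → Fin d → SignType} (hY : SingleTail k Y)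
    (hd : 10 ≤ d) (hnd : n ≤ d) {δ : Fin d → ℝ} (hδ : ∀ b ∈ commonCols d k, 1 ≤ δ b)
    (z : Fin d → ℝ) :
    ∃ z' : Fin d → ℝ, img (realMat Y) z' = img (realMat Y) z ∧
      ∑ j, z' j ^ 2 ≤ (d : ℝ) ^ (20 * badNum δ Y (cleanRows k Y) (commonCols d k) + 27) *
        ∑ i, img (realMat Y) z i ^ 2 := by
  set K := commonCols d k with hK
  obtain ⟨J, hJK, hJm, hgood⟩ := badNum_spec δ Y (cleanRows k Y) K
  set m := badNum δ Y (cleanRows k Y) K with hm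
  set E := ∑ i, img (realMat Y) z i ^ 2 with hE
  have hE0 : 0 ≤ E := Finset.sum_nonneg fun _ _ => sq_nonneg _
  set U := √E with hU
  have hU0 : 0 ≤ U := Real.sqrt_nonneg _
  have hUsq : U ^ 2 = E := Real.sq_sqrt hE0
  have hd1 : (10 : ℝ) ≤ d := by exact_mod_cast hd
  -- The good coordinates are kept: on clean rows free of `J` their separation bounds them by the
  -- norm `U` of the image. Only the coordinates in `J` and in the tail are solved for again.
  have hz : ∀ b ∈ K \ J, |z b| ≤ U := by
    intro b hb
    apply Real.le_sqrt_of_sq_le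
    rw [sq_abs]
    have h1 := (hgood b hb z).trans (energy_clearRows_le Y hJK z)
    have h2 := hδ b (Finset.mem_sdiff.1 hb).1
    nlinarith [sq_nonneg (z b)]
  set L := 2 * d * U with hL
  have hL0 : 0 ≤ L := by positivity
  have himg : ∀ y i, img (realMat Y) y i =
      lin Y (K \ J) y i + (lin Y J y i + lin Y Kᶜ y i) := by
    intro y i
    rw [img_realMat Y k, lin_sdiff Y hJK]
    ring
  have hw : ∀ i, |lin Y J z i + lin Y Kᶜ z i| ≤ L := by
    intro i
    have e : lin Y J z i + lin Y Kᶜ z i = img (realMat Y) z i - lin Y (K \ J) z i := by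
      rw [himg]; ring
    rw [e]
    refine (abs_sub _ _).trans ?_
    have h1 : |img (realMat Y) z i| ≤ U := by
      apply Real.le_sqrt_of_sq_le
      rw [sq_abs]
      exact Finset.single_le_sum (f := fun i => img (realMat Y) z i ^ 2)
        (fun _ _ => sq_nonneg _) (Finset.mem_univ i)
    have h2 := abs_lin_le Y (K \ J) hz hU0 i
    rw [hL]
    nlinarith
  have hmd : m ≤ d := by
    rw [← hJm]
    simpa using Finset.card_le_univ J
  have hd5 : d ≤ d ^ 5 := Nat.le_self_pow (by norm_num) d
  obtain ⟨b, hb1, hb2⟩ := exists_small_solution (integerSystem k Y) (abs_integerSystem_le k Y)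
    (le_of_system_card hd hnd) (hmd.trans hd5) (by positivity : 0 ≤ 2 * L) J hJm.le z
    (abs_integerSystem_apply_le hY J z hL0 hw)
  set β := ((d ^ 5 : ℕ) : ℝ) ^ (2 * m + 2) * (2 * L) with hβ
  have hβ0 : 0 ≤ β := by positivity
  obtain ⟨t, ht1, ht2⟩ := exists_tail_coefficients hY J z b hb1 (L := L + d * β) (by positivity)
    (fun i => (abs_sub _ _).trans (add_le_add (hw i) (abs_lin_le Y J hb2 hβ0 i)))
  -- Cramer's rule gives `β = 4 d ^ (10 m + 11) U` and hence tail coefficients at most `2 d U + 4 d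
  -- ^ (10 m + 12) U`. Summing `d` squares of size `T²` produces the exponent `20 m + 27`.
  set T := (d : ℝ) ^ (10 * m + 13) * U with hT
  have hbig : L + d * β ≤ T := by
    have e1 : L + d * β = 2 * d * U + 4 * (d : ℝ) ^ (10 * m + 12) * U := by
      rw [hβ, hL]; push_cast; rw [← pow_mul]; ring
    have e2 : (d : ℝ) ≤ (d : ℝ) ^ (10 * m + 12) := le_self_pow₀ (by linarith) (by omega)
    have e3 : T = d * (d : ℝ) ^ (10 * m + 12) * U := by rw [hT]; ring
    rw [e1, e3]
    have e4 : 0 ≤ (d : ℝ) ^ (10 * m + 12) * U := by positivity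
    nlinarith [mul_le_mul_of_nonneg_right e2 hU0]
  have hdβ : β ≤ d * β := by nlinarith
  have hUL : U ≤ L := by rw [hL]; nlinarith
  classical
  refine ⟨fun j => if j ∈ K \ J then z j else if j ∈ J then b j else t j, ?_, ?_⟩
  · funext i
    rw [himg, himg]
    congr 1
    · exact Finset.sum_congr rfl fun j hj => by simp only [hj, if_true]
    · rw [← ht2 i]
      congr 1
      · refine Finset.sum_congr rfl fun j hj => ?_
        have : j ∉ K \ J := fun h => (Finset.mem_sdiff.1 h).2 hj
        simp only [this, hj, if_true, if_false]
      · refine Finset.sum_congr rfl fun j hj => ?_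
        have h1 : j ∉ K := Finset.mem_compl.1 hj
        have h2 : j ∉ K \ J := fun h => h1 (Finset.mem_sdiff.1 h).1
        have h3 : j ∉ J := fun h => h1 (hJK h)
        simp only [h2, h3, if_false]
  · have hle : ∀ j, |(if j ∈ K \ J then z j else if j ∈ J then b j else t j)| ≤ T := by
      intro j
      split_ifs with h1 h2
      · have := hz j h1
        have : 0 ≤ d * β := by positivity
        linarith
      · have := hb2 j h2
        linarith
      · exact (ht1 j).trans hbig
    calc _ ≤ ∑ _j : Fin d, T ^ 2 := Finset.sum_le_sum fun j _ => by
          rw [← sq_abs]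
          exact pow_le_pow_left₀ (abs_nonneg _) (hle j) 2
      _ = d * T ^ 2 := by simp
      _ = _ := by rw [hT, mul_pow, hUsq, ← pow_mul]; ring

/-- The row norms of the pseudoinverse are bounded in terms of the number of bad columns. -/
theorem rowNorm_le_pow {k : ℕ} {Y : Fin n → Fin d → SignType} (hY : SingleTail k Y)
    (hd : 10 ≤ d) (hnd : n ≤ d) {δ : Fin d → ℝ} (hδ : ∀ b ∈ commonCols d k, 1 ≤ δ b) (j : Fin d) :
    rowNorm (realMat Y) j ≤
      (d : ℝ) ^ (20 * badNum δ Y (cleanRows k Y) (commonCols d k) + 27) := by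
  refine rowNorm_le_of_noisePart _ (by positivity) fun ξ => ?_
  obtain ⟨z', h1, h2⟩ := exists_short_preimage hY hd hnd hδ (noisePart (realMat Y) ξ)
  refine le_trans ?_ ((sum_sq_noisePart_le _ ξ h1).trans h2)
  exact Finset.single_le_sum (f := fun j => noisePart (realMat Y) ξ j ^ 2)
    (fun _ _ => sq_nonneg _) (Finset.mem_univ j)

end

end LongTail

namespace LongTail

set_option linter.unusedSectionVars false

noncomputable section

variable {n d : ℕ}

/-! ### Well separated common columns -/

/-- The matrix with all entries outside the rows `I` and the columns `K` replaced by zero. -/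
def subMat (I : Finset (Fin n)) (K : Finset (Fin d)) (Y : Fin n → Fin d → SignType) :
    Fin n → Fin d → ℝ := fun i j => if i ∈ I ∧ j ∈ K then (Y i j : ℝ) else 0

/-- The inverse of the Gram matrix of the columns `K` on the rows `I`. -/
def invGram (I : Finset (Fin n)) (K : Finset (Fin d)) (Y : Fin n → Fin d → SignType)
    (a b : Fin d) : ℝ :=
  if a ∈ K ∧ b ∈ K then ∑ i, pinv (subMat I K Y) a i * pinv (subMat I K Y) b i else 0

/-- The leverage of the row `g` with respect to the columns `K` on the rows `I`. -/
def leverage (I : Finset (Fin n)) (K : Finset (Fin d)) (Y : Fin n → Fin d → SignType)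
    (g : Fin d → SignType) : ℝ :=
  ∑ a, ∑ b, invGram I K Y a b * ((g a : ℝ) * (g b : ℝ))

theorem img_subMat (I : Finset (Fin n)) (K : Finset (Fin d)) (Y : Fin n → Fin d → SignType)
    (z : Fin d → ℝ) (i : Fin n) :
    img (subMat I K Y) z i = if i ∈ I then lin Y K z i else 0 := by
  unfold img subMat lin
  split_ifs with h
  · simp [h, ite_mul, Finset.sum_ite_mem]
  · simp [h]

theorem sum_img_subMat (I : Finset (Fin n)) (K : Finset (Fin d)) (Y : Fin n → Fin d → SignType)
    (z : Fin d → ℝ) : ∑ i, img (subMat I K Y) z i ^ 2 = energy Y I K z := by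
  simp only [img_subMat, ite_pow, ne_eq, OfNat.ofNat_ne_zero, not_false_eq_true, zero_pow]
  rw [Finset.sum_ite_mem, Finset.univ_inter]
  rfl

theorem invGram_congr {I : Finset (Fin n)} {K : Finset (Fin d)} {Y Y' : Fin n → Fin d → SignType}
    (h : ∀ i ∈ I, ∀ b ∈ K, Y i b = Y' i b) : invGram I K Y = invGram I K Y' := by
  have : subMat I K Y = subMat I K Y' := by
    funext i j
    unfold subMat
    split_ifs with hij
    · rw [h i hij.1 j hij.2]
    · rfl
  unfold invGram
  rw [this]

theorem le_of_goodCol {I : Finset (Fin n)} {K : Finset (Fin d)} {Y : Fin n → Fin d → SignType}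
    {δ : Fin d → ℝ} {a : Fin d} (hδ : 0 < δ a) (h : GoodCol δ Y I K a) (z : Fin d → ℝ) :
    z a ^ 2 ≤ 1 / δ a * energy Y I K z := by
  have := h z
  rw [one_div, inv_mul_eq_div, le_div_iff₀ hδ]
  linarith

/-- A diagonal entry is a squared row norm of the pseudoinverse of the submatrix, and separation is
exactly a bound for such a norm. -/
theorem invGram_diag_le {I : Finset (Fin n)} {K : Finset (Fin d)} {Y : Fin n → Fin d → SignType}
    {δ : Fin d → ℝ} {a : Fin d} (hδ : 0 < δ a) (h : GoodCol δ Y I K a) :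
    invGram I K Y a a ≤ 1 / δ a := by
  unfold invGram
  split_ifs
  · refine le_trans (le_of_eq (Finset.sum_congr rfl fun i _ => (sq _).symm))
      (rowNorm_le_of_forall (subMat I K Y) (by positivity) fun z => ?_)
    rw [sum_img_subMat]
    exact le_of_goodCol hδ h z
  · positivity

theorem leverage_nonneg (I : Finset (Fin n)) (K : Finset (Fin d)) (Y : Fin n → Fin d → SignType)
    (g : Fin d → SignType) : 0 ≤ leverage I K Y g := by
  have : leverage I K Y g =
      ∑ i, (∑ a ∈ K, pinv (subMat I K Y) a i * (g a : ℝ)) ^ 2 := by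
    have e : ∀ i, (∑ a ∈ K, pinv (subMat I K Y) a i * (g a : ℝ)) ^ 2 =
        ∑ a ∈ K, ∑ b ∈ K, pinv (subMat I K Y) a i * pinv (subMat I K Y) b i *
          ((g a : ℝ) * (g b : ℝ)) := by
      intro i
      rw [sq, Finset.sum_mul_sum]
      exact Finset.sum_congr rfl fun a _ => Finset.sum_congr rfl fun b _ => by ring
    simp only [e]
    rw [Finset.sum_comm]
    unfold leverage invGram
    rw [← Finset.sum_subset (Finset.subset_univ K)]
    · refine Finset.sum_congr rfl fun a ha => ?_
      rw [Finset.sum_comm, ← Finset.sum_subset (Finset.subset_univ K)]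
      · refine Finset.sum_congr rfl fun b hb => ?_
        rw [if_pos ⟨ha, hb⟩, Finset.sum_mul]
      · intro b _ hb
        rw [if_neg fun h => hb h.2, zero_mul]
    · intro a _ ha
      exact Finset.sum_eq_zero fun b _ => by rw [if_neg fun h => ha h.1, zero_mul]
  rw [this]
  exact Finset.sum_nonneg fun _ _ => sq_nonneg _

/-- Separation of all columns makes kernel vectors of the submatrix vanish on `K`, so the linear
form given by `g` does not see the kernel. -/
theorem sq_lin_le_leverage {I : Finset (Fin n)} {K : Finset (Fin d)}
    {Y : Fin n → Fin d → SignType} {δ : Fin d → ℝ} (hδ : ∀ a ∈ K, 0 < δ a)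
    (h : ∀ a ∈ K, GoodCol δ Y I K a) (g : Fin d → SignType) (z : Fin d → ℝ) :
    (∑ b ∈ K, (g b : ℝ) * z b) ^ 2 ≤ leverage I K Y g * energy Y I K z := by
  have h1 := sq_dotProduct_le (subMat I K Y) (fun b => if b ∈ K then (g b : ℝ) else 0) z
    (fun w hw => by
      have h0 : energy Y I K w = 0 := by
        rw [← sum_img_subMat, hw]; simp
      refine Finset.sum_eq_zero fun b _ => ?_
      dsimp only
      split_ifs with hb
      · have := le_of_goodCol (hδ b hb) (h b hb) w
        rw [h0, mul_zero] at this
        have : w b = 0 := by nlinarith [sq_nonneg (w b)]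
        rw [this, mul_zero]
      · rw [zero_mul])
  rw [sum_img_subMat] at h1
  have e1 : (fun b => if b ∈ K then (g b : ℝ) else 0) ⬝ᵥ z = ∑ b ∈ K, (g b : ℝ) * z b := by
    simp [dotProduct, ite_mul, Finset.sum_ite_mem]
  rw [e1] at h1
  refine h1.trans (le_of_eq ?_)
  congr 1
  unfold leverage invGram
  refine Finset.sum_congr rfl fun a _ => Finset.sum_congr rfl fun b _ => ?_
  by_cases ha : a ∈ K <;> by_cases hb : b ∈ K <;> simp [ha, hb]

/-- The mean leverage of a row which is independent of the rows `I`. -/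
theorem mean_leverage_le {q δ : Fin d → ℝ} (hq : IsProb q) {I : Finset (Fin n)}
    {K : Finset (Fin d)} (hδ : ∀ a ∈ K, 0 < δ a) {i : Fin n} (hi : i ∉ I) :
    mean q (fun Y : Fin n → Fin d → SignType =>
      ind (badNum δ Y I K = 0) * leverage I K Y (Y i)) ≤ ∑ a ∈ K, q a / δ a := by
  -- Row `i` is resampled while the inverse Gram matrix stays fixed. Its entries are uncorrelated,
  -- so only the diagonal contributes to the mean of the quadratic form.
  rw [mean_resample q (fun i' _ => i' = i),
    ← mean_const (ι := Fin n) q (∑ a ∈ K, q a / δ a)]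
  refine mean_mono hq fun Y => ?_
  have e : ∀ Y' : Fin n → Fin d → SignType, ∀ i' ∈ I, ∀ b ∈ K,
      merge (fun i' _ => i' = i) Y' Y i' b = Y i' b := fun Y' i' hi' b _ =>
    merge_of_not (A := fun i' _ => i' = i) (fun h => hi (h ▸ hi')) _ _
  have e2 : ∀ Y' : Fin n → Fin d → SignType, merge (fun i' _ => i' = i) Y' Y i = Y' i :=
    fun Y' => funext fun b => merge_of (A := fun i' _ => i' = i) rfl _ _
  simp only [badNum_congr (e _), leverage, invGram_congr (e _), e2]
  rw [mean_mul_left, mean_row q i (fun g => ∑ a, ∑ b, invGram I K Y a b *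
    ((g a : ℝ) * (g b : ℝ))), rowMean_quad]
  have hnn : 0 ≤ ∑ a ∈ K, q a / δ a :=
    Finset.sum_nonneg fun a ha => div_nonneg (hq a).1 (hδ a ha).le
  by_cases hN : badNum δ Y I K = 0
  · rw [ind_of hN, one_mul, ← Finset.sum_subset (Finset.subset_univ K)]
    · refine Finset.sum_le_sum fun a ha => ?_
      have := invGram_diag_le (hδ a ha) (goodCol_of_badNum_eq_zero hN a ha)
      rw [div_eq_mul_one_div]
      exact mul_le_mul_of_nonneg_left this (hq a).1
    · intro a _ ha
      simp [invGram, ha]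
  · rw [ind_of_not hN, zero_mul]; exact hnn

/-! ### Row norms and kernel components when no common column is bad. -/

section Pointwise

variable {k : ℕ} {Y : Fin n → Fin d → SignType} {δ : Fin d → ℝ}

theorem rowNorm_common_le (hδ : ∀ a ∈ commonCols d k, 0 < δ a)
    (hN : badNum δ Y (cleanRows k Y) (commonCols d k) = 0) {a : Fin d}
    (ha : a ∈ commonCols d k) : rowNorm (realMat Y) a ≤ 1 / δ a := by
  have h0 := hδ a ha
  refine rowNorm_le_of_forall _ (by positivity) fun z => ?_
  refine (le_of_goodCol h0 (goodCol_of_badNum_eq_zero hN a ha) z).trans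
    (mul_le_mul_of_nonneg_left ?_ (by positivity))
  exact (energy_cleanRows_le Y z).trans (Finset.sum_le_sum_of_subset_of_nonneg
    (Finset.subset_univ _) fun _ _ _ => sq_nonneg _)

/-- Up to sign `z l = u - v`, where `u` is the image in row `i` and `v` its common part. Since `v² ≤
h E` with `h` the leverage and `E` the energy on the clean rows, `(u - v)² ≤ (1 + h) (u² + E)`. Row
`i` is not clean, so `u²` and `E` do not overlap. -/
theorem rowNorm_tail_le (hδ : ∀ a ∈ commonCols d k, 0 < δ a) (hY : SingleTail k Y)
    (hN : badNum δ Y (cleanRows k Y) (commonCols d k) = 0) {i : Fin n} {l : Fin d}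
    (hl : l ∉ commonCols d k) (hil : Y i l ≠ 0) :
    rowNorm (realMat Y) l ≤ 1 + leverage (cleanRows k Y) (commonCols d k) Y (Y i) := by
  set K := commonCols d k
  set I := cleanRows k Y with hI
  set h := leverage I K Y (Y i)
  have hh : 0 ≤ h := leverage_nonneg _ _ _ _
  refine rowNorm_le_of_forall _ (by linarith) fun z => ?_
  have h1 := sq_lin_le_leverage hδ (goodCol_of_badNum_eq_zero hN) (Y i) z
  have h2 : img (realMat Y) z i = lin Y K z i + Y i l * z l := by
    rw [img_realMat Y k, lin_compl_of_singleTail hY hl hil]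
  have hiI : i ∉ I := by
    intro hi
    exact hil ((Finset.mem_filter.1 hi).2 l hl)
  have h3 : img (realMat Y) z i ^ 2 + energy Y I K z ≤ ∑ i, img (realMat Y) z i ^ 2 := by
    have := Finset.sum_le_sum_of_subset_of_nonneg (Finset.subset_univ (insert i I))
      (f := fun i => img (realMat Y) z i ^ 2) fun _ _ _ => sq_nonneg _
    rw [Finset.sum_insert hiI] at this
    linarith [energy_cleanRows_le (k := k) Y z]
  have h4 : z l ^ 2 = (img (realMat Y) z i - lin Y K z i) ^ 2 := by
    rw [h2]
    have := coe_sq_of_ne_zero hil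
    linear_combination (-(z l ^ 2)) * this
  rw [h4]
  have h5 : lin Y K z i ^ 2 ≤ h * energy Y I K z := h1
  have hE := energy_nonneg Y I K z
  refine le_trans ?_ (mul_le_mul_of_nonneg_left h3 (by linarith))
  set u := img (realMat Y) z i
  set v := lin Y K z i
  set E := energy Y I K z
  have h6 : (2 * (u * v)) ^ 2 ≤ (h * u ^ 2 + E) ^ 2 := by
    nlinarith [sq_nonneg (h * u ^ 2 - E), mul_le_mul_of_nonneg_left h5 (sq_nonneg u)]
  have h7 := abs_le_of_sq_le_sq' h6 (by positivity)
  nlinarith [h7.1]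

/-- The kernel component has zero image, hence zero energy on the clean rows, and separation leaves
no room for a non-zero coordinate. -/
theorem residual_common (hδ : ∀ a ∈ commonCols d k, 0 < δ a)
    (hN : badNum δ Y (cleanRows k Y) (commonCols d k) = 0) (β : Fin d → ℝ) {a : Fin d}
    (ha : a ∈ commonCols d k) : residual (realMat Y) β a = 0 := by
  have h1 := le_of_goodCol (hδ a ha) (goodCol_of_badNum_eq_zero hN a ha)
    (residual (realMat Y) β)
  have h2 := energy_cleanRows_le (k := k) Y (residual (realMat Y) β)
  rw [img_residual] at h2
  simp only [Pi.zero_apply, ne_eq, OfNat.ofNat_ne_zero, not_false_eq_true, zero_pow,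
    Finset.sum_const_zero] at h2
  have h3 : energy Y (cleanRows k Y) (commonCols d k) (residual (realMat Y) β) = 0 :=
    le_antisymm h2 (energy_nonneg _ _ _ _)
  rw [h3, mul_zero] at h1
  nlinarith [sq_nonneg (residual (realMat Y) β a)]

theorem residual_tail (hδ : ∀ a ∈ commonCols d k, 0 < δ a) (hY : SingleTail k Y)
    (hN : badNum δ Y (cleanRows k Y) (commonCols d k) = 0) (β : Fin d → ℝ) {i : Fin n}
    {l : Fin d} (hl : l ∉ commonCols d k) (hil : Y i l ≠ 0) :
    residual (realMat Y) β l = 0 := by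
  have h1 := congrFun (img_residual (realMat Y) β) i
  have h2 : lin Y (commonCols d k) (residual (realMat Y) β) i = 0 :=
    Finset.sum_eq_zero fun a ha => by rw [residual_common hδ hN β ha, mul_zero]
  rw [img_realMat Y k, lin_compl_of_singleTail hY hl hil, h2, zero_add, Pi.zero_apply] at h1
  have := coe_sq_of_ne_zero hil
  rcases mul_eq_zero.1 h1 with h | h
  · rw [h] at this; norm_num at this
  · exact h

end Pointwise

end

end LongTail

namespace LongTail

set_option linter.unusedSectionVars false

noncomputable section

variable {n d : ℕ}

/-! ### Averaging over the common columns -/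

/-- The parameters for which the common columns are well separated with high probability. -/
structure Regular (d n k : ℕ) (p : ℕ → ℝ) : Prop where
  isFrequency : IsFrequency d p
  ten_le : 10 ≤ d
  samples_le : n ≤ d
  one_le : 1 ≤ k
  common_le : k ≤ d
  many_samples : 8704 * (k : ℝ) ≤ (n : ℝ) / 8
  pow_le_exp : ((d : ℝ) ^ 60) ^ k ≤ Real.exp ((n : ℝ) / 8192)
  sum_le_half : (k : ℝ) * ((d : ℝ) ^ 60 *
    (3 * Real.exp (-(n * p k / 100)) + Real.exp (-(n : ℝ) / 8192))) ≤ 1 / 2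
  eight_le : 8 ≤ n * p k

/-- The separation required of the common columns. -/
def separation (n d : ℕ) (p : ℕ → ℝ) (a : Fin d) : ℝ := n * freq d p a / 8

/-- The sign matrix with the common columns of `H` and the long-tail columns of `Y`. -/
def withTail (k : ℕ) (H Y : Fin n → Fin d → SignType) : Fin n → Fin d → SignType :=
  merge (fun _ j => j ∈ commonCols d k) H Y

theorem withTail_common {k : ℕ} (H Y : Fin n → Fin d → SignType) (i : Fin n) {j : Fin d}
    (hj : j ∈ commonCols d k) : withTail k H Y i j = H i j :=
  merge_of (A := fun _ j => j ∈ commonCols d k) hj _ _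

theorem withTail_tail {k : ℕ} (H Y : Fin n → Fin d → SignType) (i : Fin n) {j : Fin d}
    (hj : j ∉ commonCols d k) : withTail k H Y i j = Y i j :=
  merge_of_not (A := fun _ j => j ∈ commonCols d k) hj _ _

theorem mixHead_realMat (k : ℕ) (H Y : Fin n → Fin d → SignType) :
    mixHead k (realMat H) (realMat Y) = realMat (withTail k H Y) := by
  funext i j
  unfold mixHead realMat
  split_ifs with h
  · rw [withTail_common _ _ _ (mem_commonCols.2 h)]
  · rw [withTail_tail _ _ _ (fun h' => h (mem_commonCols.1 h'))]

theorem cleanRows_withTail (k : ℕ) (H Y : Fin n → Fin d → SignType) :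
    cleanRows k (withTail k H Y) = cleanRows k Y := by
  ext i
  simp only [cleanRows, Finset.mem_filter, Finset.mem_univ, true_and]
  exact forall_congr' fun l => forall_congr' fun hl => by rw [withTail_tail _ _ _ hl]

theorem singleTail_withTail {k : ℕ} {Y : Fin n → Fin d → SignType} (h : SingleTail k Y)
    (H : Fin n → Fin d → SignType) : SingleTail k (withTail k H Y) := by
  intro i l hl l' hl'
  rw [withTail_tail _ _ _ hl, withTail_tail _ _ _ hl']
  exact h i l hl l' hl'

theorem badNum_withTail (δ : Fin d → ℝ) (k : ℕ) (H Y : Fin n → Fin d → SignType)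
    (I : Finset (Fin n)) :
    badNum δ (withTail k H Y) I (commonCols d k) = badNum δ H I (commonCols d k) :=
  badNum_congr fun _ _ _ hb => withTail_common _ _ _ hb

theorem leverage_withTail (k : ℕ) (H Y : Fin n → Fin d → SignType) (I : Finset (Fin n))
    (i : Fin n) :
    leverage I (commonCols d k) (withTail k H Y) (withTail k H Y i) =
      leverage I (commonCols d k) H (H i) := by
  unfold leverage
  rw [invGram_congr (Y' := H) fun _ _ _ hb => withTail_common _ _ _ hb]
  refine Finset.sum_congr rfl fun a _ => Finset.sum_congr rfl fun b _ => ?_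
  by_cases hab : a ∈ commonCols d k ∧ b ∈ commonCols d k
  · rw [withTail_common _ _ _ hab.1, withTail_common _ _ _ hab.2]
  · simp [invGram, hab]

theorem card_commonCols_le (d k : ℕ) : (commonCols d k).card ≤ k := by
  have : (commonCols d k).card ≤ (Finset.range k).card :=
    Finset.card_le_card_of_injOn (fun j => (j : ℕ))
      (fun j hj => by
        have := mem_commonCols.1 (Finset.mem_coe.1 hj)
        simp; omega)
      (fun a _ b _ h => Fin.ext h)
  simpa using this

theorem tailProb_eq (d k : ℕ) (p : ℕ → ℝ) :
    tailProb d k p = ∑ j ∈ (commonCols d k)ᶜ, freq d p j := by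
  unfold tailProb
  refine (Finset.sum_bij (fun (j : Fin d) _ => (j : ℕ) + 1) ?_ ?_ ?_ ?_).symm
  · intro j hj
    have := mt mem_commonCols.2 (Finset.mem_compl.1 hj)
    have := j.2
    simp only [Finset.mem_Ioc]; omega
  · intro a _ b _ h
    exact Fin.ext (by omega)
  · intro i hi
    rw [Finset.mem_Ioc] at hi
    refine ⟨⟨i - 1, by omega⟩, ?_, by simp; omega⟩
    rw [Finset.mem_compl, mem_commonCols]
    simp; omega
  · intro j _
    rfl

/-! ### Mean row norms and mean bias over the common columns. -/

section Regular

variable {k : ℕ} {p : ℕ → ℝ}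

theorem Regular.isProb (h : Regular d n k p) : IsProb (freq d p) := by
  intro j
  have := h.isFrequency.1 (j + 1) (Finset.mem_Icc.2 ⟨by omega, by have := j.2; omega⟩)
  exact ⟨this.1.le, this.2⟩

theorem Regular.le_freq (h : Regular d n k p) {a : Fin d} (ha : a ∈ commonCols d k) :
    p k ≤ freq d p a := by
  have := mem_commonCols.1 ha
  have h1 := h.one_le
  have h2 := h.common_le
  exact h.isFrequency.2 (a + 1) (Finset.mem_Icc.2 ⟨by omega, by omega⟩) k
    (Finset.mem_Icc.2 ⟨h1, h2⟩) this

theorem Regular.samples_pos (h : Regular d n k p) : (0 : ℝ) < n := by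
  have h1 := h.many_samples
  have h2 : (1 : ℝ) ≤ k := by exact_mod_cast h.one_le
  linarith

theorem Regular.one_le_separation (h : Regular d n k p) {a : Fin d} (ha : a ∈ commonCols d k) :
    1 ≤ separation n d p a := by
  have h1 := mul_le_mul_of_nonneg_left (h.le_freq ha) h.samples_pos.le
  have h2 := h.eight_le
  unfold separation
  linarith

theorem Regular.separation_pos (h : Regular d n k p) {a : Fin d} (ha : a ∈ commonCols d k) :
    0 < separation n d p a := lt_of_lt_of_le one_pos (h.one_le_separation ha)

theorem Regular.mean_pow_badNum_le (h : Regular d n k p) {I : Finset (Fin n)}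
    (hI : 3 / 4 * (n : ℝ) ≤ I.card) :
    mean (freq d p) (fun H : Fin n → Fin d → SignType =>
      ((d : ℝ) ^ 60) ^ badNum (separation n d p) H I (commonCols d k)) ≤ 2 := by
  have hd : (10 : ℝ) ≤ d := by exact_mod_cast h.ten_le
  have hK : ((commonCols d k).card : ℝ) ≤ k := by exact_mod_cast card_commonCols_le d k
  have hx : (1 : ℝ) ≤ (d : ℝ) ^ 60 := one_le_pow₀ (by linarith)
  have h1 := LongTail.mean_pow_badNum_le (ι := Fin n) h.isProb (δ := separation n d p) (I := I)
    (K := commonCols d k) (x := (d : ℝ) ^ 60) (ν := n) hx h.samples_pos (fun a _ => rfl) hI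
    (by have := h.many_samples; linarith)
    ((pow_le_pow_right₀ hx (card_commonCols_le d k)).trans h.pow_le_exp) (by
      refine le_trans ?_ h.sum_le_half
      refine (Finset.sum_le_card_nsmul _ _ ((d : ℝ) ^ 60 *
        (3 * Real.exp (-(n * p k / 100)) + Real.exp (-(n : ℝ) / 8192))) fun a ha => ?_).trans ?_
      · have h1 := mul_le_mul_of_nonneg_left (h.le_freq ha) h.samples_pos.le
        have h2 : Real.exp (-(n * freq d p a / 100)) ≤ Real.exp (-(n * p k / 100)) :=
          Real.exp_le_exp.2 (by linarith)
        exact mul_le_mul_of_nonneg_left (by linarith) (by positivity)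
      · rw [nsmul_eq_mul]
        exact mul_le_mul_of_nonneg_right hK (by positivity)) (commonCols d k) subset_rfl I subset_rfl
  simpa using h1

/-- For `N ≥ 1` one has `20 N + 27 + 13 ≤ 60 N`, so the deterministic row norm bound costs at most
`d ^ (-13)` times the exponential moment, which is at most `2`. -/
theorem Regular.mean_bad_le (h : Regular d n k p) {I : Finset (Fin n)}
    (hI : 3 / 4 * (n : ℝ) ≤ I.card) :
    mean (freq d p) (fun H : Fin n → Fin d → SignType =>
      ind (badNum (separation n d p) H I (commonCols d k) ≠ 0) *
        (d : ℝ) ^ (20 * badNum (separation n d p) H I (commonCols d k) + 27)) ≤ 1 / (d : ℝ) ^ 12 := by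
  have hd : (10 : ℝ) ≤ d := by exact_mod_cast h.ten_le
  have h1 : mean (freq d p) (fun H : Fin n → Fin d → SignType =>
      ind (badNum (separation n d p) H I (commonCols d k) ≠ 0) *
        (d : ℝ) ^ (20 * badNum (separation n d p) H I (commonCols d k) + 27)) ≤
      mean (freq d p) (fun H : Fin n → Fin d → SignType => 1 / (d : ℝ) ^ 13 *
        ((d : ℝ) ^ 60) ^ badNum (separation n d p) H I (commonCols d k)) := by
    refine mean_mono h.isProb fun H => ?_
    set N := badNum (separation n d p) H I (commonCols d k)
    by_cases hN : N = 0
    · rw [ind_of_not (by simpa using hN), zero_mul]; positivity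
    · rw [ind_of hN, one_mul, one_div, inv_mul_eq_div, le_div_iff₀ (by positivity), ← pow_add,
        ← pow_mul]
      exact pow_le_pow_right₀ (by linarith) (by omega)
  refine h1.trans ?_
  rw [mean_mul_left]
  refine (mul_le_mul_of_nonneg_left (h.mean_pow_badNum_le hI) (by positivity)).trans ?_
  rw [one_div, inv_mul_eq_div, div_le_div_iff₀ (by positivity) (by positivity), one_mul,
    pow_succ _ 12, mul_comm]
  exact mul_le_mul_of_nonneg_left (by linarith) (by positivity)

theorem Regular.mean_ind_bad_le (h : Regular d n k p) {I : Finset (Fin n)}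
    (hI : 3 / 4 * (n : ℝ) ≤ I.card) :
    mean (freq d p) (fun H : Fin n → Fin d → SignType =>
      ind (badNum (separation n d p) H I (commonCols d k) ≠ 0)) ≤ 1 / (d : ℝ) ^ 12 := by
  have hd : (10 : ℝ) ≤ d := by exact_mod_cast h.ten_le
  refine (mean_mono h.isProb fun H => ?_).trans (h.mean_bad_le hI)
  exact le_mul_of_one_le_right (ind_nonneg _) (one_le_pow₀ (by linarith))

variable {Y : Fin n → Fin d → SignType}

/-- The number of bad common columns, when the common columns are those of `H`. -/
def badCommon (k : ℕ) (p : ℕ → ℝ) (Y H : Fin n → Fin d → SignType) : ℕ :=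
  badNum (separation n d p) H (cleanRows k Y) (commonCols d k)

theorem badNum_withTail_eq (k : ℕ) (p : ℕ → ℝ) (H Y : Fin n → Fin d → SignType) :
    badNum (separation n d p) (withTail k H Y) (cleanRows k (withTail k H Y)) (commonCols d k) =
      badCommon k p Y H := by
  rw [badNum_withTail, cleanRows_withTail]; rfl

theorem Regular.mean_rowNorm_common_le (h : Regular d n k p) {a : Fin d}
    (ha : a ∈ commonCols d k) :
    mean (freq d p) (fun H => ind (badCommon k p Y H = 0) *
      rowNorm (realMat (withTail k H Y)) a) ≤ 1 / separation n d p a := by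
  rw [← mean_const (ι := Fin n) (freq d p) (1 / separation n d p a)]
  refine mean_mono h.isProb fun H => ?_
  have h0 := h.separation_pos ha
  by_cases hN : badCommon k p Y H = 0
  · rw [ind_of hN, one_mul]
    rw [← badNum_withTail_eq] at hN
    exact rowNorm_common_le (fun a ha => h.separation_pos ha) hN ha
  · rw [ind_of_not hN, zero_mul]; positivity

/-- A sample containing `l` is not clean, so its common entries are independent of those in the
clean rows and its mean leverage is at most `8 k / n ≤ 8`. An unseen feature has row norm `0`. -/
theorem Regular.mean_rowNorm_tail_le (h : Regular d n k p) (hY : SingleTail k Y) {l : Fin d}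
    (hl : l ∉ commonCols d k) :
    mean (freq d p) (fun H => ind (badCommon k p Y H = 0) *
      rowNorm (realMat (withTail k H Y)) l) ≤ 9 := by
  by_cases hex : ∃ i, Y i l ≠ 0
  · obtain ⟨i, hi⟩ := hex
    have hiI : i ∉ cleanRows k Y := fun h' => hi ((Finset.mem_filter.1 h').2 l hl)
    have h1 : mean (freq d p) (fun H => ind (badCommon k p Y H = 0) *
        rowNorm (realMat (withTail k H Y)) l) ≤
        mean (freq d p) (fun H => 1 + ind (badCommon k p Y H = 0) *
          leverage (cleanRows k Y) (commonCols d k) H (H i)) := by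
      refine mean_mono h.isProb fun H => ?_
      by_cases hN : badCommon k p Y H = 0
      · rw [ind_of hN, one_mul, one_mul]
        have hN' := hN
        rw [← badNum_withTail_eq] at hN'
        have := rowNorm_tail_le (fun a ha => h.separation_pos ha) (singleTail_withTail hY H) hN'
          hl (i := i) (by rw [withTail_tail _ _ _ hl]; exact hi)
        rwa [leverage_withTail, cleanRows_withTail] at this
      · rw [ind_of_not hN, zero_mul, zero_mul]; norm_num
    refine h1.trans ?_
    rw [mean_add, mean_const]
    have h2 := mean_leverage_le h.isProb (fun a ha => h.separation_pos ha)
      (K := commonCols d k) hiI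
    have h3 : ∑ a ∈ commonCols d k, freq d p a / separation n d p a ≤ 8 := by
      have hn := h.samples_pos
      have e : ∀ a ∈ commonCols d k, freq d p a / separation n d p a ≤ 8 / n := by
        intro a ha
        have h0 := h.separation_pos ha
        rw [div_le_div_iff₀ h0 hn]
        unfold separation
        linarith
      refine (Finset.sum_le_card_nsmul _ _ _ e).trans ?_
      rw [nsmul_eq_mul, mul_div_assoc', div_le_iff₀ hn]
      have hK : ((commonCols d k).card : ℝ) ≤ k := by exact_mod_cast card_commonCols_le d k
      have := h.many_samples
      linarith
    unfold badCommon
    linarith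
  · push Not at hex
    refine (mean_mono h.isProb fun H => ?_).trans (le_of_eq (mean_const (ι := Fin n) _ 9))
    rw [rowNorm_of_zero]
    · simp
    · intro i
      unfold realMat
      rw [withTail_tail _ _ _ hl, hex i]; simp

theorem Regular.mean_rowNorm_bad_le (h : Regular d n k p) (hY : SingleTail k Y)
    (hI : 3 / 4 * (n : ℝ) ≤ (cleanRows k Y).card) (j : Fin d) :
    mean (freq d p) (fun H => ind (badCommon k p Y H ≠ 0) *
      rowNorm (realMat (withTail k H Y)) j) ≤ 1 / (d : ℝ) ^ 12 := by
  refine (mean_mono h.isProb fun H => ?_).trans (h.mean_bad_le hI)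
  refine mul_le_mul_of_nonneg_left ?_ (ind_nonneg _)
  have := rowNorm_le_pow (singleTail_withTail hY H) h.ten_le h.samples_le
    (δ := separation n d p) (fun b hb => h.one_le_separation hb) j
  rwa [badNum_withTail_eq] at this

/-- The mean bias of the estimator. -/
theorem Regular.mean_bias_le (h : Regular d n k p) (hY : SingleTail k Y)
    (hI : 3 / 4 * (n : ℝ) ≤ (cleanRows k Y).card) {β : Fin d → ℝ} {B : ℝ}
    (hβ : ∀ j, |β j| ≤ B) {T : Finset (Fin d)}
    (hT : ∀ j ∈ T, j ∉ commonCols d k ∧ ∃ i, Y i j ≠ 0) :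
    mean (freq d p) (fun H => ∑ j, oodFreq p T j *
      residual (realMat (withTail k H Y)) β j ^ 2) ≤
      B ^ 2 * (tailProb d k p + 1 / (d : ℝ) ^ 2) := by
  have hd : (10 : ℝ) ≤ d := by exact_mod_cast h.ten_le
  have hB : ∀ j, β j ^ 2 ≤ B ^ 2 := fun j => sq_le_sq' (abs_le.1 (hβ j)).1 (abs_le.1 (hβ j)).2
  have hq := h.isProb
  have hpt : 0 ≤ tailProb d k p := by
    rw [tailProb_eq]; exact Finset.sum_nonneg fun j _ => (hq j).1
  have h1 : mean (freq d p) (fun H => ∑ j, oodFreq p T j *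
      residual (realMat (withTail k H Y)) β j ^ 2) ≤
      mean (freq d p) (fun H => B ^ 2 * tailProb d k p + d * B ^ 2 *
        ind (badCommon k p Y H ≠ 0)) := by
    refine mean_mono hq fun H => ?_
    -- Without bad columns only unseen long-tail features contribute; they lie outside `T` and keep
    -- their own frequencies. Otherwise the residual is no longer than `β`, and the small
    -- probability of bad columns absorbs `d B²`.
    by_cases hN : badCommon k p Y H = 0
    · rw [ind_of_not (by simpa using hN), mul_zero, add_zero, tailProb_eq, Finset.mul_sum,
        ← Finset.sum_subset (Finset.subset_univ (commonCols d k)ᶜ)]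
      · refine Finset.sum_le_sum fun j hj => ?_
        have hjK := Finset.mem_compl.1 hj
        rw [← badNum_withTail_eq] at hN
        by_cases hex : ∃ i, Y i j ≠ 0
        · obtain ⟨i, hi⟩ := hex
          rw [residual_tail (fun a ha => h.separation_pos ha) (singleTail_withTail hY H) hN β hjK
            (i := i) (by rw [withTail_tail _ _ _ hjK]; exact hi)]
          have := (hq j).1
          simp only [ne_eq, OfNat.ofNat_ne_zero, not_false_eq_true, zero_pow, mul_zero]
          positivity
        · have hjT : j ∉ T := fun hj => hex (hT j hj).2
          push Not at hex
          rw [residual_of_zero _ _ (fun i => by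
            unfold realMat; rw [withTail_tail _ _ _ hjK, hex i]; simp)]
          have e : oodFreq p T j = freq d p j := by simp [oodFreq, hjT, freq]
          rw [e, mul_comm]
          exact mul_le_mul_of_nonneg_right (hB j) (hq j).1
      · intro j _ hj
        rw [← badNum_withTail_eq] at hN
        rw [residual_common (fun a ha => h.separation_pos ha) hN β (by simpa using hj)]
        simp
    · rw [ind_of hN, mul_one]
      have h2 : ∑ j, oodFreq p T j * residual (realMat (withTail k H Y)) β j ^ 2 ≤
          ∑ j, residual (realMat (withTail k H Y)) β j ^ 2 :=
        Finset.sum_le_sum fun j _ =>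
          mul_le_of_le_one_left (sq_nonneg _) (isProb_oodFreq hq T j).2
      have h3 := sum_sq_residual_le (realMat (withTail k H Y)) β
      have h4 : ∑ j, β j ^ 2 ≤ d * B ^ 2 :=
        (Finset.sum_le_sum fun j _ => hB j).trans (le_of_eq (by simp))
      have : 0 ≤ B ^ 2 * tailProb d k p := by positivity
      linarith
  refine h1.trans ?_
  rw [mean_add, mean_const, mean_mul_left, mul_add]
  have h5 := mul_le_mul_of_nonneg_left (h.mean_ind_bad_le hI) (by positivity : 0 ≤ d * B ^ 2)
  have h6 : d * B ^ 2 * (1 / (d : ℝ) ^ 12) ≤ B ^ 2 * (1 / (d : ℝ) ^ 2) := by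
    rw [mul_comm (d : ℝ), mul_assoc]
    refine mul_le_mul_of_nonneg_left ?_ (sq_nonneg B)
    rw [mul_one_div, div_le_div_iff₀ (by positivity) (by positivity), one_mul, ← pow_succ']
    exact pow_le_pow_right₀ (by linarith) (by norm_num)
  unfold badCommon at *
  linarith

/-- The mean squared noise, weighted by the frequencies. -/
theorem Regular.mean_noise_weight_le (h : Regular d n k p) (hY : SingleTail k Y)
    (hI : 3 / 4 * (n : ℝ) ≤ (cleanRows k Y).card) :
    ∑ j, mean (freq d p) (fun H => (ind (badCommon k p Y H = 0) * freq d p j +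
      ind (badCommon k p Y H ≠ 0)) * rowNorm (realMat (withTail k H Y)) j) ≤
      9 * tailProb d k p + 9 * (k / n) := by
  have hd : (10 : ℝ) ≤ d := by exact_mod_cast h.ten_le
  have hn := h.samples_pos
  have hq := h.isProb
  have e : ∀ j, mean (freq d p) (fun H => (ind (badCommon k p Y H = 0) * freq d p j +
      ind (badCommon k p Y H ≠ 0)) * rowNorm (realMat (withTail k H Y)) j) ≤
      freq d p j * mean (freq d p) (fun H => ind (badCommon k p Y H = 0) *
        rowNorm (realMat (withTail k H Y)) j) + 1 / (d : ℝ) ^ 12 := by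
    intro j
    have := h.mean_rowNorm_bad_le hY hI j
    rw [← mean_mul_left]
    refine le_trans (le_of_eq ?_) (add_le_add_right this _)
    rw [← mean_add]
    congr 1
    funext H
    ring
  refine (Finset.sum_le_sum fun j _ => e j).trans ?_
  rw [Finset.sum_add_distrib, ← Finset.sum_add_sum_compl (commonCols d k)]
  have h1 : ∑ j ∈ commonCols d k, freq d p j * mean (freq d p) (fun H =>
      ind (badCommon k p Y H = 0) * rowNorm (realMat (withTail k H Y)) j) ≤ 8 * (k / n) := by
    have : ∀ j ∈ commonCols d k, freq d p j * mean (freq d p) (fun H =>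
        ind (badCommon k p Y H = 0) * rowNorm (realMat (withTail k H Y)) j) ≤ 8 / n := by
      intro j hj
      refine (mul_le_mul_of_nonneg_left (h.mean_rowNorm_common_le hj) (hq j).1).trans ?_
      have h0 := h.separation_pos hj
      rw [mul_one_div, div_le_div_iff₀ h0 hn]
      unfold separation
      linarith
    refine (Finset.sum_le_card_nsmul _ _ _ this).trans ?_
    rw [nsmul_eq_mul]
    have hK : ((commonCols d k).card : ℝ) ≤ k := by exact_mod_cast card_commonCols_le d k
    calc _ ≤ (k : ℝ) * (8 / n) := mul_le_mul_of_nonneg_right hK (by positivity)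
      _ = _ := by ring
  have h2 : ∑ j ∈ (commonCols d k)ᶜ, freq d p j * mean (freq d p) (fun H =>
      ind (badCommon k p Y H = 0) * rowNorm (realMat (withTail k H Y)) j) ≤
      9 * tailProb d k p := by
    rw [tailProb_eq, Finset.mul_sum]
    refine Finset.sum_le_sum fun j hj => ?_
    have := mul_le_mul_of_nonneg_left
      (h.mean_rowNorm_tail_le hY (Finset.mem_compl.1 hj)) (hq j).1
    linarith
  -- The exceptional contributions of all coordinates together are hidden in one further `k / n`,
  -- whence the factor `9 = 8 + 1`.
  have h3 : ∑ _j : Fin d, 1 / (d : ℝ) ^ 12 ≤ (k : ℝ) / n := by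
    rw [Finset.sum_const, Finset.card_univ, Fintype.card_fin, nsmul_eq_mul, mul_one_div,
      div_le_div_iff₀ (by positivity) hn]
    have hk : (1 : ℝ) ≤ k := by exact_mod_cast h.one_le
    have hnd : (n : ℝ) ≤ d := by exact_mod_cast h.samples_le
    calc (d : ℝ) * n ≤ d * d := mul_le_mul_of_nonneg_left hnd (by positivity)
      _ = (d : ℝ) ^ 2 := (sq _).symm
      _ ≤ (d : ℝ) ^ 12 := pow_le_pow_right₀ (by linarith) (by norm_num)
      _ ≤ k * (d : ℝ) ^ 12 := le_mul_of_one_le_left (by positivity) hk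
  linarith

end Regular

end

end LongTail

namespace LongTail

set_option linter.unusedSectionVars false

noncomputable section

variable {n d k : ℕ} {p : ℕ → ℝ} {Y : Fin n → Fin d → SignType}

/-! ### The loss for typical noise -/

/-- The mean squared noise in the coordinate `l`, when no common column is bad. -/
def coordNoise (k : ℕ) (p : ℕ → ℝ) (Y : Fin n → Fin d → SignType) (ξ : Fin n → ℝ)
    (l : Fin d) : ℝ :=
  mean (freq d p) fun H => ind (badCommon k p Y H = 0) *
    noisePart (realMat (withTail k H Y)) ξ l ^ 2

/-- The mean squared noise, weighted by the frequencies. -/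
def totalNoise (k : ℕ) (p : ℕ → ℝ) (Y : Fin n → Fin d → SignType) (ξ : Fin n → ℝ) : ℝ :=
  ∑ j, mean (freq d p) fun H => (ind (badCommon k p Y H = 0) * freq d p j +
      ind (badCommon k p Y H ≠ 0)) * noisePart (realMat (withTail k H Y)) ξ j ^ 2

/-- Averaged over the common columns, the squared noise is a weighted sum of squares of linear forms
whose total weight is the mean row norm, at most `9`. The factor is `36 = 4 * 9`. -/
theorem Regular.coordNoise_tail (h : Regular d n k p) (hY : SingleTail k Y) {l : Fin d}
    (hl : l ∉ commonCols d k) (σ t : ℝ) :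
    (noiseLaw n σ).real {ξ | 36 * σ ^ 2 * t < coordNoise k p Y ξ l} ≤ 2 * Real.exp (-t) := by
  have h1 := noiseLaw_tail (Finset.univ : Finset (Fin n → Fin d → SignType)) n σ
    (fun H => matWeight (freq d p) H * ind (badCommon k p Y H = 0))
    (fun H => pinv (realMat (withTail k H Y)) l)
    (fun H _ => mul_nonneg (matWeight_nonneg h.isProb H) (ind_nonneg _)) (M := 9) (by norm_num) t
    (by
      refine le_trans (le_of_eq ?_) (h.mean_rowNorm_tail_le hY hl)
      exact Finset.sum_congr rfl fun H _ => mul_assoc _ _ _)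
  have e : ∀ ξ, coordNoise k p Y ξ l = ∑ H : Fin n → Fin d → SignType,
      matWeight (freq d p) H * ind (badCommon k p Y H = 0) *
        (∑ i, pinv (realMat (withTail k H Y)) l i * ξ i) ^ 2 := fun ξ =>
    Finset.sum_congr rfl fun H _ => (mul_assoc _ _ _).symm
  simp only [e]
  norm_num at h1 ⊢
  exact h1

theorem Regular.totalNoise_markov (h : Regular d n k p) (hY : SingleTail k Y)
    (hI : 3 / 4 * (n : ℝ) ≤ (cleanRows k Y).card) (σ : ℝ) {t : ℝ} (ht : 0 < t) :
    (noiseLaw n σ).real {ξ | t * (σ ^ 2 * (9 * tailProb d k p + 9 * (k / n))) <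
      totalNoise k p Y ξ} ≤ 1 / t := by
  have hq := h.isProb
  have hn := h.samples_pos
  have hk : (1 : ℝ) ≤ k := by exact_mod_cast h.one_le
  have hpt : 0 ≤ tailProb d k p := by
    rw [tailProb_eq]; exact Finset.sum_nonneg fun j _ => (hq j).1
  have h1 := noiseLaw_markov
    (Finset.univ : Finset (Fin d × (Fin n → Fin d → SignType))) n σ
    (fun a => matWeight (freq d p) a.2 * (ind (badCommon k p Y a.2 = 0) * freq d p a.1 +
      ind (badCommon k p Y a.2 ≠ 0)))
    (fun a => pinv (realMat (withTail k a.2 Y)) a.1)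
    (fun a _ => mul_nonneg (matWeight_nonneg hq _)
      (add_nonneg (mul_nonneg (ind_nonneg _) (hq _).1) (ind_nonneg _)))
    (M := 9 * tailProb d k p + 9 * (k / n)) (by positivity) ht
    (by
      refine le_trans (le_of_eq ?_) (h.mean_noise_weight_le hY hI)
      rw [Fintype.sum_prod_type]
      exact Finset.sum_congr rfl fun j _ => Finset.sum_congr rfl fun H _ => mul_assoc _ _ _)
  have e : ∀ ξ, totalNoise k p Y ξ = ∑ a : Fin d × (Fin n → Fin d → SignType),
      matWeight (freq d p) a.2 * (ind (badCommon k p Y a.2 = 0) * freq d p a.1 +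
      ind (badCommon k p Y a.2 ≠ 0)) *
        (∑ i, pinv (realMat (withTail k a.2 Y)) a.1 i * ξ i) ^ 2 := by
    intro ξ
    rw [Fintype.sum_prod_type]
    exact Finset.sum_congr rfl fun j _ => Finset.sum_congr rfl fun H _ => (mul_assoc _ _ _).symm
  simp only [e]
  exact h1

/-- The weight of a coordinate is split according to the common columns. If none is bad, it is at
most the frequency plus the indicator of `T`; otherwise it is at most `1`, which the second summand
of `totalNoise` covers. The set `T` then enters only through `coordNoise`. -/
theorem Regular.avgOodLoss_le (h : Regular d n k p) (hY : SingleTail k Y)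
    (hI : 3 / 4 * (n : ℝ) ≤ (cleanRows k Y).card) {β : Fin d → ℝ} {B : ℝ}
    (hβ : ∀ j, |β j| ≤ B) {T : Finset (Fin d)}
    (hT : ∀ j ∈ T, j ∉ commonCols d k ∧ ∃ i, Y i j ≠ 0) (ξ : Fin n → ℝ) :
    avgOodLoss k p β T (realMat Y) ξ ≤ 2 * (B ^ 2 * (tailProb d k p + 1 / (d : ℝ) ^ 2)) +
      2 * (∑ l ∈ T, coordNoise k p Y ξ l + totalNoise k p Y ξ) := by
  have hq := h.isProb
  unfold avgOodLoss
  rw [integral_designLaw hq]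
  simp only [mixHead_realMat, oodLoss_eq hq, betaHat_sub]
  have hpt : ∀ H : Fin n → Fin d → SignType,
      ∑ j, oodFreq p T j * (noisePart (realMat (withTail k H Y)) ξ j -
        residual (realMat (withTail k H Y)) β j) ^ 2 ≤
      2 * ∑ j, oodFreq p T j * residual (realMat (withTail k H Y)) β j ^ 2 +
      2 * (∑ l ∈ T, ind (badCommon k p Y H = 0) * noisePart (realMat (withTail k H Y)) ξ l ^ 2 +
        ∑ j, (ind (badCommon k p Y H = 0) * freq d p j + ind (badCommon k p Y H ≠ 0)) *
          noisePart (realMat (withTail k H Y)) ξ j ^ 2) := by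
    intro H
    have e : ∑ l ∈ T, ind (badCommon k p Y H = 0) *
        noisePart (realMat (withTail k H Y)) ξ l ^ 2 =
        ∑ l, (if l ∈ T then ind (badCommon k p Y H = 0) else 0) *
          noisePart (realMat (withTail k H Y)) ξ l ^ 2 := by
      simp only [ite_mul, zero_mul]
      rw [Finset.sum_ite_mem, Finset.univ_inter]
    rw [e, ← Finset.sum_add_distrib, Finset.mul_sum, Finset.mul_sum, ← Finset.sum_add_distrib]
    refine Finset.sum_le_sum fun j _ => ?_
    set x := noisePart (realMat (withTail k H Y)) ξ j
    set r := residual (realMat (withTail k H Y)) β j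
    have h0 := isProb_oodFreq hq T j
    have h1 : (x - r) ^ 2 ≤ 2 * r ^ 2 + 2 * x ^ 2 := by nlinarith [sq_nonneg (x + r)]
    have h2 : oodFreq p T j ≤ (if j ∈ T then ind (badCommon k p Y H = 0) else 0) +
        (ind (badCommon k p Y H = 0) * freq d p j + ind (badCommon k p Y H ≠ 0)) := by
      have hj := hq j
      by_cases hN : badCommon k p Y H = 0
      · rw [ind_of hN, ind_of_not (by simpa using hN)]
        by_cases hjT : j ∈ T
        · simp only [oodFreq, hjT, if_true]; linarith
        · simp only [oodFreq, hjT, if_false]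
          have : p ((j : ℕ) + 1) = freq d p j := rfl
          linarith
      · rw [ind_of_not hN, ind_of hN]
        simp only [ite_self, zero_mul, zero_add]
        exact h0.2
    have h3 := mul_le_mul_of_nonneg_left h1 h0.1
    have h4 := mul_le_mul_of_nonneg_right h2 (sq_nonneg x)
    linarith
  refine (mean_mono hq hpt).trans ?_
  rw [mean_add, mean_mul_left, mean_mul_left, mean_add]
  have := h.mean_bias_le hY hI hβ hT
  simp only [mean_sum] at this ⊢
  unfold coordNoise totalNoise
  linarith

/-- Subadditivity suffices, so the event need not be measurable. -/
theorem one_sub_le_measureReal {α : Type*} [MeasurableSpace α] (μ : Measure α)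
    [IsProbabilityMeasure μ] (s : Set α) {ε : ℝ} (h : μ.real sᶜ ≤ ε) : 1 - ε ≤ μ.real s := by
  have h1 := measureReal_union_le (μ := μ) s sᶜ
  rw [Set.union_compl_self, probReal_univ] at h1
  linarith

/-- The bound for the averaged loss which holds with high probability. -/
def lossBound (d n k : ℕ) (p : ℕ → ℝ) (B σ : ℝ) (m : ℕ) : ℝ :=
  2 * (B ^ 2 * (tailProb d k p + 1 / (d : ℝ) ^ 2)) +
    2 * (m * (72 * σ ^ 2 * Real.log d) +
      1000 * (σ ^ 2 * (9 * tailProb d k p + 9 * (k / n))))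

theorem Regular.noise_event (h : Regular d n k p) (hd : 10000 ≤ d) (hY : SingleTail k Y)
    (hI : 3 / 4 * (n : ℝ) ≤ (cleanRows k Y).card) {β : Fin d → ℝ} {B : ℝ}
    (hβ : ∀ j, |β j| ≤ B) (σ : ℝ) :
    0.998 ≤ (noiseLaw n σ).real {ξ | ∀ T : Finset (Fin d),
      (∀ j ∈ T, j ∉ commonCols d k ∧ ∃ i, Y i j ≠ 0) →
        avgOodLoss k p β T (realMat Y) ξ ≤ lossBound d n k p B σ T.card} := by
  have hd' : (10000 : ℝ) ≤ d := by exact_mod_cast hd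
  have hP : IsProbabilityMeasure (noiseLaw n σ) := inferInstance
  -- A coordinate then fails with probability at most `2 / d²`, which survives the union bound over
  -- the tail and makes the estimate uniform in `T`.
  set t := 2 * Real.log d with ht
  set bad : Set (Fin n → ℝ) := {ξ | 1000 * (σ ^ 2 * (9 * tailProb d k p + 9 * (k / n))) <
      totalNoise k p Y ξ} ∪ ⋃ l ∈ (commonCols d k)ᶜ, {ξ | 36 * σ ^ 2 * t < coordNoise k p Y ξ l}
    with hbad
  have h1 : (noiseLaw n σ).real bad ≤ 1 / 1000 + 2 / d := by
    refine (measureReal_union_le _ _).trans (add_le_add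
      (h.totalNoise_markov hY hI σ (by norm_num)) ?_)
    refine (measureReal_biUnion_finset_le _ _).trans ?_
    refine (Finset.sum_le_card_nsmul _ _ (2 * Real.exp (-t)) fun l hl =>
      h.coordNoise_tail hY (Finset.mem_compl.1 hl) σ t).trans ?_
    have h2 : ((commonCols d k)ᶜ.card : ℝ) ≤ d := by
      have := Finset.card_le_univ (commonCols d k)ᶜ
      rw [Fintype.card_fin] at this
      exact_mod_cast this
    have h3 : Real.exp (-t) = 1 / (d : ℝ) ^ 2 := by
      rw [ht, Real.exp_neg, two_mul, Real.exp_add, Real.exp_log (by linarith), one_div, sq]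
    rw [nsmul_eq_mul, h3]
    calc _ ≤ (d : ℝ) * (2 * (1 / (d : ℝ) ^ 2)) := mul_le_mul_of_nonneg_right h2 (by positivity)
      _ = 2 / d := by field_simp
  have h2 : (2 : ℝ) / d ≤ 1 / 1000 := by
    rw [div_le_div_iff₀ (by linarith) (by norm_num)]; linarith
  have h3 := one_sub_le_measureReal (noiseLaw n σ) {ξ | ∀ T : Finset (Fin d),
      (∀ j ∈ T, j ∉ commonCols d k ∧ ∃ i, Y i j ≠ 0) →
        avgOodLoss k p β T (realMat Y) ξ ≤ lossBound d n k p B σ T.card} (ε := 1 / 1000 + 2 / d)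
    (by
      refine (measureReal_mono fun ξ hξ => ?_).trans h1
      by_contra hc
      apply hξ
      intro T hT
      simp only [hbad, Set.mem_union, Set.mem_ofPred_eq, Set.mem_iUnion, not_or, not_lt,
        not_exists] at hc
      refine (h.avgOodLoss_le hY hI hβ hT ξ).trans ?_
      unfold lossBound
      have : ∑ l ∈ T, coordNoise k p Y ξ l ≤ T.card * (72 * σ ^ 2 * Real.log d) := by
        rw [← nsmul_eq_mul]
        refine Finset.sum_le_card_nsmul _ _ _ fun l hl => ?_
        have := hc.2 l (Finset.mem_compl.2 (hT l hl).1)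
        rw [ht] at this
        linarith
      linarith [hc.1])
  norm_num at h2 h3 ⊢
  linarith

/-! ### Typical design matrices -/

theorem mean_tail_entry_le (h : Regular d n k p) (i : Fin n) :
    mean (freq d p) (fun Y : Fin n → Fin d → SignType => ind (i ∉ cleanRows k Y)) ≤
      tailProb d k p := by
  rw [tailProb_eq]
  have h1 : mean (freq d p) (fun Y : Fin n → Fin d → SignType => ind (i ∉ cleanRows k Y)) ≤
      mean (freq d p) (fun Y : Fin n → Fin d → SignType =>
        ∑ l ∈ (commonCols d k)ᶜ, (Y i l : ℝ) * (Y i l : ℝ)) := by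
    refine mean_mono h.isProb fun Y => ?_
    have hnn : ∀ l ∈ (commonCols d k)ᶜ, 0 ≤ (Y i l : ℝ) * (Y i l : ℝ) :=
      fun l _ => mul_self_nonneg _
    by_cases hi : i ∈ cleanRows k Y
    · rw [ind_of_not (by simpa using hi)]
      exact Finset.sum_nonneg hnn
    · rw [ind_of hi]
      simp only [cleanRows, Finset.mem_filter, Finset.mem_univ, true_and] at hi
      push Not at hi
      obtain ⟨l, hl, hil⟩ := hi
      refine le_trans (le_of_eq ?_) (Finset.single_le_sum hnn (Finset.mem_compl.2 hl))
      rw [← sq, coe_sq_of_ne_zero hil]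
  refine h1.trans (le_of_eq ?_)
  rw [mean_sum]
  refine Finset.sum_congr rfl fun l _ => ?_
  rw [mean_row (freq d p) i (fun g => (g l : ℝ) * (g l : ℝ)), rowMean_mul_coord, if_pos rfl]

theorem mean_dirty_le (h : Regular d n k p) :
    mean (freq d p) (fun Y : Fin n → Fin d → SignType => ∑ i, ind (i ∉ cleanRows k Y)) ≤
      n * tailProb d k p := by
  rw [mean_sum]
  refine (Finset.sum_le_card_nsmul _ _ _ fun i _ => mean_tail_entry_le h i).trans ?_
  simp

theorem sum_ind_dirty (Y : Fin n → Fin d → SignType) :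
    ∑ i, ind (i ∉ cleanRows k Y) = n - (cleanRows k Y).card := by
  have h1 : ∑ i, ind (i ∈ cleanRows k Y) = (cleanRows k Y).card := by
    have : ∀ i, ind (i ∈ cleanRows k Y) = if i ∈ cleanRows k Y then (1 : ℝ) else 0 := by
      intro i
      by_cases h : i ∈ cleanRows k Y <;> simp [ind, h]
    simp [this]
  simp only [ind_not, Finset.sum_sub_distrib, h1]
  simp

theorem mean_few_clean_le (h : Regular d n k p) :
    mean (freq d p) (fun Y : Fin n → Fin d → SignType =>
      ind (¬3 / 4 * (n : ℝ) ≤ (cleanRows k Y).card)) ≤ 4 * tailProb d k p := by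
  have hn := h.samples_pos
  have h1 := mean_ind_le h.isProb (f := fun Y : Fin n → Fin d → SignType =>
    ∑ i, ind (i ∉ cleanRows k Y)) (fun Y => Finset.sum_nonneg fun i _ => ind_nonneg _)
    (t := n / 4) (by positivity)
  have h2 : mean (freq d p) (fun Y : Fin n → Fin d → SignType =>
      ∑ i, ind (i ∉ cleanRows k Y)) / (n / 4) ≤ 4 * tailProb d k p := by
    rw [div_le_iff₀ (by positivity)]
    linarith [mean_dirty_le (n := n) h]
  refine (mean_mono h.isProb fun Y => ind_mono fun hY => ?_).trans (h1.trans h2)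
  rw [sum_ind_dirty]
  linarith

/-- A union bound over samples and ordered pairs of distinct long-tail features, which occur
independently. This is where smallness of `n p_{>k}²` is required. -/
theorem mean_not_singleTail_le (h : Regular d n k p) :
    mean (freq d p) (fun Y : Fin n → Fin d → SignType => ind (¬SingleTail k Y)) ≤
      n * tailProb d k p ^ 2 := by
  have hq := h.isProb
  set K := commonCols d k with hK
  have h1 : mean (freq d p) (fun Y : Fin n → Fin d → SignType => ind (¬SingleTail k Y)) ≤
      mean (freq d p) (fun Y : Fin n → Fin d → SignType =>
        ∑ i, ∑ l ∈ Kᶜ, ∑ l' ∈ Kᶜ.erase l, (Y i l : ℝ) ^ 2 * (Y i l' : ℝ) ^ 2) := by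
    refine mean_mono hq fun Y => ?_
    have hnn : ∀ i l, 0 ≤ ∑ l' ∈ Kᶜ.erase l, (Y i l : ℝ) ^ 2 * (Y i l' : ℝ) ^ 2 :=
      fun i l => Finset.sum_nonneg fun _ _ => by positivity
    by_cases hY : SingleTail k Y
    · rw [ind_of_not (by simpa using hY)]
      exact Finset.sum_nonneg fun i _ => Finset.sum_nonneg fun l _ => hnn i l
    · rw [ind_of hY]
      unfold SingleTail at hY
      push Not at hY
      obtain ⟨i, l, hl, l', hl', h1, h2, h3⟩ := hY
      refine le_trans ?_ (Finset.single_le_sum (f := fun i => ∑ l ∈ Kᶜ, ∑ l' ∈ Kᶜ.erase l,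
        (Y i l : ℝ) ^ 2 * (Y i l' : ℝ) ^ 2) (fun i _ => Finset.sum_nonneg fun l _ => hnn i l)
        (Finset.mem_univ i))
      refine le_trans ?_ (Finset.single_le_sum (f := fun l => ∑ l' ∈ Kᶜ.erase l,
        (Y i l : ℝ) ^ 2 * (Y i l' : ℝ) ^ 2) (fun l _ => hnn i l) (Finset.mem_compl.2 hl))
      refine le_trans (le_of_eq ?_) (Finset.single_le_sum (f := fun l' =>
        (Y i l : ℝ) ^ 2 * (Y i l' : ℝ) ^ 2) (fun _ _ => by positivity)
        (Finset.mem_erase.2 ⟨Ne.symm h3, Finset.mem_compl.2 hl'⟩))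
      rw [coe_sq_of_ne_zero h1, coe_sq_of_ne_zero h2, one_mul]
  refine h1.trans ?_
  simp only [mean_sum]
  have e : ∀ (i : Fin n), ∀ l ∈ Kᶜ, ∀ l' ∈ Kᶜ.erase l,
      mean (freq d p) (fun Y : Fin n → Fin d → SignType => (Y i l : ℝ) ^ 2 * (Y i l' : ℝ) ^ 2) =
        freq d p l * freq d p l' := by
    intro i l _ l' hl'
    rw [mean_row (freq d p) i (fun g => (g l : ℝ) ^ 2 * (g l' : ℝ) ^ 2),
      rowMean_two (freq d p) (Ne.symm (Finset.ne_of_mem_erase hl')) (fun s => (s : ℝ) ^ 2)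
        (fun s => (s : ℝ) ^ 2), sum_signType, sum_signType]
    simp [signWeight]
  calc _ = ∑ _i : Fin n, ∑ l ∈ Kᶜ, ∑ l' ∈ Kᶜ.erase l, freq d p l * freq d p l' :=
        Finset.sum_congr rfl fun i _ => Finset.sum_congr rfl fun l hl =>
          Finset.sum_congr rfl fun l' hl' => e i l hl l' hl'
    _ ≤ ∑ _i : Fin n, ∑ l ∈ Kᶜ, ∑ l' ∈ Kᶜ, freq d p l * freq d p l' :=
        Finset.sum_le_sum fun i _ => Finset.sum_le_sum fun l _ =>
          Finset.sum_le_sum_of_subset_of_nonneg (Finset.erase_subset _ _) fun _ _ _ =>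
            mul_nonneg (hq _).1 (hq _).1
    _ = n * tailProb d k p ^ 2 := by
      rw [tailProb_eq, sq, Finset.sum_mul_sum]
      simp [hK]

/-- The clean rows depend only on the long-tail columns, so resampling the common columns reduces
the actual matrix to the case of an independent common part. -/
theorem Regular.mean_bad_actual_le (h : Regular d n k p) :
    mean (freq d p) (fun Y : Fin n → Fin d → SignType =>
      ind (3 / 4 * (n : ℝ) ≤ (cleanRows k Y).card) * ind (badCommon k p Y Y ≠ 0)) ≤
      1 / (d : ℝ) ^ 12 := by
  have hd : (10 : ℝ) ≤ d := by exact_mod_cast h.ten_le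
  rw [mean_resample _ (fun _ j => j ∈ commonCols d k),
    ← mean_const (ι := Fin n) (freq d p) (1 / (d : ℝ) ^ 12)]
  refine mean_mono h.isProb fun Y => ?_
  have e1 : ∀ H, cleanRows k (merge (fun _ j => j ∈ commonCols d k) H Y) = cleanRows k Y :=
    fun H => cleanRows_withTail k H Y
  have e2 : ∀ H, badCommon k p (merge (fun _ j => j ∈ commonCols d k) H Y)
      (merge (fun _ j => j ∈ commonCols d k) H Y) = badCommon k p Y H :=
    fun H => badNum_withTail_eq k p H Y
  simp only [e1, e2]
  rw [mean_mul_left]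
  by_cases hI : 3 / 4 * (n : ℝ) ≤ (cleanRows k Y).card
  · rw [ind_of hI, one_mul]
    exact h.mean_ind_bad_le hI
  · rw [ind_of_not hI, zero_mul]; positivity

theorem mem_seen_iff {X : Fin n → Fin d → ℝ} {j : Fin d} : j ∈ seen X ↔ ∃ i, X i j ≠ 0 := by
  simp [seen]

theorem mem_seenCommon_iff {X : Fin n → Fin d → ℝ} {j : Fin d} : j ∈ seenCommon k X ↔
    ∃ i, (∀ l : Fin d, k < (l : ℕ) + 1 → X i l = 0) ∧ X i j ≠ 0 := by
  simp [seenCommon]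

/-- When no common column is bad, all common features appear in clean samples. -/
theorem Regular.mem_seenCommon (h : Regular d n k p) (hN : badCommon k p Y Y = 0) {a : Fin d}
    (ha : a ∈ commonCols d k) : a ∈ seenCommon k (realMat Y) := by
  have hg := goodCol_of_badNum_eq_zero hN a ha (Pi.single a 1)
  have h0 := h.separation_pos ha
  rw [Pi.single_eq_same, one_pow, mul_one] at hg
  have h1 : ∃ i ∈ cleanRows k Y, Y i a ≠ 0 := by
    by_contra hc
    push Not at hc
    have : energy Y (cleanRows k Y) (commonCols d k) (Pi.single a 1) = 0 := by
      refine Finset.sum_eq_zero fun i hi => ?_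
      have : lin Y (commonCols d k) (Pi.single a 1) i = 0 := by
        refine Finset.sum_eq_zero fun b _ => ?_
        by_cases hb : b = a
        · rw [hb, hc i hi]; simp
        · rw [Pi.single_eq_of_ne hb, mul_zero]
      rw [this]; norm_num
    linarith
  obtain ⟨i, hi, hia⟩ := h1
  refine mem_seenCommon_iff.2 ⟨i, fun l hl => ?_, ?_⟩
  · unfold realMat
    rw [(Finset.mem_filter.1 hi).2 l (fun h' => by have := mem_commonCols.1 h'; omega)]
    simp
  · intro h'
    unfold realMat at h'
    have := coe_sq_of_ne_zero hia
    rw [h'] at this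
    norm_num at this

theorem mem_seen {j : Fin d} (hj : j ∈ seen (realMat Y)) : ∃ i, Y i j ≠ 0 := by
  obtain ⟨i, hi⟩ := mem_seen_iff.1 hj
  exact ⟨i, fun h => hi (by unfold realMat; rw [h]; simp)⟩

/-- With high probability, the averaged loss is small for all sets of features which do not
appear in clean samples. -/
theorem Regular.loss_event (h : Regular d n k p) (hd : 10000 ≤ d)
    (hpt : tailProb d k p ≤ 1 / 2000) (hnp : n * tailProb d k p ^ 2 ≤ 1 / 1000)
    {β : Fin d → ℝ} {B : ℝ} (hβ : ∀ j, |β j| ≤ B) (σ : ℝ) :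
    0.99 ≤ (trainLaw n d p σ).real {ω | ∀ T : Finset (Fin d),
      T ⊆ seen ω.1 \ seenCommon k ω.1 →
        avgOodLoss k p β T ω.1 ω.2 ≤ lossBound d n k p B σ T.card} := by
  have hd' : (10000 : ℝ) ≤ d := by exact_mod_cast hd
  have hq := h.isProb
  refine le_trans ?_ (mean_le_trainLaw hq σ _)
  have hpoint : ∀ Y : Fin n → Fin d → SignType,
      0.998 * (1 - ind (¬SingleTail k Y) - ind (¬3 / 4 * (n : ℝ) ≤ (cleanRows k Y).card) -
        ind (3 / 4 * (n : ℝ) ≤ (cleanRows k Y).card) * ind (badCommon k p Y Y ≠ 0)) ≤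
      (noiseLaw n σ).real {ξ | (realMat Y, ξ) ∈
        {ω : (Fin n → Fin d → ℝ) × (Fin n → ℝ) | ∀ T : Finset (Fin d),
      T ⊆ seen ω.1 \ seenCommon k ω.1 →
        avgOodLoss k p β T ω.1 ω.2 ≤ lossBound d n k p B σ T.card}} := by
    intro Y
    have n1 := ind_nonneg (¬SingleTail k Y)
    have n2 := ind_nonneg (¬3 / 4 * (n : ℝ) ≤ (cleanRows k Y).card)
    have n3 := mul_nonneg (ind_nonneg (3 / 4 * (n : ℝ) ≤ (cleanRows k Y).card))
      (ind_nonneg (badCommon k p Y Y ≠ 0))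
    by_cases hgood : SingleTail k Y ∧ 3 / 4 * (n : ℝ) ≤ (cleanRows k Y).card ∧
        badCommon k p Y Y = 0
    · obtain ⟨h1, h2, h3⟩ := hgood
      refine le_trans ?_ ((h.noise_event hd h1 h2 hβ σ).trans (measureReal_mono ?_))
      · linarith
      · intro ξ hξ T hT
        refine hξ T fun j hj => ?_
        obtain ⟨h4, h5⟩ := Finset.mem_sdiff.1 (hT hj)
        exact ⟨fun hjK => h5 (h.mem_seenCommon h3 hjK), mem_seen h4⟩
    · refine le_trans ?_ measureReal_nonneg
      by_cases h1 : SingleTail k Y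
      · by_cases h2 : 3 / 4 * (n : ℝ) ≤ (cleanRows k Y).card
        · have h3 : badCommon k p Y Y ≠ 0 := fun h3 => hgood ⟨h1, h2, h3⟩
          rw [ind_of h2, ind_of h3] at *
          linarith
        · rw [ind_of h2] at *
          linarith
      · rw [ind_of h1] at *
        linarith
  refine le_trans ?_ (mean_mono hq hpoint)
  rw [mean_mul_left, mean_sub, mean_sub, mean_sub, mean_const]
  -- The three failures have probabilities at most `1 / 1000`, `4 / 2000` and `1 / 1000`, and `0.998
  -- * 0.996 ≥ 0.99`.
  have b1 := mean_not_singleTail_le h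
  have b2 := mean_few_clean_le h
  have b3 := h.mean_bad_actual_le
  have b4 : 1 / (d : ℝ) ^ 12 ≤ 1 / 1000 := by
    rw [div_le_div_iff₀ (by positivity) (by norm_num)]
    have : (d : ℝ) ≤ (d : ℝ) ^ 12 := le_self_pow₀ (by linarith) (by norm_num)
    linarith
  norm_num at *
  linarith

/-- Long-tail features are unlikely to appear at all if they are very rare. -/
theorem Regular.no_tail_event (h : Regular d n k p) (hnp : n * tailProb d k p ≤ 1 / 1000)
    (σ : ℝ) :
    0.99 ≤ (trainLaw n d p σ).real {ω | ∀ T : Finset (Fin d),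
      T ⊆ seen ω.1 \ seenCommon k ω.1 → ¬T.Nonempty} := by
  have hq := h.isProb
  refine le_trans ?_ (mean_le_trainLaw hq σ _)
  have hpoint : ∀ Y : Fin n → Fin d → SignType, 1 - ∑ i, ind (i ∉ cleanRows k Y) ≤
      (noiseLaw n σ).real {ξ | (realMat Y, ξ) ∈
        {ω : (Fin n → Fin d → ℝ) × (Fin n → ℝ) | ∀ T : Finset (Fin d),
      T ⊆ seen ω.1 \ seenCommon k ω.1 → ¬T.Nonempty}} := by
    intro Y
    by_cases hc : ∀ i, i ∈ cleanRows k Y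
    · have hu : {ξ : Fin n → ℝ | (realMat Y, ξ) ∈
          {ω : (Fin n → Fin d → ℝ) × (Fin n → ℝ) | ∀ T : Finset (Fin d),
          T ⊆ seen ω.1 \ seenCommon k ω.1 → ¬T.Nonempty}} = Set.univ := by
        refine Set.eq_univ_of_forall fun ξ T hT ⟨j, hj⟩ => ?_
        obtain ⟨h4, h5⟩ := Finset.mem_sdiff.1 (hT hj)
        apply h5
        obtain ⟨i, hi⟩ := mem_seen_iff.1 h4
        refine mem_seenCommon_iff.2 ⟨i, fun l hl => ?_, hi⟩
        show (Y i l : ℝ) = 0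
        rw [(Finset.mem_filter.1 (hc i)).2 l (fun h' => by have := mem_commonCols.1 h'; omega)]
        simp
      rw [hu, probReal_univ]
      have : 0 ≤ ∑ i, ind (i ∉ cleanRows k Y) := Finset.sum_nonneg fun i _ => ind_nonneg _
      linarith
    · push Not at hc
      obtain ⟨i, hi⟩ := hc
      have h1 := Finset.single_le_sum (f := fun i => ind (i ∉ cleanRows k Y))
        (fun i _ => ind_nonneg _) (Finset.mem_univ i)
      rw [ind_of hi] at h1
      exact le_trans (by linarith) measureReal_nonneg
  refine le_trans ?_ (mean_mono hq hpoint)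
  rw [mean_sub, mean_const]
  have := mean_dirty_le (n := n) h
  norm_num at *
  linarith

end

end LongTail

namespace LongTail

set_option linter.unusedSectionVars false

noncomputable section

/-! ### The parameter regime -/

section Regime

variable {d n k : ℕ} {p : ℕ → ℝ}

theorem le_of_log {M : ℝ} (hd : ⌈Real.exp M⌉₊ ≤ d) : M ≤ Real.log d := by
  have h1 : Real.exp M ≤ d := (Nat.le_ceil _).trans (by exact_mod_cast hd)
  exact (Real.le_log_iff_exp_le ((Real.exp_pos M).trans_le h1)).2 h1

theorem Regime.bounds (h : Regime 2 d n k) (hL : 1000000 ≤ Real.log d) :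
    1 ≤ k ∧ (n : ℝ) ≤ d ∧ Real.log d ^ 2 < k ∧ k * Real.log d ^ 2 < n ∧ (1000000 : ℝ) ≤ d := by
  obtain ⟨h1, h2, h3⟩ := h
  have hL2 : 0 < Real.log d ^ 2 := by positivity
  have hk : (0 : ℝ) < k := hL2.trans h1
  have hd : Real.log d ≤ d := Real.log_le_self (by positivity)
  rw [lt_div_iff₀ hL2] at h2
  rw [div_lt_iff₀ hL2, div_mul_eq_mul_div, lt_div_iff₀ (by positivity)] at h3
  refine ⟨by exact_mod_cast hk, ?_, h1, h2, by linarith⟩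
  have h4 : (n : ℝ) * Real.log d ^ 2 < d := by
    have : (n : ℝ) * Real.log d ^ 2 * Real.log d ^ 2 < d * Real.log d ^ 2 := by nlinarith
    exact lt_of_mul_lt_mul_right this hL2.le
  exact (le_mul_of_one_le_right (Nat.cast_nonneg n) (one_le_pow₀ (by linarith))).trans h4.le

/-- `c₁ ln d ≥ 6400` turns `n p_k / 100` into at least `64 ln d`, beating the `d ^ 60` per bad
column and the union over columns. `n > k ln² d ≥ 10⁶ k ln d` supplies the required number of rows
and pays for `(d ^ 60) ^ k`. -/
theorem Regime.regular (h : Regime 2 d n k) (hp : IsFrequency d p) {c₁ : ℝ}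
    (hL : 1000000 ≤ Real.log d) (hc₁ : 6400 ≤ c₁ * Real.log d)
    (hpk : c₁ * Real.log d ^ 2 ≤ n * p k) : Regular d n k p := by
  obtain ⟨hk1, hnd, hLk, hkn, hd⟩ := h.bounds hL
  set L := Real.log d with hLdef
  have hk : (1 : ℝ) ≤ k := by exact_mod_cast hk1
  have hL2 : (1000000 : ℝ) * L ≤ L ^ 2 := by nlinarith
  have hnk : 1000000 * L * k ≤ n := by nlinarith
  have hd0 : (0 : ℝ) < d := by linarith
  have hexp : Real.exp L = d := Real.exp_log hd0
  have hkn' : (k : ℝ) ≤ n := by nlinarith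
  have hpow : ∀ m : ℕ, (d : ℝ) ^ m = Real.exp (m * L) := by
    intro m; rw [← hexp, ← Real.exp_nat_mul]
  refine ⟨hp, ?_, by exact_mod_cast hnd, hk1, ?_, ?_, ?_, ?_, ?_⟩
  · have : (10 : ℝ) ≤ d := by linarith
    exact_mod_cast this
  · exact_mod_cast hkn'.trans hnd
  · nlinarith
  · rw [hpow, ← Real.exp_nat_mul]
    apply Real.exp_le_exp.2
    push_cast
    nlinarith
  · have e1 : Real.exp (-(n * p k / 100)) ≤ 1 / (d : ℝ) ^ 64 := by
      rw [hpow, one_div, ← Real.exp_neg]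
      apply Real.exp_le_exp.2
      push_cast
      nlinarith
    have e2 : Real.exp (-(n : ℝ) / 8192) ≤ 1 / (d : ℝ) ^ 64 := by
      rw [hpow, one_div, ← Real.exp_neg]
      apply Real.exp_le_exp.2
      push_cast
      nlinarith
    calc (k : ℝ) * ((d : ℝ) ^ 60 * (3 * Real.exp (-(n * p k / 100)) +
          Real.exp (-(n : ℝ) / 8192))) ≤ d * ((d : ℝ) ^ 60 * (4 * (1 / (d : ℝ) ^ 64))) := by
          refine mul_le_mul (hkn'.trans hnd) ?_ (by positivity) hd0.le
          exact mul_le_mul_of_nonneg_left (by linarith) (by positivity)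
      _ = 4 / (d : ℝ) ^ 3 := by field_simp
      _ ≤ 1 / 2 := by
        rw [div_le_div_iff₀ (by positivity) (by norm_num)]
        have : (d : ℝ) ≤ (d : ℝ) ^ 3 := le_self_pow₀ (by linarith) (by norm_num)
        linarith
  · nlinarith

theorem tailProb_nonneg (hp : IsFrequency d p) (k : ℕ) : 0 ≤ tailProb d k p :=
  Finset.sum_nonneg fun i hi =>
    (hp.1 i (Finset.mem_Icc.2 ⟨by have := Finset.mem_Ioc.1 hi; omega, (Finset.mem_Ioc.1 hi).2⟩)).1.le

theorem tailProb_le_of_sq {t N : ℝ} (hN : 1000000 ≤ N) (h : N * t ^ 2 ≤ 1 / 1000) :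
    t ≤ 1 / 2000 := by
  by_contra hc
  push Not at hc
  have : (1 / 2000 : ℝ) ^ 2 < t ^ 2 := by
    apply pow_lt_pow_left₀ hc (by norm_num) (by norm_num)
  nlinarith

end Regime

theorem trainLaw_isProbabilityMeasure {n d : ℕ} {p : ℕ → ℝ} {σ : ℝ} (hq : IsProb (freq d p)) :
    IsProbabilityMeasure (trainLaw n d p σ) := by
  have h1 : ∀ j : Fin d, IsProbabilityMeasure (featureLaw (p (j + 1))) := fun j =>
    featureLaw_isProbabilityMeasure (hq j).1 (hq j).2
  have h2 : IsProbabilityMeasure (dataLaw d p) := by unfold dataLaw; infer_instance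
  have h3 : IsProbabilityMeasure (designLaw n d p) := by unfold designLaw; infer_instance
  unfold trainLaw
  infer_instance

/-! ### General frequencies -/

theorem loss_general (c₁ B : ℝ) (hc₁ : 0 < c₁) :
    ∃ d₀ : ℕ, ∀ (d n k : ℕ) (p : ℕ → ℝ) (β : Fin d → ℝ) (σ : ℝ),
      d₀ ≤ d → Regime 2 d n k → IsFrequency d p → (∀ j, |β j| ≤ B) → 0 ≤ σ → σ ≤ 1 →
      c₁ * Real.log d ^ 2 ≤ n * p k → n * tailProb d k p ^ 2 ≤ 1 / 1000 →
      0.99 ≤ (trainLaw n d p σ).real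
        {ω | ∀ T : Finset (Fin d), T ⊆ seen ω.1 \ seenCommon k ω.1 → T.Nonempty →
          avgOodLoss k p β T ω.1 ω.2 ≤ (4 * B ^ 2 + 40000) * (tailProb d k p +
            σ ^ 2 * (T.card : ℝ) * ((k : ℝ) ^ 2 * Real.log d ^ 2 / n + Real.log d))} := by
  refine ⟨⌈Real.exp (1000000 + 6400 / c₁)⌉₊, ?_⟩
  intro d n k p β σ hd hR hp hβ hσ0 hσ1 hpk hnp
  have hL0 := le_of_log hd
  have hc0 : 0 ≤ 6400 / c₁ := by positivity
  have hL : 1000000 ≤ Real.log d := by linarith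
  have hcL : 6400 ≤ c₁ * Real.log d := by
    have : 6400 / c₁ ≤ Real.log d := by linarith
    rw [div_le_iff₀ hc₁] at this
    linarith
  obtain ⟨hk1, hnd, hLk, hkn, hd6⟩ := hR.bounds hL
  have h := hR.regular hp hL hcL hpk
  have hn := h.samples_pos
  have hk : (1 : ℝ) ≤ k := by exact_mod_cast hk1
  have hpt0 := tailProb_nonneg hp k
  have hprob : IsProbabilityMeasure (trainLaw n d p σ) :=
    trainLaw_isProbabilityMeasure h.isProb
  -- If long-tail features are too rare to be seen, no non-empty `T` exists. Otherwise `p_{>k}` is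
  -- at least of order `1 / n`, which gives `n ≥ 10⁶` (as `n p_{>k}²` is small and `k ln² d < n`)
  -- and `1 / d² ≤ p_{>k}`.
  by_cases hsmall : n * tailProb d k p ≤ 1 / 1000
  · refine (h.no_tail_event hsmall σ).trans (measureReal_mono fun ω hω T hT hne => ?_)
    exact absurd hne (hω T hT)
  · push Not at hsmall
    have hn6 : (1000000 : ℝ) ≤ n := by nlinarith
    refine (h.loss_event (by exact_mod_cast (by linarith : (10000 : ℝ) ≤ d))
      (tailProb_le_of_sq hn6 hnp) hnp hβ σ).trans
      (measureReal_mono fun ω hω T hT hne => (hω T hT).trans ?_)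
    unfold lossBound
    set t := tailProb d k p
    set L := Real.log d
    have hm : (1 : ℝ) ≤ T.card := by exact_mod_cast hne.card_pos
    have h1 : 1 / (d : ℝ) ^ 2 ≤ t := by
      rw [div_le_iff₀ (by positivity)]
      have : (n : ℝ) * t * d ≤ t * d ^ 2 := by nlinarith [mul_nonneg hpt0 (by positivity : (0:ℝ) ≤ d)]
      nlinarith
    have h2 : (k : ℝ) / n ≤ 1 := by
      rw [div_le_one hn]
      exact (le_mul_of_one_le_right (by positivity) (one_le_pow₀ (by linarith))).trans hkn.le
    have hσ2 : σ ^ 2 ≤ 1 := pow_le_one₀ hσ0 hσ1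
    have hσ0' : 0 ≤ σ ^ 2 := sq_nonneg σ
    set S := σ ^ 2 * (T.card : ℝ) * L with hS
    have h3 : σ ^ 2 * ((k : ℝ) / n) ≤ S := by
      have : (1 : ℝ) ≤ T.card * L := by nlinarith
      rw [hS, mul_assoc]
      exact mul_le_mul_of_nonneg_left (h2.trans this) hσ0'
    have h4 : σ ^ 2 * t ≤ t := mul_le_of_le_one_left hpt0 hσ2
    have hS0 : 0 ≤ S := le_trans (by positivity) h3
    have h5 : S ≤ σ ^ 2 * (T.card : ℝ) * ((k : ℝ) ^ 2 * L ^ 2 / n + L) := by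
      rw [mul_add]
      have : 0 ≤ σ ^ 2 * (T.card : ℝ) * ((k : ℝ) ^ 2 * L ^ 2 / n) := by positivity
      linarith
    have h6 : B ^ 2 * (t + 1 / (d : ℝ) ^ 2) ≤ B ^ 2 * (2 * t) :=
      mul_le_mul_of_nonneg_left (by linarith) (sq_nonneg B)
    have h7 : (4 * B ^ 2 + 40000) * (t + S) ≤
        (4 * B ^ 2 + 40000) * (t + σ ^ 2 * (T.card : ℝ) * ((k : ℝ) ^ 2 * L ^ 2 / n + L)) :=
      mul_le_mul_of_nonneg_left (by linarith) (by positivity)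
    refine le_trans ?_ h7
    have h8 : 0 ≤ B ^ 2 * S := by positivity
    have e : (T.card : ℝ) * (72 * σ ^ 2 * L) = 72 * S := by rw [hS]; ring
    rw [e]
    nlinarith

end

end LongTail

namespace LongTail

set_option linter.unusedSectionVars false

noncomputable section

/-! ### Power laws -/

section PowerLaw

variable {d : ℕ} {s α : ℝ}

/-- The normalization of the truncated power law. -/
def powerSum (d : ℕ) (α : ℝ) : ℝ := ∑ l ∈ Finset.Icc 1 d, (l : ℝ) ^ (-α)

theorem powerLaw_eq (d : ℕ) (s α : ℝ) (i : ℕ) :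
    powerLaw d s α i = min 1 (s * (i : ℝ) ^ (-α) / powerSum d α) := rfl

theorem one_le_powerSum (hd : 1 ≤ d) (α : ℝ) : 1 ≤ powerSum d α := by
  have := Finset.single_le_sum (f := fun l : ℕ => (l : ℝ) ^ (-α))
    (fun l _ => Real.rpow_nonneg (Nat.cast_nonneg l) _) (Finset.mem_Icc.2 ⟨le_rfl, hd⟩)
  simpa [powerSum] using this

theorem isFrequency_powerLaw (hs : 0 < s) (hα : 0 ≤ α) : IsFrequency d (powerLaw d s α) := by
  refine ⟨fun i hi => ?_, fun i hi j hj hij => ?_⟩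
  · obtain ⟨h1, h2⟩ := Finset.mem_Icc.1 hi
    have hZ := one_le_powerSum (h1.trans h2) α
    have hi0 : (0 : ℝ) < i := by exact_mod_cast h1
    refine ⟨lt_min one_pos (div_pos (mul_pos hs (Real.rpow_pos_of_pos hi0 _))
      (lt_of_lt_of_le one_pos hZ)),
      min_le_left _ _⟩
  · obtain ⟨h1, h2⟩ := Finset.mem_Icc.1 hi
    have hZ := one_le_powerSum (h1.trans h2) α
    have hi0 : (0 : ℝ) < i := by exact_mod_cast h1
    have hij' : (i : ℝ) ≤ j := by exact_mod_cast hij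
    rw [powerLaw_eq, powerLaw_eq]
    refine min_le_min le_rfl (div_le_div_of_nonneg_right ?_ (by linarith))
    exact mul_le_mul_of_nonneg_left
      (Real.rpow_le_rpow_of_nonpos hi0 hij' (by linarith)) hs.le

/-- Beyond `k` one has `i ^ (-α) ≤ k ^ (2 - α) i ^ (-2)`, and the sum of the `i ^ (-2)` telescopes
to at most `1 / k`. -/
theorem sum_tail_rpow_le {k : ℕ} (hk : 1 ≤ k) (hkd : k ≤ d) (hα : 2 ≤ α) :
    ∑ i ∈ Finset.Ioc k d, (i : ℝ) ^ (-α) ≤ k * (k : ℝ) ^ (-α) := by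
  have hk0 : (0 : ℝ) < k := by exact_mod_cast hk
  have h1 : ∀ i ∈ Finset.Ioc k d, (i : ℝ) ^ (-α) ≤ (k : ℝ) ^ (2 - α) * ((i : ℝ) ^ 2)⁻¹ := by
    intro i hi
    have hki : (k : ℝ) ≤ i := by exact_mod_cast (Finset.mem_Ioc.1 hi).1.le
    have hi0 : (0 : ℝ) < i := hk0.trans_le hki
    have e : (i : ℝ) ^ (-α) = (i : ℝ) ^ (2 - α) * ((i : ℝ) ^ 2)⁻¹ := by
      rw [← Real.rpow_natCast, ← Real.rpow_neg hi0.le, ← Real.rpow_add hi0]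
      congr 1
      push_cast
      ring
    rw [e]
    exact mul_le_mul_of_nonneg_right
      (Real.rpow_le_rpow_of_nonpos hk0 hki (by linarith)) (by positivity)
  refine (Finset.sum_le_sum h1).trans ?_
  rw [← Finset.mul_sum]
  have h2 : ∑ i ∈ Finset.Ioc k d, ((i : ℝ) ^ 2)⁻¹ ≤ (k : ℝ)⁻¹ := by
    have := sum_Ioc_inv_sq_le_sub (α := ℝ) (k := k) (n := d) (by omega) hkd
    have : (0 : ℝ) ≤ (d : ℝ)⁻¹ := by positivity
    linarith
  refine (mul_le_mul_of_nonneg_left h2 (Real.rpow_nonneg hk0.le _)).trans (le_of_eq ?_)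
  have e1 : (k : ℝ) ^ (2 - α) = k * k * (k : ℝ) ^ (-α) := by
    rw [sub_eq_add_neg, Real.rpow_add hk0, Real.rpow_two, sq]
  rw [e1]
  field_simp

theorem tailProb_powerLaw_le {k : ℕ} (hs : 0 < s) (hk : 1 ≤ k) (hkd : k ≤ d) (hα : 2 ≤ α)
    (h1 : powerLaw d s α k < 1) :
    tailProb d k (powerLaw d s α) ≤ k * powerLaw d s α k ∧
      powerLaw d s α k ≤ s * (k : ℝ) ^ (-α) := by
  have hZ := one_le_powerSum (hk.trans hkd) α
  have hk0 : (0 : ℝ) < k := by exact_mod_cast hk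
  have e : powerLaw d s α k = s * (k : ℝ) ^ (-α) / powerSum d α := by
    rw [powerLaw_eq] at h1 ⊢
    refine min_eq_right ?_
    by_contra hc
    push Not at hc
    rw [min_eq_left hc.le] at h1
    exact lt_irrefl _ h1
  constructor
  · have h2 : tailProb d k (powerLaw d s α) ≤
        ∑ i ∈ Finset.Ioc k d, s / powerSum d α * (i : ℝ) ^ (-α) :=
      Finset.sum_le_sum fun i _ => by
        rw [powerLaw_eq]
        refine (min_le_right _ _).trans (le_of_eq ?_)
        ring
    rw [← Finset.mul_sum] at h2
    refine h2.trans ?_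
    rw [e]
    refine (mul_le_mul_of_nonneg_left (sum_tail_rpow_le hk hkd hα) (by positivity)).trans
      (le_of_eq ?_)
    ring
  · rw [e]
    exact div_le_self (by positivity) hZ

end PowerLaw

/-! ### The size of the threshold `k` and the resulting exponents. -/

theorem le_rpow_of_powerLaw {k L n s α c₁ : ℝ} (hk : 0 < k) (hL : 0 < L) (hs : 0 < s)
    (hn : 0 < n) (hα : 0 < α) (hc₁ : 0 < c₁) (h : c₁ * L ^ 2 ≤ n * (s * k ^ (-α))) :
    k ≤ (1 / c₁) ^ (1 / α) * (n * s / L ^ 2) ^ (1 / α) := by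
  have hka : 0 < k ^ α := Real.rpow_pos_of_pos hk α
  have h1 : k ^ α ≤ 1 / c₁ * (n * s / L ^ 2) := by
    rw [Real.rpow_neg hk.le, ← mul_assoc, ← div_eq_mul_inv, le_div_iff₀ hka] at h
    rw [one_div, inv_mul_eq_div, div_div, le_div_iff₀ (by positivity)]
    linarith
  rw [← Real.mul_rpow (by positivity) (by positivity)]
  calc k = (k ^ α) ^ (1 / α) := by
        rw [← Real.rpow_mul hk.le, mul_one_div_cancel hα.ne', Real.rpow_one]
    _ ≤ _ := Real.rpow_le_rpow hka.le h1 (by positivity)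

theorem power_bound_eq {L n s α : ℝ} (hL : 0 < L) (hs : 0 < s) (hn : 0 < n) :
    L ^ 2 / n * (n * s / L ^ 2) ^ (1 / α) = s * (L ^ 2 / (n * s)) ^ (1 - 1 / α) := by
  have hv : 0 < L ^ 2 / (n * s) := by positivity
  have e1 : n * s / L ^ 2 = (L ^ 2 / (n * s))⁻¹ := by rw [inv_div]
  rw [e1, Real.inv_rpow hv.le, Real.rpow_sub hv, Real.rpow_one]
  field_simp

/-- With `e = (1 - 2/α) / 12`, both `s` and `L` are below `n ^ e`, so the left side has exponent at
most `(1 + e) (2/α) + 5 e ≤ 2/α + 6 e ≤ 1`. The spare factor `L` later swallows the constants. -/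
theorem sq_mul_pow_four_le {k L n s α c₁ : ℝ} (hk : 0 < k) (hL : 1 ≤ L) (hs : 0 < s)
    (hn : 1 ≤ n) (hα : 2 < α) (hc₁ : 0 < c₁)
    (hkle : k ≤ (1 / c₁) ^ (1 / α) * (n * s / L ^ 2) ^ (1 / α))
    (hsL : s + L < n ^ ((1 - 2 / α) / 12)) :
    k ^ 2 * L ^ 4 * L ≤ ((1 / c₁) ^ (1 / α)) ^ 2 * n := by
  set e := (1 - 2 / α) / 12 with he
  have hα0 : 0 < α := by linarith
  have h2α : 2 / α < 1 := by rw [div_lt_one hα0]; exact hα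
  have h2α0 : 0 < 2 / α := by positivity
  have he0 : 0 < e := by rw [he]; linarith
  have hn0 : 0 < n := by linarith
  set w := n ^ e with hw
  have hw0 : 0 < w := Real.rpow_pos_of_pos hn0 e
  have hs' : s ≤ w := by linarith
  have hL' : L ≤ w := by linarith
  have h1 : n * s / L ^ 2 ≤ n * w := by
    rw [div_le_iff₀ (by positivity)]
    have : 1 ≤ L ^ 2 := one_le_pow₀ hL
    calc n * s ≤ n * w := mul_le_mul_of_nonneg_left hs' hn0.le
      _ ≤ n * w * L ^ 2 := le_mul_of_one_le_right (by positivity) this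
  have h2 : ((n * s / L ^ 2) ^ (1 / α)) ^ 2 ≤ n ^ ((1 + e) * (2 / α)) := by
    rw [← Real.rpow_natCast, ← Real.rpow_mul (by positivity)]
    calc (n * s / L ^ 2) ^ (1 / α * ((2 : ℕ) : ℝ)) ≤ (n * w) ^ (1 / α * ((2 : ℕ) : ℝ)) :=
          Real.rpow_le_rpow (by positivity) h1 (by positivity)
      _ = (n ^ (1 + e)) ^ (1 / α * ((2 : ℕ) : ℝ)) := by
          rw [Real.rpow_add hn0, Real.rpow_one]
      _ = n ^ ((1 + e) * (2 / α)) := by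
          rw [← Real.rpow_mul hn0.le]
          congr 1
          push_cast
          ring
  have h3 : L ^ 4 * L ≤ n ^ (e * 5) := by
    calc L ^ 4 * L = L ^ 5 := by ring
      _ ≤ w ^ 5 := pow_le_pow_left₀ (by linarith) hL' 5
      _ = n ^ (e * 5) := by
        rw [hw, ← Real.rpow_natCast, ← Real.rpow_mul hn0.le]
        norm_num
  have h4 : n ^ ((1 + e) * (2 / α)) * n ^ (e * 5) ≤ n := by
    rw [← Real.rpow_add hn0]
    calc n ^ ((1 + e) * (2 / α) + e * 5) ≤ n ^ (1 : ℝ) := by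
          refine Real.rpow_le_rpow_of_exponent_le hn ?_
          have : e * (2 / α) ≤ e := mul_le_of_le_one_right he0.le h2α.le
          have : 12 * e = 1 - 2 / α := by rw [he]; ring
          linarith
      _ = n := Real.rpow_one n
  have h5 : k ^ 2 ≤ ((1 / c₁) ^ (1 / α)) ^ 2 * n ^ ((1 + e) * (2 / α)) := by
    refine (pow_le_pow_left₀ hk.le hkle 2).trans ?_
    rw [mul_pow]
    exact mul_le_mul_of_nonneg_left h2 (sq_nonneg _)
  calc k ^ 2 * L ^ 4 * L = k ^ 2 * (L ^ 4 * L) := by ring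
    _ ≤ (((1 / c₁) ^ (1 / α)) ^ 2 * n ^ ((1 + e) * (2 / α))) * n ^ (e * 5) :=
      mul_le_mul h5 h3 (by positivity) (by positivity)
    _ = ((1 / c₁) ^ (1 / α)) ^ 2 * (n ^ ((1 + e) * (2 / α)) * n ^ (e * 5)) := by ring
    _ ≤ _ := mul_le_mul_of_nonneg_left h4 (sq_nonneg _)

theorem loss_powerLaw (α c₁ c₂ B : ℝ) (hα : 2 < α) (hc₁ : 0 < c₁) (hc₂ : 0 < c₂) :
    ∃ (d₀ : ℕ) (C : ℝ), 0 < C ∧ ∀ (d n k : ℕ) (s : ℝ) (β : Fin d → ℝ) (σ : ℝ),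
      d₀ ≤ d → Regime 2 d n k → 0 < s →
      s + Real.log d < (n : ℝ) ^ ((1 - 2 / α) / 12) → (∀ j, |β j| ≤ B) → 0 ≤ σ → σ ≤ 1 →
      c₁ * Real.log d ^ 2 ≤ n * powerLaw d s α k → n * powerLaw d s α k ≤ c₂ * Real.log d ^ 2 →
      0.99 ≤ (trainLaw n d (powerLaw d s α) σ).real
        {ω | ∀ T : Finset (Fin d), T ⊆ seen ω.1 \ seenCommon k ω.1 →
          avgOodLoss k (powerLaw d s α) β T ω.1 ω.2 ≤
            C * (s * (Real.log d ^ 2 / (n * s)) ^ (1 - 1 / α) +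
              σ ^ 2 * (T.card : ℝ) * Real.log d)} := by
  have hα0 : 0 < α := by linarith
  set D := (1 / c₁) ^ (1 / α) with hD
  have hD0 : 0 < D := Real.rpow_pos_of_pos (by positivity) _
  -- The summands of the exponent serve in turn the absolute thresholds, regularity, `p_k < 1`, and
  -- `n p_{>k}² ≤ 1 / 1000`.
  refine ⟨⌈Real.exp (1000000 + 6400 / c₁ + c₂ + 1000 * c₂ ^ 2 * D ^ 2)⌉₊,
    (2 * B ^ 2 + 18000) * (c₂ + 1) * D + 144, by positivity, ?_⟩
  intro d n k s β σ hd hR hs hsL hβ hσ0 hσ1 hlow hup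
  have hL0 := le_of_log hd
  have hc0 : 0 ≤ 6400 / c₁ := by positivity
  have hc3 : 0 ≤ 1000 * c₂ ^ 2 * D ^ 2 := by positivity
  have hL : 1000000 ≤ Real.log d := by linarith
  have hcL : 6400 ≤ c₁ * Real.log d := by
    have : 6400 / c₁ ≤ Real.log d := by linarith
    rw [div_le_iff₀ hc₁] at this
    linarith
  obtain ⟨hk1, hnd, hLk, hkn, hd6⟩ := hR.bounds hL
  have hp : IsFrequency d (powerLaw d s α) := isFrequency_powerLaw hs hα0.le
  have h := hR.regular hp hL hcL hlow
  have hn := h.samples_pos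
  have hk : (1 : ℝ) ≤ k := by exact_mod_cast hk1
  have hpt0 := tailProb_nonneg hp k
  have hprob : IsProbabilityMeasure (trainLaw n d (powerLaw d s α) σ) :=
    trainLaw_isProbabilityMeasure h.isProb
  set L := Real.log d with hLdef
  have hL1 : 1 ≤ L := by linarith
  have hLsq : L ≤ L ^ 2 := le_self_pow₀ hL1 (by norm_num)
  have hL2n : L ^ 2 < n := lt_of_le_of_lt (le_mul_of_one_le_left (by positivity) hk) hkn
  have hc2n : c₂ * L ^ 2 < n := by
    have h1 : c₂ ≤ k := by linarith
    exact lt_of_le_of_lt (mul_le_mul_of_nonneg_right h1 (by positivity)) hkn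
  have hp1 : powerLaw d s α k < 1 := by
    have : n * powerLaw d s α k < n * 1 := by linarith
    exact lt_of_mul_lt_mul_left this hn.le
  obtain ⟨ht1, ht2⟩ := tailProb_powerLaw_le hs hk1 h.common_le hα.le hp1
  have hkle := le_rpow_of_powerLaw (k := k) (L := L) (n := n) (by linarith) (by linarith) hs hn hα0
    hc₁ (hlow.trans (mul_le_mul_of_nonneg_left ht2 hn.le))
  rw [← hD] at hkle
  set t := tailProb d k (powerLaw d s α) with ht
  have hnt : n * t ≤ c₂ * k * L ^ 2 := by
    calc n * t ≤ n * (k * powerLaw d s α k) := mul_le_mul_of_nonneg_left ht1 hn.le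
      _ = k * (n * powerLaw d s α k) := by ring
      _ ≤ k * (c₂ * L ^ 2) := mul_le_mul_of_nonneg_left hup (by linarith)
      _ = _ := by ring
  have hn6 : (1000000 : ℝ) ≤ n := by linarith
  have hnp : n * t ^ 2 ≤ 1 / 1000 := by
    have h1 := sq_mul_pow_four_le (k := k) (L := L) (n := n) (by linarith) hL1 hs (by linarith) hα
      hc₁ hkle hsL
    rw [← hD] at h1
    have h2 : (n * t) ^ 2 ≤ (c₂ * k * L ^ 2) ^ 2 :=
      pow_le_pow_left₀ (by positivity) hnt 2
    have h3 : 1000 * c₂ ^ 2 * D ^ 2 ≤ L := by linarith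
    have h4 : (n * t) ^ 2 * L ≤ n * (1 / 1000) * L := by
      calc (n * t) ^ 2 * L ≤ (c₂ * k * L ^ 2) ^ 2 * L :=
            mul_le_mul_of_nonneg_right h2 (by linarith)
        _ = c₂ ^ 2 * (k ^ 2 * L ^ 4 * L) := by ring
        _ ≤ c₂ ^ 2 * (D ^ 2 * n) := mul_le_mul_of_nonneg_left h1 (sq_nonneg _)
        _ = n * (1 / 1000) * (1000 * c₂ ^ 2 * D ^ 2) := by ring
        _ ≤ _ := mul_le_mul_of_nonneg_left h3 (by positivity)
    have h5 : (n * t) ^ 2 ≤ n * (1 / 1000) := le_of_mul_le_mul_right h4 (by linarith)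
    have h6 : n * (n * t ^ 2) ≤ n * (1 / 1000) := by
      calc _ = (n * t) ^ 2 := by ring
        _ ≤ _ := h5
    exact le_of_mul_le_mul_left h6 hn
  refine (h.loss_event (by exact_mod_cast (by linarith : (10000 : ℝ) ≤ d))
    (tailProb_le_of_sq hn6 hnp) hnp hβ σ).trans
    (measureReal_mono fun ω hω T hT => (hω T hT).trans ?_)
  unfold lossBound
  rw [← ht, ← hLdef, ← power_bound_eq (by linarith) hs hn]
  -- `W` dominates every term free of `T`: up to constants it bounds `p_{>k}`, `k / n` and `1 / d²`,
  -- and the bound on `k` turns it into the claimed rate.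
  set W := L ^ 2 * k / n with hW
  have hWY : W ≤ D * (L ^ 2 / n * (n * s / L ^ 2) ^ (1 / α)) := by
    calc W = L ^ 2 / n * k := by rw [hW]; ring
      _ ≤ L ^ 2 / n * (D * (n * s / L ^ 2) ^ (1 / α)) :=
        mul_le_mul_of_nonneg_left hkle (by positivity)
      _ = _ := by ring
  set V := L ^ 2 / n * (n * s / L ^ 2) ^ (1 / α)
  have hW0 : 0 ≤ W := by positivity
  have htW : t ≤ c₂ * W := by
    rw [hW, ← mul_div_assoc, le_div_iff₀ hn]
    linarith
  have hkW : (k : ℝ) / n ≤ W := by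
    rw [hW]
    refine div_le_div_of_nonneg_right ?_ hn.le
    exact le_mul_of_one_le_left (by linarith) (one_le_pow₀ hL1)
  have hdW : 1 / (d : ℝ) ^ 2 ≤ W := by
    refine le_trans ?_ hkW
    rw [div_le_div_iff₀ (by positivity) hn, one_mul]
    have : (d : ℝ) ≤ (d : ℝ) ^ 2 := le_self_pow₀ (by linarith) (by norm_num)
    calc (n : ℝ) ≤ (d : ℝ) ^ 2 := hnd.trans this
      _ ≤ k * (d : ℝ) ^ 2 := le_mul_of_one_le_left (by positivity) hk
  have hσ2 : σ ^ 2 ≤ 1 := pow_le_one₀ hσ0 hσ1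
  have hb1 : B ^ 2 * (t + 1 / (d : ℝ) ^ 2) ≤ B ^ 2 * ((c₂ + 1) * W) :=
    mul_le_mul_of_nonneg_left (by linarith) (sq_nonneg B)
  have hb2 : σ ^ 2 * (9 * t + 9 * (k / n)) ≤ 9 * ((c₂ + 1) * W) := by
    have h1 : 9 * t + 9 * ((k : ℝ) / n) ≤ 9 * ((c₂ + 1) * W) := by linarith
    have h2 : 0 ≤ 9 * t + 9 * ((k : ℝ) / n) := by positivity
    exact (mul_le_of_le_one_left h2 hσ2).trans h1
  have hV0 : 0 ≤ V := by positivity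
  have hS0 : 0 ≤ σ ^ 2 * (T.card : ℝ) * L := by positivity
  have hb3 : (2 * B ^ 2 + 18000) * (c₂ + 1) * W ≤ (2 * B ^ 2 + 18000) * (c₂ + 1) * (D * V) :=
    mul_le_mul_of_nonneg_left hWY (by positivity)
  have hb4 : 0 ≤ (2 * B ^ 2 + 18000) * (c₂ + 1) * D * (σ ^ 2 * (T.card : ℝ) * L) := by positivity
  calc _ ≤ 2 * (B ^ 2 * ((c₂ + 1) * W)) + 2 * ((T.card : ℝ) * (72 * σ ^ 2 * L) +
        1000 * (9 * ((c₂ + 1) * W))) := by linarith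
    _ = (2 * B ^ 2 + 18000) * (c₂ + 1) * W + 144 * (σ ^ 2 * (T.card : ℝ) * L) := by ring
    _ ≤ (2 * B ^ 2 + 18000) * (c₂ + 1) * (D * V) + 144 * (σ ^ 2 * (T.card : ℝ) * L) := by
      linarith
    _ ≤ ((2 * B ^ 2 + 18000) * (c₂ + 1) * D + 144) * (V + σ ^ 2 * (T.card : ℝ) * L) := by
      linarith

end

end LongTail

open LongTail in
theorem theorem4 :
    ∃ c : ℝ, 0 < c ∧
      -- general frequencies
      (∀ c₁ c₂ cp B : ℝ, 0 < c₁ → 0 < c₂ → 0 < cp → 0 < B →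
        ∃ (A d₀ : ℕ) (C : ℝ), 0 < C ∧
          ∀ (d n k : ℕ) (p : ℕ → ℝ) (β : Fin d → ℝ) (σ : ℝ),
            d₀ ≤ d → Regime A d n k → IsFrequency d p →
            (∀ j, |β j| ≤ B) → 0 ≤ σ → σ ≤ 1 →
            c₁ * Real.log d ^ 2 ≤ n * p k → n * p k ≤ c₂ * Real.log d ^ 2 →
            tailProb d k p ≤ 1 - cp → n * tailProb d k p ^ 2 < c →
            0.99 ≤ (trainLaw n d p σ).real
              {ω | ∀ T : Finset (Fin d), T ⊆ seen ω.1 \ seenCommon k ω.1 → T.Nonempty →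
                avgOodLoss k p β T ω.1 ω.2 ≤
                  C * (tailProb d k p +
                    σ ^ 2 * (T.card : ℝ) *
                      ((k : ℝ) ^ 2 * Real.log d ^ 2 / n + Real.log d))}) ∧
      -- power-law frequencies
      (∀ α c₁ c₂ B : ℝ, 2 < α → 0 < c₁ → 0 < c₂ → 0 < B →
        ∃ (A d₀ : ℕ) (c₀ C : ℝ), 0 < c₀ ∧ 0 < C ∧
          ∀ (d n k : ℕ) (s : ℝ) (β : Fin d → ℝ) (σ : ℝ),
            d₀ ≤ d → Regime A d n k → 0 < s → s + Real.log d < (n : ℝ) ^ c₀ →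
            (∀ j, |β j| ≤ B) → 0 ≤ σ → σ ≤ 1 →
            c₁ * Real.log d ^ 2 ≤ n * powerLaw d s α k →
            n * powerLaw d s α k ≤ c₂ * Real.log d ^ 2 →
            0.99 ≤ (trainLaw n d (powerLaw d s α) σ).real
              {ω | ∀ T : Finset (Fin d), T ⊆ seen ω.1 \ seenCommon k ω.1 →
                avgOodLoss k (powerLaw d s α) β T ω.1 ω.2 ≤
                  C * (s * (Real.log d ^ 2 / (n * s)) ^ (1 - 1 / α) +
                    σ ^ 2 * (T.card : ℝ) * Real.log d)}) := by
  -- The absolute constant is the allowed probability that some sample has two long-tail features.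
  refine ⟨1 / 1000, by norm_num, ?_, ?_⟩
  · intro c₁ _ _ B hc₁ _ _ _
    obtain ⟨d₀, h⟩ := loss_general c₁ B hc₁
    refine ⟨2, d₀, 4 * B ^ 2 + 40000, by positivity, ?_⟩
    intro d n k p β σ hd hR hp hβ hσ0 hσ1 hlow _ _ hnp
    exact h d n k p β σ hd hR hp hβ hσ0 hσ1 hlow hnp.le
  · intro α c₁ c₂ B hα hc₁ hc₂ _
    obtain ⟨d₀, C, hC, h⟩ := loss_powerLaw α c₁ c₂ B hα hc₁ hc₂
    have hα1 : 2 / α < 1 := (div_lt_one (by linarith)).2 hα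
    exact ⟨2, d₀, (1 - 2 / α) / 12, C, by linarith, hC,
      fun d n k s β σ hd hR hs hsL hβ hσ0 hσ1 hlow hup =>
        h d n k s β σ hd hR hs hsL hβ hσ0 hσ1 hlow hup⟩
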